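/- **Notation.** Let $p$ be a prime and let $\mathbf c=(c_1\le c_2\le\dots)$ be a non-decreasing sequence of positive integers. Let $A(p,\mathbf c)$ be the group with generators $a_i$ ($i\in\mathbb Z$) and defining relations $a_i^p=1$ ($i\in\mathbb Z$) and $[\dots[[a_{i_0},a_{i_1}],a_{i_2}],\dots,a_{i_{c_n}}]=1$ for all $n\ge 1$ and all $i_0,\dots,i_{c_n}\in\mathbb Z$ with $\max_{j,k}|i_j-i_k|\le n$. Let $G(p,\mathbf c)=A(p,\mathbf c)\rtimes\langle t\rangle$, where $t$ has infinite order and $ta_it^{-1}=a_{i+1}$ for all $i\in\mathbb Z$. For a group $G$ with a finite generating set $S$, a non-principal ultrafilter $\omega$ on $\mathbb N$ and a scaling sequence $d=(d_n)$ (an unbounded non-decreasing sequence of positive reals), $\mathrm{Con}^\omega(G,d)$ denotes the asymptotic cone of $G$ with the word metric of $S$: the set of sequences $(g_n)$ in $G$ with $\sup_n |g_n|_S/d_n<\infty$, with the pseudometric $\lim^\omega |f_n^{-1}g_n|_S/d_n$, where sequences at distance $0$ are identified. An $\mathbb R$-tree is a geodesic metric space in which any two distinct points are joined by a unique topological arc.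 The class of elementary amenable groups is the smallest class of groups that contains all finite and all abelian groups and is closed under subgroups, quotients, extensions and directed unions. **Theorem.** Let $p$ be a prime. 1. For every non-decreasing sequence $\mathbf c$ of positive integers, the group $G=G(p,\mathbf c)$ has the following properties: $G$ is 2-generated; $G$ is (locally nilpotent $p$-group)-by-(infinite cyclic); $G$ is elementary amenable, and amenable; $G$ admits an epimorphism onto the restricted wreath product $(\mathbb Z/p\mathbb Z)\,\mathrm{wr}\,\mathbb Z$; $G$ is not virtually cyclic; $G$ is residually (finite $p$-group) and residually nilpotent. 2. There is a non-decreasing sequence $\mathbf c$ of positive integers such that $G=G(p,\mathbf c)$ has the following two properties. - There is a scaling sequence $d$ such that for every non-principal ultrafilter $\omega$ on $\mathbb N$ and every finite generating set of $G$, the asymptotic cone $\mathrm{Con}^\omega(G,d)$ is an $\mathbb R$-tree. - For every finite generating set of $G$, there are non-principal ultrafilters $\omega_1,\omega_2$ and scaling sequences $d_1,d_2$ such that $\mathrm{Con}^{\omega_1}(G,d_1)$ and $\mathrm{Con}^{\omega_2}(G,d_2)$ are not homeomorphic. In particular, some finitely generated amenable group has two non-homeomorphic asymptotic cones. -/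

import Mathlib

open Filter Topology
open scoped commutatorElement

universe u

/-! ### Group-theoretic properties -/

/-- `G` is generated by (at most) two elements. -/
def IsTwoGenerated (G : Type*) [Group G] : Prop :=
  ∃ a b : G, Subgroup.closure {a, b} = ⊤

/-- `G` has a cyclic subgroup of finite index. -/
def IsVirtuallyCyclic (G : Type*) [Group G] : Prop :=
  ∃ H : Subgroup G, IsCyclic H ∧ H.FiniteIndex

/-- Every finitely generated subgroup of `G` is nilpotent. -/
def IsLocallyNilpotent (G : Type*) [Group G] : Prop :=
  ∀ H : Subgroup G, H.FG → Group.IsNilpotent H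

/-- `G` is (locally nilpotent `p`-group)-by-(infinite cyclic). -/
def IsLocallyNilpotentPGroupByInfiniteCyclic (p : ℕ) (G : Type*) [Group G] : Prop :=
  ∃ (N : Subgroup G) (_ : N.Normal), IsLocallyNilpotent N ∧ IsPGroup p N ∧
    Nonempty (G ⧸ N ≃* Multiplicative ℤ)

/-- `G` is residually (finite `p`-group). -/
def IsResiduallyFinitePGroup (p : ℕ) (G : Type*) [Group G] : Prop :=
  ∀ g : G, g ≠ 1 → ∃ (N : Subgroup G) (_ : N.Normal),
    g ∉ N ∧ Finite (G ⧸ N) ∧ IsPGroup p (G ⧸ N)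

/-- `G` is residually nilpotent. -/
def IsResiduallyNilpotent (G : Type*) [Group G] : Prop :=
  ∀ g : G, g ≠ 1 → ∃ (N : Subgroup G) (_ : N.Normal), g ∉ N ∧ Group.IsNilpotent (G ⧸ N)

/-- The class of elementary amenable groups: the smallest class of groups that contains all finite
and all abelian groups and is closed under subgroups, quotients, extensions and directed unions.
(Subgroups and quotients are taken up to isomorphism, as domains of injective and codomains of
surjective homomorphisms; so the class is closed under isomorphism.) -/
inductive IsElementaryAmenable : (G : Type u) → [Group G] → Prop
  | of_finite (G : Type u) [Group G] [Finite G] : IsElementaryAmenable G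
  | of_comm (G : Type u) [Group G] (h : ∀ a b : G, a * b = b * a) : IsElementaryAmenable G
  | of_injective {G H : Type u} [Group G] [Group H] (f : H →* G) (hf : Function.Injective f)
      (hG : IsElementaryAmenable G) : IsElementaryAmenable H
  | of_surjective {G H : Type u} [Group G] [Group H] (f : G →* H) (hf : Function.Surjective f)
      (hG : IsElementaryAmenable G) : IsElementaryAmenable H
  | of_extension {G : Type u} [Group G] (N : Subgroup G) [N.Normal]
      (hN : IsElementaryAmenable N) (hQ : IsElementaryAmenable (G ⧸ N)) : IsElementaryAmenable G
  | of_directed {G : Type u} [Group G] (K : Set (Subgroup G)) (hne : K.Nonempty)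
      (hdir : DirectedOn (· ≤ ·) K) (hK : ∀ H ∈ K, IsElementaryAmenable H)
      (htop : ∀ g : G, ∃ H ∈ K, g ∈ H) : IsElementaryAmenable G

/-- Amenability of a discrete group: there is a left-invariant finitely additive probability
measure defined on all subsets. -/
def IsAmenableGroup (G : Type*) [Group G] : Prop :=
  ∃ μ : Set G → ℝ, (∀ A, 0 ≤ μ A) ∧ μ Set.univ = 1 ∧
    (∀ A B, Disjoint A B → μ (A ∪ B) = μ A + μ B) ∧
    ∀ (g : G) (A : Set G), μ ((fun x => g * x) '' A) = μ A

/-! ### The groups `A(p, c)`, `G(p, c)` and the wreath product `(ℤ/p) wr ℤ` -/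

/-- The left-normed commutator `[…[[x₀, x₁], x₂], …, xₖ]`. -/
def leftNormedCommutator {G : Type*} [Group G] (x : ℕ → G) : ℕ → G
  | 0 => x 0
  | k + 1 => ⁅leftNormedCommutator x k, x (k + 1)⁆

theorem map_leftNormedCommutator {G H : Type*} [Group G] [Group H] (f : G →* H) (x : ℕ → G)
    (k : ℕ) :
    f (leftNormedCommutator x k) = leftNormedCommutator (fun j => f (x j)) k := by
  induction k with
  | zero => rfl
  | succ k ih => simp [leftNormedCommutator, map_commutatorElement, ih]

/-- The relators `a_i ^ p` (`i ∈ ℤ`) and `[…[a_{i₀}, a_{i₁}], …, a_{i_{c n}}]` for all `n ≥ 1` and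
all indices `i₀, …, i_{c n}` that pairwise differ by at most `n`. -/
def relatorsA (p : ℕ) (c : ℕ+ → ℕ+) : Set (FreeGroup ℤ) :=
  {w | ∃ i : ℤ, w = FreeGroup.of i ^ p} ∪
  {w | ∃ (n : ℕ+) (i : ℕ → ℤ),
    (∀ j ≤ (c n : ℕ), ∀ k ≤ (c n : ℕ), |i j - i k| ≤ (n : ℤ)) ∧
    w = leftNormedCommutator (fun j => FreeGroup.of (i j)) (c n)}

/-- The group `A(p, c)`. -/
abbrev GroupA (p : ℕ) (c : ℕ+ → ℕ+) : Type := PresentedGroup (relatorsA p c)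

namespace GroupA

variable (p : ℕ) (c : ℕ+ → ℕ+)

theorem lift_shift_relators (m : ℤ) :
    ∀ r ∈ relatorsA p c,
      FreeGroup.lift (fun i : ℤ => (PresentedGroup.of (i + m) : GroupA p c)) r = 1 := by
  rintro r (⟨i, rfl⟩ | ⟨n, i, hi, rfl⟩)
  · have h : (PresentedGroup.mk (relatorsA p c)) (FreeGroup.of (i + m) ^ p) = 1 :=
      PresentedGroup.one_of_mem (Or.inl ⟨i + m, rfl⟩)
    rw [map_pow] at h ⊢
    rw [FreeGroup.lift_apply_of]
    exact h
  · have h : (PresentedGroup.mk (relatorsA p c))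
        (leftNormedCommutator (fun j => FreeGroup.of (i j + m)) (c n)) = 1 :=
      PresentedGroup.one_of_mem (Or.inr ⟨n, fun j => i j + m, by simpa using hi, rfl⟩)
    rw [map_leftNormedCommutator] at h ⊢
    simp only [FreeGroup.lift_apply_of]
    exact h

/-- The endomorphism `a_i ↦ a_{i + m}` of `A(p, c)`. -/
def shiftHom (m : ℤ) : GroupA p c →* GroupA p c :=
  PresentedGroup.toGroup (lift_shift_relators p c m)

/-- The automorphism `a_i ↦ a_{i + 1}` of `A(p, c)`. -/
def shift : MulAut (GroupA p c) :=
  MonoidHom.toMulEquiv (shiftHom p c 1) (shiftHom p c (-1))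
    (PresentedGroup.ext fun i => by simp [shiftHom])
    (PresentedGroup.ext fun i => by simp [shiftHom])

theorem shift_of (i : ℤ) :
    shift p c (PresentedGroup.of i) = PresentedGroup.of (i + 1) := by
  simp [shift, shiftHom]

end GroupA

/-- The group `G(p, c)`: the extension of `A(p, c)` by an element `t` of infinite order that acts
by `t a_i t⁻¹ = a_{i + 1}`, that is, the semidirect product of `A(p, c)` and `ℤ`. -/
abbrev GroupG (p : ℕ) (c : ℕ+ → ℕ+) : Type :=
  GroupA p c ⋊[zpowersHom (MulAut (GroupA p c)) (GroupA.shift p c)] Multiplicative ℤ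

/-- The shift by one of the base group `⨁_ℤ ℤ/p` of the wreath product. -/
noncomputable def baseShift (p : ℕ) : MulAut (Multiplicative (ℤ →₀ ZMod p)) :=
  AddEquiv.toMultiplicative (Finsupp.domCongr (Equiv.addRight (1 : ℤ)))

/-- The (restricted) wreath product `(ℤ/p) wr ℤ`. -/
abbrev WreathZModInt (p : ℕ) : Type :=
  Multiplicative (ℤ →₀ ZMod p) ⋊[zpowersHom (MulAut (Multiplicative (ℤ →₀ ZMod p)))
    (baseShift p)] Multiplicative ℤ

/-! ### Word metrics -/

section WordMetric

variable {G : Type*} [Group G]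

/-- `g` is represented by a word of length `n` in the letters `S ∪ S⁻¹`. -/
def IsWordOfLength (S : Set G) (n : ℕ) (g : G) : Prop :=
  ∃ l : List G, l.length = n ∧ (∀ x ∈ l, x ∈ S ∨ x⁻¹ ∈ S) ∧ l.prod = g

/-- The length of a shortest word in `S ∪ S⁻¹` that represents `g`
(used only when `S` generates the group). -/
noncomputable def wordLength (S : Set G) (g : G) : ℕ := sInf {n | IsWordOfLength S n g}

theorem exists_isWordOfLength {S : Set G} (hS : Subgroup.closure S = ⊤) (g : G) :
    ∃ n, IsWordOfLength S n g := by
  have hg : g ∈ Subgroup.closure S := hS ▸ Subgroup.mem_top g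
  rw [← Subgroup.mem_toSubmonoid, Subgroup.closure_toSubmonoid] at hg
  obtain ⟨l, hl, rfl⟩ := Submonoid.exists_list_of_mem_closure hg
  exact ⟨l.length, l, rfl, fun x hx => by simpa using hl x hx, rfl⟩

theorem isWordOfLength_wordLength {S : Set G} (hS : Subgroup.closure S = ⊤) (g : G) :
    IsWordOfLength S (wordLength S g) g :=
  Nat.sInf_mem (exists_isWordOfLength hS g)

theorem wordLength_le {S : Set G} {n : ℕ} {g : G} (h : IsWordOfLength S n g) :
    wordLength S g ≤ n :=
  Nat.sInf_le h

theorem wordLength_one (S : Set G) : wordLength S (1 : G) = 0 :=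
  Nat.le_zero.1 (wordLength_le ⟨[], rfl, by simp, rfl⟩)

theorem wordLength_inv_le {S : Set G} (hS : Subgroup.closure S = ⊤) (g : G) :
    wordLength S g⁻¹ ≤ wordLength S g := by
  obtain ⟨l, hl, hm, hp⟩ := isWordOfLength_wordLength hS g
  refine wordLength_le ⟨(l.map fun x => x⁻¹).reverse, by simpa using hl, ?_, ?_⟩
  · intro x hx
    simp only [List.mem_reverse, List.mem_map] at hx
    obtain ⟨y, hy, rfl⟩ := hx
    simpa using (hm y hy).symm
  · rw [← List.prod_inv_reverse, hp]

theorem wordLength_inv {S : Set G} (hS : Subgroup.closure S = ⊤) (g : G) :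
    wordLength S g⁻¹ = wordLength S g :=
  le_antisymm (wordLength_inv_le hS g) (by simpa using wordLength_inv_le hS g⁻¹)

theorem wordLength_mul_le {S : Set G} (hS : Subgroup.closure S = ⊤) (g h : G) :
    wordLength S (g * h) ≤ wordLength S g + wordLength S h := by
  obtain ⟨l, hl, hm, hp⟩ := isWordOfLength_wordLength hS g
  obtain ⟨l', hl', hm', hp'⟩ := isWordOfLength_wordLength hS h
  refine wordLength_le ⟨l ++ l', by simp [hl, hl'], ?_, by simp [hp, hp']⟩
  intro x hx
  rcases List.mem_append.1 hx with h1 | h1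
  exacts [hm x h1, hm' x h1]

theorem eq_one_of_wordLength_eq_zero {S : Set G} (hS : Subgroup.closure S = ⊤) {g : G}
    (h : wordLength S g = 0) : g = 1 := by
  obtain ⟨l, hl, -, hp⟩ := isWordOfLength_wordLength hS g
  rw [h, List.length_eq_zero_iff] at hl
  rw [← hp, hl, List.prod_nil]

/-- The group `G` with the word metric `dist(f, g) = |f⁻¹ g|` of a generating set `S`. -/
@[nolint unusedArguments]
def WordMetricSpace (S : Set G) (_hS : Subgroup.closure S = ⊤) : Type _ := G

noncomputable instance (S : Set G) (hS : Subgroup.closure S = ⊤) :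
    MetricSpace (WordMetricSpace S hS) where
  dist f g := (wordLength S ((show G from f)⁻¹ * (show G from g)) : ℝ)
  dist_self f := by
    show ((wordLength S ((show G from f)⁻¹ * (show G from f)) : ℕ) : ℝ) = 0
    rw [inv_mul_cancel, wordLength_one, Nat.cast_zero]
  dist_comm f g := by
    show ((wordLength S ((show G from f)⁻¹ * (show G from g)) : ℕ) : ℝ) =
      (wordLength S ((show G from g)⁻¹ * (show G from f)) : ℕ)
    rw [← wordLength_inv hS, mul_inv_rev, inv_inv]
  dist_triangle f g h := by
    show ((wordLength S ((show G from f)⁻¹ * (show G from h)) : ℕ) : ℝ) ≤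
      (wordLength S ((show G from f)⁻¹ * (show G from g)) : ℕ) +
      (wordLength S ((show G from g)⁻¹ * (show G from h)) : ℕ)
    have := wordLength_mul_le hS ((show G from f)⁻¹ * (show G from g))
      ((show G from g)⁻¹ * (show G from h))
    rw [mul_assoc, mul_inv_cancel_left] at this
    exact_mod_cast this
  eq_of_dist_eq_zero {f g} hfg := by
    have h : ((wordLength S ((show G from f)⁻¹ * (show G from g)) : ℕ) : ℝ) = 0 := hfg
    have h1 := eq_one_of_wordLength_eq_zero hS (Nat.cast_eq_zero.1 h)
    exact (inv_mul_eq_one (G := G)).1 h1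

/-- An element of `G`, viewed as a point of `WordMetricSpace S hS`. -/
def WordMetricSpace.of {S : Set G} {hS : Subgroup.closure S = ⊤} (g : G) : WordMetricSpace S hS := g

theorem WordMetricSpace.dist_of {S : Set G} {hS : Subgroup.closure S = ⊤} (f g : G) :
    dist (WordMetricSpace.of f : WordMetricSpace S hS) (WordMetricSpace.of g) =
      wordLength S (f⁻¹ * g) := rfl

end WordMetric

/-! ### Asymptotic cones -/

/-- A scaling sequence: an unbounded non-decreasing sequence of positive real numbers. -/
structure ScalingSequence where
  toFun : ℕ → ℝ
  pos : ∀ n, 0 < toFun n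
  mono : Monotone toFun
  unbounded : ¬ BddAbove (Set.range toFun)

instance : CoeFun ScalingSequence fun _ => ℕ → ℝ := ⟨ScalingSequence.toFun⟩

/-- An ultrafilter on `ℕ` is non-principal if it contains no finite set. -/
def IsNonprincipal (ω : Ultrafilter ℕ) : Prop := ∀ s : Set ℕ, s.Finite → s ∉ ω

/-- The limit `lim^ω x_n` of a (bounded) sequence of real numbers along an ultrafilter. -/
noncomputable def omegaLim (ω : Ultrafilter ℕ) (x : ℕ → ℝ) : ℝ := limUnder (ω : Filter ℕ) x

theorem tendsto_omegaLim (ω : Ultrafilter ℕ) {x : ℕ → ℝ} {a b : ℝ} (ha : ∀ n, a ≤ x n)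
    (hb : ∀ n, x n ≤ b) : Tendsto x ω (𝓝 (omegaLim ω x)) := by
  have h : Set.Icc a b ∈ ω.map x :=
    Ultrafilter.mem_map.2 (Filter.mem_of_superset Filter.univ_mem fun n _ => ⟨ha n, hb n⟩)
  obtain ⟨y, -, hy⟩ := isCompact_Icc.ultrafilter_le_nhds' (ω.map x) h
  exact tendsto_nhds_limUnder ⟨y, hy⟩

section Cone

variable {X : Type*} [MetricSpace X]

/-- The sequences `(x_n)` in `X` that stay at bounded distance from the observation points `e_n`
in the rescaled metrics `dist / d_n`. The ultrafilter is recorded because it determines the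
pseudometric below. -/
structure ConeSeq (ω : Ultrafilter ℕ) (X : Type*) [MetricSpace X] (e : ℕ → X)
    (d : ScalingSequence) where
  toFun : ℕ → X
  bounded : ∃ C : ℝ, ∀ n, dist (toFun n) (e n) / d n ≤ C

instance (ω : Ultrafilter ℕ) (e : ℕ → X) (d : ScalingSequence) :
    CoeFun (ConeSeq ω X e d) fun _ => ℕ → X := ⟨ConeSeq.toFun⟩

theorem ConeSeq.tendsto {ω : Ultrafilter ℕ} {e : ℕ → X} {d : ScalingSequence}
    (f g : ConeSeq ω X e d) :
    Tendsto (fun n => dist (f n) (g n) / d n) ω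
      (𝓝 (omegaLim ω fun n => dist (f n) (g n) / d n)) := by
  obtain ⟨C, hC⟩ := f.bounded
  obtain ⟨D, hD⟩ := g.bounded
  refine tendsto_omegaLim ω (a := 0) (b := C + D)
    (fun n => div_nonneg dist_nonneg (d.pos n).le) fun n => ?_
  calc dist (f n) (g n) / d n
      ≤ (dist (f n) (e n) + dist (g n) (e n)) / d n :=
        div_le_div_of_nonneg_right (dist_triangle_right _ _ _) (d.pos n).le
    _ ≤ C + D := by rw [add_div]; exact add_le_add (hC n) (hD n)

/-- The pseudometric `lim^ω (dist(f_n, g_n) / d_n)`. -/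
noncomputable instance (ω : Ultrafilter ℕ) (e : ℕ → X) (d : ScalingSequence) :
    PseudoMetricSpace (ConeSeq ω X e d) where
  dist f g := omegaLim ω fun n => dist (f n) (g n) / d n
  dist_self f := by
    have h := f.tendsto f
    simp only [dist_self, zero_div] at h
    simpa using tendsto_nhds_unique h tendsto_const_nhds
  dist_comm f g := by simp only [dist_comm]
  dist_triangle f g h := by
    refine le_of_tendsto_of_tendsto' (f.tendsto h) ((f.tendsto g).add (g.tendsto h)) fun n => ?_
    rw [← add_div]
    exact div_le_div_of_nonneg_right (dist_triangle _ _ _) (d.pos n).le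

/-- The asymptotic cone `Con^ω(X, e, d)`: the quotient of the space of sequences above in which
sequences at distance `0` are identified. -/
abbrev AsymptoticCone (ω : Ultrafilter ℕ) (X : Type*) [MetricSpace X] (e : ℕ → X)
    (d : ScalingSequence) : Type _ := SeparationQuotient (ConeSeq ω X e d)

end Cone

/-- The asymptotic cone `Con^ω(G, d)` of a group `G` with the word metric of a generating set `S`
(observed from the identity). -/
abbrev GroupAsymptoticCone {G : Type*} [Group G] (S : Set G) (hS : Subgroup.closure S = ⊤)
    (ω : Ultrafilter ℕ) (d : ScalingSequence) : Type _ :=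
  AsymptoticCone ω (WordMetricSpace S hS) (fun _ => WordMetricSpace.of 1) d

/-! ### `ℝ`-trees -/

/-- Any two points `x, y` are joined by a geodesic, an isometric copy of `[0, dist x y]`. -/
def IsGeodesicSpace (X : Type*) [MetricSpace X] : Prop :=
  ∀ x y : X, ∃ γ : ℝ → X, γ 0 = x ∧ γ (dist x y) = y ∧
    ∀ s ∈ Set.Icc 0 (dist x y), ∀ t ∈ Set.Icc 0 (dist x y), dist (γ s) (γ t) = |s - t|

/-- An `ℝ`-tree: a geodesic metric space in which any two topological arcs with the same endpoints
have the same image (so that two distinct points are joined by a unique arc, a geodesic). -/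
def IsRealTree (X : Type*) [MetricSpace X] : Prop :=
  IsGeodesicSpace X ∧
    ∀ α β : C(unitInterval, X), Function.Injective α → Function.Injective β →
      α 0 = β 0 → α 1 = β 1 → Set.range α = Set.range β

/-! ### Left-normed commutators -/

section LeftNormed

variable {G : Type*} [Group G]

/-! Let `G_N` be the group built like `G(p, c)`, but with only the commutator relations of level at
most `N`. A relation of level `n` lives in a window of `n + 1` consecutive generators, and a window
no wider than an imposed level generates a finite `p`-group
(`finite_and_isPGroup_of_leftNormedCommutator`). Hence `G_N` is an HNN extension of the finite
`p`-group `⟨a_0, …, a_N⟩`, whose stable letter carries `⟨a_0, …, a_{N-1}⟩` to `⟨a_1, …, a_N⟩`. The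
Bass–Serre tree, here a tree of normal-form lists, has finite vertex stabilizers, so `G_N` satisfies
the four-point condition with a constant `δ_N` that depends only on `c_1, …, c_N`
(`LocalModel.exists_fourPoint`).

Moreover `G_N` is residually (finite `p`-group) (`LocalModel.exists_finite_quotient_of_ne_one`). A
finite `p`-group is nilpotent, so it satisfies all long commutator relations. If the later values of
`c` are large enough, a prescribed ball of `G_N` therefore embeds in `G(p, c)`. Thus `c` can be
chosen inductively so that balls whose radii grow much faster than `δ_N` inherit the four-point
condition (`LocalModel.exists_lacunary`). A scaling sequence strictly between the constants and the
radii gives cones that are geodesic and zero-hyperbolic, that is, `ℝ`-trees.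

For a cone that is not a tree, take the increasing finite subgroups `F_n` generated by windows and
scale by the least radius `r_n` of a ball that contains a conjugate of `F_n`. In a tree, the
midpoint of an orbit segment of length `1`, the largest possible, would be fixed by the limit
action, whereas minimality of `r_n` makes some element move it by at least `1`
(`exists_not_isRealTree`). Cones of groups are always geodesic and uniqueness of arcs is
topological, so neither a homeomorphism nor a change of finite generating set affects whether a cone
is a tree.

The algebraic properties in the first half follow from writing `A(p, c)` as the directed union of
its finite windows. `LocalModel` treats the groups with all levels and with levels at most `N`
alike. -/

theorem leftNormedCommutator_congr {x y : ℕ → G} {k : ℕ} (h : ∀ j ≤ k, x j = y j) :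
    leftNormedCommutator x k = leftNormedCommutator y k := by
  induction k with
  | zero => exact h 0 le_rfl
  | succ k ih =>
    simp only [leftNormedCommutator]
    rw [ih fun j hj => h j (hj.trans k.le_succ), h (k + 1) le_rfl]

theorem leftNormedCommutator_eq_one_of_eq_one {x : ℕ → G} {j k : ℕ} (hjk : j ≤ k)
    (h : x j = 1) : leftNormedCommutator x k = 1 := by
  induction k with
  | zero => obtain rfl := Nat.le_zero.1 hjk; exact h
  | succ k ih =>
    simp only [leftNormedCommutator]
    rcases Nat.le_succ_iff.1 hjk with hj | rfl
    · rw [ih hj, commutatorElement_one_left]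
    · rw [h, commutatorElement_one_right]

theorem leftNormedCommutator_mem_lowerCentralSeries (x : ℕ → G) (k : ℕ) :
    leftNormedCommutator x k ∈ (⊤ : Subgroup G).lowerCentralSeries k := by
  induction k with
  | zero => simp
  | succ k ih =>
    rw [Subgroup.lowerCentralSeries_succ]
    exact Subgroup.subset_closure ⟨_, ih, _, Subgroup.mem_top _, rfl⟩

theorem commutatorElement_pow_right_of_commute {u x : G} (h : Commute ⁅u, x⁆ x) (n : ℕ) :
    ⁅u, x ^ n⁆ = ⁅u, x⁆ ^ n := by
  have h1 : u * x * u⁻¹ = ⁅u, x⁆ * x := by simp [commutatorElement_def]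
  have h2 : u * x ^ n * u⁻¹ = (u * x * u⁻¹) ^ n := by rw [conj_pow]
  rw [commutatorElement_def, h2, h1, h.mul_pow, mul_inv_cancel_right]

/-- Induction on `c`. The longest possibly nontrivial commutators of generators commute with all
generators, hence are central, and have exponent `p` because `[u, x]^p = [u, x^p]` when `[u, x]` is
central. They are finitely many, so they generate a finite central `p`-subgroup, and in the quotient
by it the bound on `c` drops by one. -/
theorem finite_and_isPGroup_of_leftNormedCommutator {p : ℕ} (hp : p.Prime) (c : ℕ) :
    ∀ {H : Type*} [Group H] (X : Set H), X.Finite → Subgroup.closure X = ⊤ →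
      (∀ x ∈ X, x ^ p = 1) →
      (∀ x : ℕ → H, (∀ j, x j ∈ X) → leftNormedCommutator x c = 1) →
      Finite H ∧ IsPGroup p H := by
  induction c with
  | zero =>
    intro H _ X _ hgen _ hX
    have h1 : Subgroup.closure X = ⊥ := by
      rw [Subgroup.closure_eq_bot_iff]
      exact fun x hx => hX (fun _ => x) fun _ => hx
    have : Subsingleton H := by
      rw [← Subgroup.subsingleton_iff]
      exact subsingleton_of_bot_eq_top (h1.symm.trans hgen)
    exact ⟨inferInstance, fun g => ⟨0, Subsingleton.elim _ _⟩⟩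
  | succ c ih =>
    intro H _ X hfin hgen hpow hX
    let Y : Set H := {w | ∃ x : ℕ → H, (∀ j, x j ∈ X) ∧ w = leftNormedCommutator x c}
    have hYX : ∀ w ∈ Y, ∀ g ∈ X, ⁅w, g⁆ = 1 := by
      rintro _ ⟨x, hx, rfl⟩ g hg
      have h := hX (fun j => if j ≤ c then x j else g) fun j => by
        split_ifs; exacts [hx j, hg]
      rw [leftNormedCommutator] at h
      rw [leftNormedCommutator_congr (y := x) fun j hj => if_pos hj] at h
      simpa using h
    have hYc : Y ⊆ Subgroup.center H := by
      intro w hw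
      have h1 : Subgroup.closure X ≤ Subgroup.centralizer {w} := by
        rw [Subgroup.closure_le]
        intro g hg
        rw [SetLike.mem_coe, Subgroup.mem_centralizer_singleton_iff]
        exact (commutatorElement_eq_one_iff_mul_comm.1 (hYX w hw g hg)).symm
      rw [SetLike.mem_coe, Subgroup.mem_center_iff]
      intro g
      have := h1 (hgen ▸ Subgroup.mem_top g)
      rwa [Subgroup.mem_centralizer_singleton_iff] at this
    have hZc : Subgroup.closure Y ≤ Subgroup.center H := (Subgroup.closure_le _).2 hYc
    have hYp : ∀ w ∈ Y, w ^ p = 1 := by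
      rintro _ ⟨x, hx, rfl⟩
      cases c with
      | zero => exact hpow _ (hx 0)
      | succ c =>
        rw [leftNormedCommutator, ← commutatorElement_pow_right_of_commute,
          hpow _ (hx _), commutatorElement_one_right]
        exact ((Subgroup.mem_center_iff.1 (hYc ⟨x, hx, rfl⟩)) (x (c + 1))).symm
    have hYfin : Y.Finite := by
      have : Finite X := hfin
      refine (Set.finite_range fun f : Fin (c + 1) → X =>
        leftNormedCommutator (fun j => if h : j < c + 1 then (f ⟨j, h⟩ : H) else 1) c).subset ?_
      rintro _ ⟨x, hx, rfl⟩
      refine ⟨fun j => ⟨x j, hx j⟩, leftNormedCommutator_congr fun j hj => ?_⟩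
      simp [Nat.lt_succ_of_le hj]
    set Z := Subgroup.closure Y with hZ
    have hZp : ∀ z ∈ Z, z ^ p = 1 := by
      intro z hz
      induction hz using Subgroup.closure_induction with
      | mem x hx => exact hYp x hx
      | one => exact one_pow _
      | mul x y hx hy h1 h2 =>
        have : Commute x y := ((Subgroup.mem_center_iff.1 (hZc hx)) y).symm
        rw [this.mul_pow, h1, h2, one_mul]
      | inv x hx h1 => rw [inv_pow, h1, inv_one]
    have hZn : Z.Normal := ⟨fun z hz g => by
      rw [(Subgroup.mem_center_iff.1 (hZc hz)) g, mul_inv_cancel_right]; exact hz⟩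
    have : Finite Z := by
      let _ : CommGroup Z := { (inferInstance : Group Z) with
        mul_comm := fun x y => Subtype.ext ((Subgroup.mem_center_iff.1 (hZc y.2)) x) }
      have : Group.FG Z := (Group.fg_iff_subgroup_fg Z).2 ((Subgroup.fg_iff Z).2 ⟨Y, rfl, hYfin⟩)
      refine CommGroup.finite_of_fg_isMulTorsion _ (fun z => ?_)
      exact isOfFinOrder_iff_pow_eq_one.2 ⟨p, hp.pos, Subtype.ext (hZp z z.2)⟩
    obtain ⟨hQf, hQp⟩ := ih (QuotientGroup.mk' Z '' X) (hfin.image _)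
      (by rw [← MonoidHom.map_closure, hgen, Subgroup.map_top_of_surjective _
            (QuotientGroup.mk'_surjective Z)])
      (by rintro _ ⟨x, hx, rfl⟩; rw [← map_pow, hpow x hx, map_one])
      (by
        intro y hy
        choose x hx hxy using hy
        have h1 := map_leftNormedCommutator (QuotientGroup.mk' Z) x c
        simp only [hxy] at h1
        rw [← h1, QuotientGroup.mk'_apply, QuotientGroup.eq_one_iff]
        exact Subgroup.subset_closure ⟨x, hx, rfl⟩)
    refine ⟨Finite.of_equiv _ (Subgroup.groupEquivQuotientProdSubgroup (s := Z)).symm, fun g => ?_⟩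
    obtain ⟨k, hk⟩ := hQp (QuotientGroup.mk' Z g)
    rw [← map_pow, QuotientGroup.mk'_apply, QuotientGroup.eq_one_iff] at hk
    exact ⟨k + 1, by rw [pow_succ, pow_mul, hZp _ hk]⟩

end LeftNormed

/-! ### Tuples that satisfy the defining relations -/

/-- The tuple `x` satisfies the defining relations of `A(p, c)` whose level lies in `L`. -/
structure IsLocalTuple {H : Type*} [Group H] (p : ℕ) (c : ℕ+ → ℕ+) (L : Set ℕ+) (x : ℤ → H) :
    Prop where
  pow_eq_one : ∀ i, x i ^ p = 1
  comm_eq_one : ∀ n ∈ L, ∀ i : ℕ → ℤ,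
    (∀ j ≤ (c n : ℕ), ∀ k ≤ (c n : ℕ), |i j - i k| ≤ (n : ℤ)) →
      leftNormedCommutator (fun j => x (i j)) (c n) = 1

namespace IsLocalTuple

variable {p : ℕ} {c : ℕ+ → ℕ+} {L : Set ℕ+}

theorem map {H K : Type*} [Group H] [Group K] {x : ℤ → H} (hx : IsLocalTuple p c L x)
    (f : H →* K) : IsLocalTuple p c L fun i => f (x i) where
  pow_eq_one i := by rw [← map_pow, hx.pow_eq_one, map_one]
  comm_eq_one n hn i hi := by
    rw [← map_leftNormedCommutator f fun j => x (i j), hx.comm_eq_one n hn i hi, map_one]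

theorem of_map {H K : Type*} [Group H] [Group K] {x : ℤ → H} (f : H →* K)
    (hf : Function.Injective f) (hx : IsLocalTuple p c L fun i => f (x i)) :
    IsLocalTuple p c L x where
  pow_eq_one i := hf (by rw [map_pow, hx.pow_eq_one, map_one])
  comm_eq_one n hn i hi := hf (by
    rw [map_leftNormedCommutator, hx.comm_eq_one n hn i hi, map_one])

theorem pi {ι : Type*} {H : Type*} [Group H] {x : ℤ → ι → H}
    (hx : ∀ j, IsLocalTuple p c L fun i => x i j) : IsLocalTuple p c L x where
  pow_eq_one i := funext fun j => (hx j).pow_eq_one i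
  comm_eq_one n hn i hi := funext fun j => by
    have := (hx j).comm_eq_one n hn i hi
    rw [Pi.one_apply, ← this]
    exact map_leftNormedCommutator (Pi.evalMonoidHom (fun _ : ι => H) j) (fun k => x (i k)) (c n)

/-- A tuple each of whose entries is trivial or an entry of a tuple with the relations, where
indices do not move further apart, satisfies the relations. -/
theorem of_reindex {H : Type*} [Group H] {x y : ℤ → H} (hx : IsLocalTuple p c L x) (I : Set ℤ)
    (m : ℤ → ℤ) (hy : ∀ i ∈ I, y i = x (m i)) (hy' : ∀ i ∉ I, y i = 1)
    (hm : ∀ n : ℕ+, ∀ i ∈ I, ∀ j ∈ I, |i - j| ≤ (n : ℤ) → |m i - m j| ≤ n) :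
    IsLocalTuple p c L y where
  pow_eq_one i := by
    by_cases hi : i ∈ I
    · rw [hy i hi, hx.pow_eq_one]
    · rw [hy' i hi, one_pow]
  comm_eq_one n hn i hi := by
    by_cases h : ∀ j ≤ (c n : ℕ), i j ∈ I
    · rw [leftNormedCommutator_congr (y := fun j => x (m (i (min j (c n)))))
        fun j hj => by rw [min_eq_left hj, hy _ (h j hj)]]
      refine hx.comm_eq_one n hn (fun j => m (i (min j (c n)))) fun j hj k hk => ?_
      exact hm n _ (h _ (min_le_right _ _)) _ (h _ (min_le_right _ _))
        (hi _ (min_le_right _ _) _ (min_le_right _ _))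
    · push Not at h
      obtain ⟨j, hj, hjI⟩ := h
      exact leftNormedCommutator_eq_one_of_eq_one hj (hy' _ hjI)

/-- A part of the tuple in a window whose width is at most a level of the relations generates a
finite `p`-group. -/
theorem finite_closure {H : Type*} [Group H] {x : ℤ → H} (hx : IsLocalTuple p c L x)
    (hp : p.Prime) {u v : ℤ} {n : ℕ+} (hn : n ∈ L) (huv : v - u ≤ n) :
    Finite (Subgroup.closure (x '' Set.Icc u v)) ∧
      IsPGroup p (Subgroup.closure (x '' Set.Icc u v)) := by
  set K := Subgroup.closure (x '' Set.Icc u v)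
  refine finite_and_isPGroup_of_leftNormedCommutator hp (c n)
    (Subtype.val ⁻¹' (x '' Set.Icc u v) : Set K)
    (Set.Finite.preimage Subtype.val_injective.injOn ((Set.finite_Icc u v).image x))
    (Subgroup.closure_closure_coe_preimage) ?_ ?_
  · rintro ⟨_, _⟩ ⟨i, -, rfl⟩
    exact Subtype.ext (hx.pow_eq_one i)
  · intro y hy
    choose i hi hiy using hy
    refine Subtype.ext ?_
    have h := map_leftNormedCommutator K.subtype y (c n)
    simp only [Subgroup.subtype_apply] at h
    rw [h]
    simp only [← hiy]
    refine hx.comm_eq_one n hn i fun j _ k _ => abs_le.2 ?_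
    have h1 := hi j
    have h2 := hi k
    simp only [Set.mem_Icc] at h1 h2
    omega

end IsLocalTuple

/-! ### Groups presented by local relations and their extensions by the shift -/

/-- The relators of `A(p, c)` whose level lies in `L`. -/
def localRelators (p : ℕ) (c : ℕ+ → ℕ+) (L : Set ℕ+) : Set (FreeGroup ℤ) :=
  {w | ∃ i : ℤ, w = FreeGroup.of i ^ p} ∪
  {w | ∃ n ∈ L, ∃ i : ℕ → ℤ,
    (∀ j ≤ (c n : ℕ), ∀ k ≤ (c n : ℕ), |i j - i k| ≤ (n : ℤ)) ∧
    w = leftNormedCommutator (fun j => FreeGroup.of (i j)) (c n)}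

theorem localRelators_univ (p : ℕ) (c : ℕ+ → ℕ+) :
    localRelators p c Set.univ = relatorsA p c := by
  simp [localRelators, relatorsA]

theorem IsLocalTuple.lift_eq_one {H : Type*} [Group H] {p : ℕ} {c : ℕ+ → ℕ+} {L : Set ℕ+}
    {x : ℤ → H} (hx : IsLocalTuple p c L x) :
    ∀ r ∈ localRelators p c L, FreeGroup.lift x r = 1 := by
  rintro r (⟨i, rfl⟩ | ⟨n, hn, i, hi, rfl⟩)
  · rw [map_pow, FreeGroup.lift_apply_of, hx.pow_eq_one]
  · rw [map_leftNormedCommutator]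
    simp only [FreeGroup.lift_apply_of]
    exact hx.comm_eq_one n hn i hi

theorem isLocalTuple_of (p : ℕ) (c : ℕ+ → ℕ+) (L : Set ℕ+) (rels : Set (FreeGroup ℤ))
    (h : localRelators p c L ⊆ rels) :
    IsLocalTuple p c L fun i => (PresentedGroup.of i : PresentedGroup rels) where
  pow_eq_one i := by
    have := PresentedGroup.one_of_mem (h (Or.inl ⟨i, rfl⟩))
    rwa [map_pow] at this
  comm_eq_one n hn i hi := by
    have := PresentedGroup.one_of_mem (h (Or.inr ⟨n, hn, i, hi, rfl⟩))
    rwa [map_leftNormedCommutator] at this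

theorem IsLocalTuple.comp_add {H : Type*} [Group H] {p : ℕ} {c : ℕ+ → ℕ+} {L : Set ℕ+}
    {x : ℤ → H} (hx : IsLocalTuple p c L x) (m : ℤ) : IsLocalTuple p c L fun i => x (i + m) :=
  hx.of_reindex Set.univ (· + m) (fun _ _ => rfl) (by simp) (by simp)

theorem zpow_apply_of_shift {B : Type*} [Group B] {σ : MulAut B} {b : ℤ → B}
    (h : ∀ i, σ (b i) = b (i + 1)) (m i : ℤ) : (σ ^ m) (b i) = b (i + m) := by
  induction m using Int.induction_on with
  | zero => simp
  | succ k ih =>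
    rw [add_comm (k : ℤ) 1, zpow_add, zpow_one, MulAut.mul_apply, ih, h]
    congr 1; ring
  | pred k ih =>
    rw [sub_eq_add_neg, add_comm, zpow_add, zpow_neg_one, MulAut.mul_apply, ih]
    apply σ.injective
    rw [MulAut.apply_inv_self, h]
    congr 1; ring

/-- A group `A` with a family of generators `a i`, `i ∈ ℤ`, and an automorphism `a i ↦ a (i + 1)`,
that is presented by the relations of `A(p, c)` whose level lies in `L`. -/
structure LocalModel (p : ℕ) (c : ℕ+ → ℕ+) (L : Set ℕ+) (A : Type) [Group A] where
  gen : ℤ → A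
  shift : MulAut A
  shift_gen : ∀ i, shift (gen i) = gen (i + 1)
  closure_gen : Subgroup.closure (Set.range gen) = ⊤
  isLocalTuple : IsLocalTuple p c L gen
  exists_lift : ∀ {H : Type} [Group H] (x : ℤ → H), IsLocalTuple p c L x →
    ∃ f : A →* H, ∀ i, f (gen i) = x i

/-- The group `A(p, c)`. -/
abbrev LocalModel.groupA (p : ℕ) (c : ℕ+ → ℕ+) : LocalModel p c Set.univ (GroupA p c) where
  gen i := PresentedGroup.of i
  shift := GroupA.shift p c
  shift_gen := GroupA.shift_of p c
  closure_gen := PresentedGroup.closure_range_of _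
  isLocalTuple := isLocalTuple_of p c _ _ (localRelators_univ p c).subset
  exists_lift x hx := ⟨PresentedGroup.toGroup (f := x) (rels := relatorsA p c)
    (localRelators_univ p c ▸ hx.lift_eq_one), fun i => by simp⟩

/-- The group given by the relations of `A(p, c)` whose level lies in `L`. -/
def LocalModel.presented (p : ℕ) (c : ℕ+ → ℕ+) (L : Set ℕ+) :
    LocalModel p c L (PresentedGroup (localRelators p c L)) where
  gen i := PresentedGroup.of i
  shift := MonoidHom.toMulEquiv
    (PresentedGroup.toGroup ((isLocalTuple_of p c L _ subset_rfl).comp_add 1).lift_eq_one)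
    (PresentedGroup.toGroup ((isLocalTuple_of p c L _ subset_rfl).comp_add (-1)).lift_eq_one)
    (PresentedGroup.ext fun i => by simp)
    (PresentedGroup.ext fun i => by simp)
  shift_gen i := by simp
  closure_gen := PresentedGroup.closure_range_of _
  isLocalTuple := isLocalTuple_of p c _ _ subset_rfl
  exists_lift x hx := ⟨PresentedGroup.toGroup hx.lift_eq_one, fun i => by simp⟩

/-! ### Generators, universal property and windows of the extension by the shift -/

namespace LocalModel

open SemidirectProduct Multiplicative

variable {p : ℕ} {c : ℕ+ → ℕ+} {L : Set ℕ+} {A : Type} [Group A] (M : LocalModel p c L A)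

/-- The extension of `A` by the shift. -/
abbrev Ext : Type := A ⋊[zpowersHom (MulAut A) M.shift] Multiplicative ℤ

/-- The generators `a 0` and `t` of the extension. -/
def base : M.Ext := inl (M.gen 0)

/-- The stable letter. -/
def stable : M.Ext := inr (ofAdd 1)

theorem hom_ext {H : Type*} [Group H] {f g : A →* H} (h : ∀ i, f (M.gen i) = g (M.gen i)) :
    f = g :=
  MonoidHom.eq_of_eqOn_dense M.closure_gen (by rintro _ ⟨i, rfl⟩; exact h i)

theorem shift_zpow_gen (m i : ℤ) : (M.shift ^ m) (M.gen i) = M.gen (i + m) :=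
  zpow_apply_of_shift M.shift_gen m i

theorem stable_zpow (m : ℤ) : M.stable ^ m = inr (ofAdd m) := by
  rw [stable, ← map_zpow, ← ofAdd_zsmul, smul_eq_mul, mul_one]

theorem stable_zpow_conj (m : ℤ) (a : A) :
    M.stable ^ m * inl a * (M.stable ^ m)⁻¹ = inl ((M.shift ^ m) a) := by
  rw [stable_zpow, ← map_inv, ← inl_aut, zpowersHom_apply, toAdd_ofAdd]

theorem inl_gen (i : ℤ) :
    (inl (M.gen i) : M.Ext) = M.stable ^ i * M.base * (M.stable ^ i)⁻¹ := by
  rw [base, stable_zpow_conj, shift_zpow_gen, zero_add]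

theorem closure_base_stable : Subgroup.closure {M.base, M.stable} = ⊤ := by
  rw [eq_top_iff]
  set K := Subgroup.closure {M.base, M.stable}
  have hb : M.base ∈ K := Subgroup.subset_closure (by simp)
  have hs : M.stable ∈ K := Subgroup.subset_closure (by simp)
  have hA : ∀ a : A, (inl a : M.Ext) ∈ K := by
    have : Subgroup.closure (Set.range M.gen) ≤ K.comap inl := by
      rw [Subgroup.closure_le]
      rintro _ ⟨i, rfl⟩
      rw [SetLike.mem_coe, Subgroup.mem_comap, M.inl_gen]
      exact K.mul_mem (K.mul_mem (K.zpow_mem hs i) hb) (K.inv_mem (K.zpow_mem hs i))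
    exact fun a => this (M.closure_gen ▸ Subgroup.mem_top a)
  intro x _
  rw [← inl_left_mul_inr_right x]
  refine K.mul_mem (hA _) ?_
  rw [← ofAdd_toAdd x.right, ← M.stable_zpow]
  exact K.zpow_mem hs _

theorem ext_hom_ext {H : Type*} [Group H] {f g : M.Ext →* H} (hb : f M.base = g M.base)
    (hs : f M.stable = g M.stable) : f = g :=
  MonoidHom.eq_of_eqOn_dense M.closure_base_stable (by
    rintro _ (rfl | rfl)
    exacts [hb, hs])

/-- Homomorphisms out of the extension arise here: in terms of `base` and `stable` its only
relations are those among the conjugates of `base` by powers of `stable`. -/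
theorem exists_ext_hom {H : Type} [Group H] (x τ : H)
    (h : IsLocalTuple p c L fun i : ℤ => τ ^ i * x * (τ ^ i)⁻¹) :
    ∃ F : M.Ext →* H, F M.base = x ∧ F M.stable = τ := by
  obtain ⟨f, hf⟩ := M.exists_lift _ h
  refine ⟨SemidirectProduct.lift f (zpowersHom H τ) fun m => ?_, ?_, ?_⟩
  · refine M.hom_ext fun i => ?_
    simp only [MonoidHom.comp_apply, MulEquiv.coe_toMonoidHom, zpowersHom_apply,
      MulAut.conj_apply]
    rw [M.shift_zpow_gen, hf, hf, add_comm, zpow_add]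
    group
  · rw [base, lift_inl, hf]; simp
  · rw [stable, lift_inr]; simp

theorem map_inl_gen {H : Type*} [Group H] (F : M.Ext →* H) (i : ℤ) :
    F (inl (M.gen i)) = F M.stable ^ i * F M.base * (F M.stable ^ i)⁻¹ := by
  rw [M.inl_gen, map_mul, map_mul, map_inv, map_zpow]

/-- The subgroup of `A` generated by the `a i` with `u ≤ i ≤ v`. -/
def window (u v : ℤ) : Subgroup A := Subgroup.closure (M.gen '' Set.Icc u v)

theorem gen_mem_window {u v i : ℤ} (h : i ∈ Set.Icc u v) : M.gen i ∈ M.window u v :=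
  Subgroup.subset_closure ⟨i, h, rfl⟩

theorem window_mono {u v u' v' : ℤ} (hu : u' ≤ u) (hv : v ≤ v') :
    M.window u v ≤ M.window u' v' :=
  Subgroup.closure_mono (Set.image_mono (Set.Icc_subset_Icc hu hv))

theorem map_shift_zpow_window (m u v : ℤ) :
    (M.window u v).map (M.shift ^ m : MulAut A).toMonoidHom = M.window (u + m) (v + m) := by
  rw [window, MonoidHom.map_closure, window]
  congr 1
  ext a
  simp only [Set.mem_image, Set.mem_Icc]
  constructor
  · rintro ⟨_, ⟨i, hi, rfl⟩, rfl⟩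
    exact ⟨i + m, by omega, by rw [MulEquiv.coe_toMonoidHom, M.shift_zpow_gen]⟩
  · rintro ⟨i, hi, rfl⟩
    exact ⟨_, ⟨i - m, by omega, rfl⟩, by
      rw [MulEquiv.coe_toMonoidHom, M.shift_zpow_gen, sub_add_cancel]⟩

theorem exists_mem_window (a : A) : ∃ n : ℕ, a ∈ M.window (-n) n := by
  have ha : a ∈ Subgroup.closure (Set.range M.gen) := M.closure_gen ▸ Subgroup.mem_top a
  induction ha using Subgroup.closure_induction with
  | mem x hx =>
    obtain ⟨i, rfl⟩ := hx
    exact ⟨i.natAbs, M.gen_mem_window (by rw [Set.mem_Icc]; omega)⟩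
  | one => exact ⟨0, one_mem _⟩
  | mul x y _ _ hx hy =>
    obtain ⟨m, hm⟩ := hx
    obtain ⟨n, hn⟩ := hy
    exact ⟨max m n, mul_mem (M.window_mono (by simp) (by simp) hm)
      (M.window_mono (by simp) (by simp) hn)⟩
  | inv x _ hx =>
    obtain ⟨m, hm⟩ := hx
    exact ⟨m, inv_mem hm⟩

theorem finite_window (hp : p.Prime) {u v : ℤ} {n : ℕ+} (hn : n ∈ L) (huv : v - u ≤ n) :
    Finite (M.window u v) :=
  (M.isLocalTuple.finite_closure hp hn huv).1

theorem isPGroup_window (hp : p.Prime) {u v : ℤ} {n : ℕ+} (hn : n ∈ L) (huv : v - u ≤ n) :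
    IsPGroup p (M.window u v) :=
  (M.isLocalTuple.finite_closure hp hn huv).2

/-- The tuple that agrees with `a` in a window and is trivial outside. -/
noncomputable def windowTuple (u v i : ℤ) : M.window u v :=
  open Classical in if h : i ∈ Set.Icc u v then ⟨M.gen i, M.gen_mem_window h⟩ else 1

theorem isLocalTuple_windowTuple (u v : ℤ) : IsLocalTuple p c L (M.windowTuple u v) := by
  refine IsLocalTuple.of_map (M.window u v).subtype Subtype.val_injective ?_
  refine M.isLocalTuple.of_reindex (Set.Icc u v) id (fun i hi => ?_) (fun i hi => ?_) ?_
  · simp [windowTuple, Set.mem_Icc.1 hi]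
  · simp only [windowTuple, dif_neg hi, map_one]
  · exact fun n i _ j _ h => h

end LocalModel

/-! ### Folding -/

section Fold

variable {H : Type*} [Group H]

/-- The function on `ℤ/q` that takes the value `x m` at the residue of `m` for `u ≤ m ≤ v`, and the
value `1` elsewhere. -/
noncomputable def foldTuple (x : ℤ → H) (u v : ℤ) (q : ℕ) (r : ZMod q) : H :=
  open Classical in if h : ∃ m ∈ Set.Icc u v, (m : ZMod q) = r then x h.choose else 1

theorem foldTuple_of_mem (x : ℤ → H) {u v : ℤ} {q : ℕ} (hq : v - u < q) {m : ℤ}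
    (hm : m ∈ Set.Icc u v) : foldTuple x u v q m = x m := by
  have h : ∃ k ∈ Set.Icc u v, (k : ZMod q) = m := ⟨m, hm, rfl⟩
  rw [foldTuple, dif_pos h]
  congr 1
  obtain ⟨h1, h2⟩ := h.choose_spec
  set k := h.choose
  rw [ZMod.intCast_eq_intCast_iff_dvd_sub] at h2
  rw [Set.mem_Icc] at h1 hm
  have := Int.eq_zero_of_abs_lt_dvd h2 (by rw [abs_lt]; omega)
  omega

/-- The window is wrapped around a circle of length `q`, and wrapping must not move indices further
apart. Levels `n ≥ v - u` are harmless. For smaller `n`, a difference of indices and the difference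
of their lifts to the window are congruent mod `q` and lie within `2 * (v - u) < q` of each other,
hence agree. -/
theorem IsLocalTuple.foldTuple {p : ℕ} {c : ℕ+ → ℕ+} {L : Set ℕ+} {x : ℤ → H}
    (hx : IsLocalTuple p c L x) {u v : ℤ} {q : ℕ} (hq : 2 * (v - u) < q) (j : ZMod q) :
    IsLocalTuple p c L fun i : ℤ => foldTuple x u v q (i - j) := by
  classical
  refine hx.of_reindex {i : ℤ | ∃ m ∈ Set.Icc u v, (m : ZMod q) = i - j}
    (fun i => if h : ∃ m ∈ Set.Icc u v, (m : ZMod q) = i - j then h.choose else 0)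
    (fun i hi => ?_) (fun i hi => ?_) ?_
  · rw [Set.mem_ofPred_eq] at hi
    rw [_root_.foldTuple, dif_pos hi, dif_pos hi]
  · rw [Set.mem_ofPred_eq] at hi
    rw [_root_.foldTuple, dif_neg hi]
  · intro n i hi k hk hn
    rw [Set.mem_ofPred_eq] at hi hk
    rw [dif_pos hi, dif_pos hk]
    obtain ⟨h1, h2⟩ := hi.choose_spec
    obtain ⟨h3, h4⟩ := hk.choose_spec
    set a := hi.choose
    set b := hk.choose
    rw [Set.mem_Icc] at h1 h3
    by_cases hnw : v - u ≤ n
    · rw [abs_le]; omega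
    · have h5 : ((a - b : ℤ) : ZMod q) = ((i - k : ℤ) : ZMod q) := by
        push_cast
        rw [h2, h4]; ring
      rw [ZMod.intCast_eq_intCast_iff_dvd_sub] at h5
      rw [abs_le] at hn
      have := Int.eq_zero_of_abs_lt_dvd h5 (by rw [abs_lt]; omega)
      rw [abs_le]; omega

end Fold

/-! ### Finite `p`-quotients in which a window survives -/

namespace LocalModel

open SemidirectProduct Multiplicative

variable {p : ℕ} {c : ℕ+ → ℕ+} {L : Set ℕ+} {A : Type} [Group A] (M : LocalModel p c L A)

theorem isPGroup_pi {ι P : Type*} [Finite ι] [Group P] (hP : IsPGroup p P) :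
    IsPGroup p (ι → P) := by
  classical
  cases nonempty_fintype ι
  intro f
  choose k hk using fun i => hP (f i)
  refine ⟨∑ i, k i, funext fun i => ?_⟩
  rw [← Finset.sum_erase_add _ _ (Finset.mem_univ i), Pi.pow_apply, Pi.one_apply, add_comm,
    pow_add, pow_mul, hk, one_pow]

theorem isPGroup_semidirectProduct {N Q : Type*} [Group N] [Group Q] {φ : Q →* MulAut N}
    (hN : IsPGroup p N) (hQ : IsPGroup p Q) : IsPGroup p (N ⋊[φ] Q) := by
  intro x
  obtain ⟨k, hk⟩ := hQ x.right
  have h : rightHom (x ^ p ^ k) = 1 := by rw [map_pow]; exact hk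
  rw [← MonoidHom.mem_ker, ← range_inl_eq_ker_rightHom] at h
  obtain ⟨y, hy⟩ := h
  obtain ⟨m, hm⟩ := hN y
  exact ⟨k + m, by rw [pow_add, pow_mul, ← hy, ← map_pow, hm, map_one]⟩

theorem neg_toAdd_inv_zpow_mul {q : ℕ} (i : ℤ) (j : Multiplicative (ZMod q)) :
    -(toAdd ((ofAdd (1 : ZMod q) ^ i)⁻¹ * j)) = (i : ZMod q) - toAdd j := by
  rw [toAdd_mul, toAdd_inv, toAdd_zpow, toAdd_ofAdd, zsmul_eq_mul, mul_one]
  ring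

/-- The extension has a quotient that is a finite `p`-group in which a given window and the stable
letter survive. -/
theorem exists_finite_quotient (hp : p.Prime) {u v : ℤ} {n : ℕ+} (hn : n ∈ L) (huv : v - u ≤ n)
    (w : ℕ) :
    ∃ (E : Type) (_ : Group E) (_ : Finite E) (F : M.Ext →* E)
      (χ : E →* Multiplicative (ZMod (p ^ (w + 1)))),
      IsPGroup p E ∧ (∀ a ∈ M.window u v, F (inl a) = 1 → a = 1) ∧
      (∀ a, χ (F (inl a)) = 1) ∧ χ (F M.stable) = ofAdd 1 := by
  have : Fact p.Prime := ⟨hp⟩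
  have := M.finite_window hp hn huv
  have hP := M.isPGroup_window hp hn huv
  set P := M.window u v
  -- The summand `w + 1` lets `ℤ/q` map onto `ℤ/p^(w+1)`; the other one gives `q = p^k > k > 2 * (v
  -- - u)`, as folding requires.
  set k := w + 1 + (2 * (v - u)).natAbs with hk
  set q := p ^ k with hqdef
  have hq : 2 * (v - u) < q := by
    have h1 : k < p ^ k := Nat.lt_pow_self hp.one_lt
    have h2 : (k : ℤ) < q := by rw [hqdef]; exact_mod_cast h1
    have h3 : 2 * (v - u) ≤ ((2 * (v - u)).natAbs : ℤ) := Int.le_natAbs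
    rw [hk] at h2
    push_cast at h2 h3 ⊢
    omega
  have hq1 : v - u < q := by
    have : (0 : ℤ) ≤ q := Nat.cast_nonneg _
    omega
  have : NeZero q := ⟨(pow_pos hp.pos k).ne'⟩
  let Z := Multiplicative (ZMod q)
  have : Finite Z := inferInstanceAs (Finite (ZMod q))
  let x := M.windowTuple u v
  have hx : IsLocalTuple p c L x := M.isLocalTuple_windowTuple u v
  -- The target is the wreath product of the finite window `P` with `ℤ/q`. The action translates
  -- functions by the inverse, so the minus sign turns the conjugate of `b` by the `i`-th power into
  -- `j ↦ foldTuple (i - j)`.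
  let b : Z → P := fun j => foldTuple x u v q (-(toAdd j))
  let E := (Z → P) ⋊[mulAutArrow] Z
  have key : ∀ i : ℤ, ((inr (ofAdd 1) : E) ^ i * inl b * (inr (ofAdd 1) ^ i)⁻¹) =
      inl fun j : Z => foldTuple x u v q (i - toAdd j) := by
    intro i
    rw [← map_zpow, ← map_inv, ← inl_aut]
    congr 1
    ext j
    simp only [mulAutArrow_apply_apply, b]
    change ((foldTuple x u v q (-(toAdd ((ofAdd (1 : ZMod q) ^ i)⁻¹ * j))) : P) : A) = _
    rw [neg_toAdd_inv_zpow_mul i j]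
  obtain ⟨F, hF1, hF2⟩ := M.exists_ext_hom (H := E) (inl b) (inr (ofAdd 1)) (by
    simp only [key]
    exact (IsLocalTuple.pi fun j => hx.foldTuple hq (toAdd j)).map inl)
  have hFg : ∀ i, F (inl (M.gen i)) = inl fun j : Z => foldTuple x u v q (i - toAdd j) := by
    intro i
    rw [M.map_inl_gen, hF1, hF2, key]
  have hFr : ∀ a, rightHom (F (inl a)) = 1 := by
    have : (rightHom.comp F).comp (inl : A →* M.Ext) = 1 := M.hom_ext fun i => by
      simp [hFg]
    exact fun a => DFunLike.congr_fun this a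
  refine ⟨E, inferInstance, Finite.of_equiv _ equivProd.symm, F,
    (AddMonoidHom.toMultiplicative (ZMod.castHom (pow_dvd_pow p (by omega : w + 1 ≤ k))
      (ZMod (p ^ (w + 1)))).toAddMonoidHom).comp rightHom, ?_, ?_, ?_, ?_⟩
  · refine isPGroup_semidirectProduct (isPGroup_pi hP) (IsPGroup.of_card (n := k) ?_)
    change Nat.card (ZMod q) = p ^ k
    rw [Nat.card_zmod]
  -- The coordinate at the neutral element of `ℤ/q` is a homomorphism on `A` that returns the
  -- generators of the window unchanged.
  · have hloc : ∀ a ∈ M.window u v, ((F (inl a)).left 1 : A) = a := by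
      intro a ha
      have h1 : ∀ a, F (inl a) = inl (F (inl a)).left := fun a => by
        ext1
        · simp
        · exact hFr a
      have hmul : ∀ a b, (F (inl (a * b))).left = (F (inl a)).left * (F (inl b)).left := by
        intro a b
        rw [map_mul, map_mul, mul_left]
        have : (F (inl a)).right = 1 := hFr a
        rw [this, map_one]; rfl
      let f : A →* P := { toFun := fun a => (F (inl a)).left 1
                          map_one' := by simp
                          map_mul' := fun a b => by rw [hmul]; rfl }
      change (P.subtype.comp f) a = (MonoidHom.id A) a
      refine MonoidHom.eqOn_closure (s := M.gen '' Set.Icc u v) ?_ ha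
      rintro _ ⟨i, hi, rfl⟩
      change ((F (inl (M.gen i))).left 1 : A) = M.gen i
      rw [hFg, left_inl]
      have : ((i : ZMod q) - toAdd (1 : Z)) = (i : ZMod q) := sub_zero _
      rw [this, foldTuple_of_mem x hq1 hi]
      simp only [x, windowTuple, dif_pos hi]
    intro a ha h
    rw [← hloc a ha, h]
    simp
  · intro a
    rw [MonoidHom.comp_apply, hFr, map_one]
  · rw [hF2, MonoidHom.comp_apply, rightHom_inr]
    exact congrArg ofAdd (map_one (ZMod.castHom (pow_dvd_pow p (by omega : w + 1 ≤ k)) _))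

end LocalModel

/-! ### Amenability from Følner sets -/

section Folner

/-- The measure is the ultralimit of the densities in the sets `F n`. Invariance needs to be checked
only for generators, since the elements that preserve the measure form a subgroup. -/
theorem isAmenableGroup_of_folner {G : Type*} [Group G] [DecidableEq G] (S : Set G)
    (hS : Subgroup.closure S = ⊤) (F : ℕ → Finset G) (hF : ∀ n, (F n).Nonempty)
    (hlim : ∀ g ∈ S, Tendsto (fun n => (((F n).filter fun x => g * x ∉ F n).card : ℝ) / (F n).card)
      atTop (𝓝 0)) : IsAmenableGroup G := by
  classical
  let ω : Ultrafilter ℕ := hyperfilter ℕ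
  have hω : (ω : Filter ℕ) ≤ atTop := Nat.hyperfilter_le_atTop
  let f : Set G → ℕ → ℝ := fun X n => (((F n).filter (· ∈ X)).card : ℝ) / (F n).card
  have hpos : ∀ n, (0 : ℝ) < (F n).card := fun n => by exact_mod_cast (hF n).card_pos
  have h0 : ∀ X n, 0 ≤ f X n := fun X n => by positivity
  have h1 : ∀ X n, f X n ≤ 1 := fun X n => by
    rw [div_le_one (hpos n)]
    exact_mod_cast Finset.card_filter_le _ _
  have ht : ∀ X, Tendsto (f X) ω (𝓝 (omegaLim ω (f X))) := fun X =>
    tendsto_omegaLim ω (h0 X) (h1 X)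
  have hcongr : ∀ g ∈ S, ∀ X, omegaLim ω (f ((fun x => g * x) '' X)) = omegaLim ω (f X) := by
    intro g hg X
    have h2 : ∀ n, |f ((fun x => g * x) '' X) n - f X n| ≤
        (((F n).filter fun x => g * x ∉ F n).card : ℝ) / (F n).card := by
      intro n
      rw [← sub_div, abs_div, abs_of_pos (hpos n)]
      refine div_le_div_of_nonneg_right ?_ (hpos n).le
      set B := (F n).filter fun x => g * x ∉ F n
      set B' := (F n).filter fun y => g⁻¹ * y ∉ F n
      -- Left multiplication by `g` matches the complements of `B` and `B'` in `F n`, so the bound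
      -- for `g` also covers `g⁻¹`.
      have hB : B'.card = B.card := by
        have e1 := Finset.card_filter_add_card_filter_not (s := F n) (fun x => g * x ∈ F n)
        have e2 := Finset.card_filter_add_card_filter_not (s := F n) (fun x => g⁻¹ * x ∈ F n)
        have e3 : ((F n).filter fun x => g * x ∈ F n).card =
            ((F n).filter fun x => g⁻¹ * x ∈ F n).card := by
          refine Finset.card_bij (fun x _ => g * x) ?_ ?_ ?_
          · intro x hx; simp at hx ⊢; exact hx.symm
          · intro x _ y _ h; exact mul_left_cancel h
          · intro y hy
            simp at hy
            exact ⟨g⁻¹ * y, by simp [hy], by simp⟩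
        change _ + B.card = _ at e1
        change _ + B'.card = _ at e2
        omega
      have a1 : ((F n).filter (· ∈ X)).card ≤
          ((F n).filter (· ∈ (fun x => g * x) '' X)).card + B.card := by
        have : ((F n).filter (· ∈ X)) ⊆
            ((F n).filter (· ∈ (fun x => g * x) '' X)).image (fun y => g⁻¹ * y) ∪ B := by
          intro x hx
          simp only [Finset.mem_filter, Finset.mem_union, Finset.mem_image, B] at hx ⊢
          by_cases h : g * x ∈ F n
          · exact Or.inl ⟨g * x, ⟨h, x, hx.2, rfl⟩, by simp⟩
          · exact Or.inr ⟨hx.1, h⟩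
        refine (Finset.card_le_card this).trans ((Finset.card_union_le _ _).trans ?_)
        exact Nat.add_le_add_right Finset.card_image_le _
      have a2 : ((F n).filter (· ∈ (fun x => g * x) '' X)).card ≤
          ((F n).filter (· ∈ X)).card + B'.card := by
        have : ((F n).filter (· ∈ (fun x => g * x) '' X)) ⊆
            ((F n).filter (· ∈ X)).image (fun y => g * y) ∪ B' := by
          intro y hy
          simp only [Finset.mem_filter, Finset.mem_union, Finset.mem_image, B'] at hy ⊢
          obtain ⟨hy1, x, hx, rfl⟩ := hy
          by_cases h : x ∈ F n
          · exact Or.inl ⟨x, ⟨h, hx⟩, rfl⟩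
          · exact Or.inr ⟨hy1, by simpa using h⟩
        refine (Finset.card_le_card this).trans ((Finset.card_union_le _ _).trans ?_)
        exact Nat.add_le_add_right Finset.card_image_le _
      rw [hB] at a2
      rw [abs_le]
      constructor
      · have : ((((F n).filter (· ∈ X)).card : ℕ) : ℝ) ≤ _ := Nat.cast_le.2 a1
        push_cast at this
        linarith
      · have : ((((F n).filter (· ∈ (fun x => g * x) '' X)).card : ℕ) : ℝ) ≤ _ :=
          Nat.cast_le.2 a2
        push_cast at this
        linarith
    have h3 : Tendsto (fun n => f ((fun x => g * x) '' X) n - f X n) ω (𝓝 0) :=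
      squeeze_zero_norm h2 ((hlim g hg).mono_left hω)
    have h4 := h3.add (ht X)
    simp only [sub_add_cancel, zero_add] at h4
    exact tendsto_nhds_unique (ht _) h4
  refine ⟨fun X => omegaLim ω (f X), fun X => ge_of_tendsto' (ht X) (h0 X), ?_, ?_, ?_⟩
  · have : f Set.univ = fun _ => 1 := by
      funext n
      simp only [f, Set.mem_univ, Finset.filter_true]
      exact div_self (hpos n).ne'
    have h := ht Set.univ
    rw [this] at h
    change omegaLim ω (f Set.univ) = 1
    rw [this]
    exact tendsto_nhds_unique h tendsto_const_nhds
  · intro X Y hXY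
    have h : f (X ∪ Y) = fun n => f X n + f Y n := by
      funext n
      simp only [f, ← add_div]
      congr 1
      rw [← Nat.cast_add, ← Finset.card_union_of_disjoint]
      · congr 2
        ext x
        simp [and_or_left]
      · rw [Finset.disjoint_filter]
        exact fun x _ h1 h2 => Set.disjoint_left.1 hXY h1 h2
    have h2 := ht (X ∪ Y)
    change omegaLim ω (f (X ∪ Y)) = _
    refine tendsto_nhds_unique h2 ?_
    conv in f (X ∪ Y) => rw [h]
    exact (ht X).add (ht Y)
  · intro g
    have hg : g ∈ Subgroup.closure S := hS ▸ Subgroup.mem_top g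
    induction hg using Subgroup.closure_induction with
    | mem x hx => exact hcongr x hx
    | one => simp
    | mul x y _ _ hx hy =>
      intro X
      have : (fun z => x * y * z) '' X = (fun z => x * z) '' ((fun z => y * z) '' X) := by
        rw [Set.image_image]; simp only [mul_assoc]
      rw [this, hx, hy]
    | inv x _ hx =>
      intro X
      rw [← hx, Set.image_image]
      simp

end Folner

/-! ### The algebraic properties in the first half of the theorem -/

namespace LocalModel

open SemidirectProduct Multiplicative

variable {p : ℕ} {c : ℕ+ → ℕ+} {A : Type} [Group A]

section

variable {L : Set ℕ+} (M : LocalModel p c L A)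

theorem isLocalTuple_single :
    IsLocalTuple p c L fun i : ℤ => ofAdd (Finsupp.single i (1 : ZMod p)) where
  pow_eq_one i := by
    rw [← ofAdd_nsmul, Finsupp.smul_single]
    simp
  comm_eq_one n _ i _ := by
    -- Positivity of `c n` matters: the relator is a commutator of at least two entries and so
    -- vanishes in an abelian group.
    obtain ⟨k, hk⟩ : ∃ k, (c n : ℕ) = k + 1 := ⟨c n - 1, by have := (c n).pos; omega⟩
    rw [hk, leftNormedCommutator, commutatorElement_eq_one_iff_mul_comm, mul_comm]

theorem gen_injective (hp : p.Prime) : Function.Injective M.gen := by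
  have : Fact p.Prime := ⟨hp⟩
  obtain ⟨f, hf⟩ := M.exists_lift _ isLocalTuple_single
  intro i j h
  have h2 := congrArg f h
  rw [hf, hf] at h2
  exact Finsupp.single_left_injective one_ne_zero (ofAdd.injective h2)

theorem exists_surjective_wreath (hp : p.Prime) :
    ∃ f : M.Ext →* WreathZModInt p, Function.Surjective f := by
  have : Fact p.Prime := ⟨hp⟩
  have hs : ∀ i : ℤ, baseShift p (ofAdd (Finsupp.single i 1)) =
      ofAdd (Finsupp.single (i + 1) 1) := by
    intro i
    change ofAdd (Finsupp.domCongr (Equiv.addRight (1 : ℤ)) (Finsupp.single i (1 : ZMod p))) = _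
    simp
  have key : ∀ i : ℤ, ((inr (ofAdd 1) : WreathZModInt p) ^ i *
      inl (ofAdd (Finsupp.single 0 1)) * (inr (ofAdd 1) ^ i)⁻¹) =
      inl (ofAdd (Finsupp.single i 1)) := by
    intro i
    rw [← map_zpow, ← map_inv, ← inl_aut, zpowersHom_apply, toAdd_zpow, toAdd_ofAdd, smul_eq_mul,
      mul_one, zpow_apply_of_shift hs, zero_add]
  obtain ⟨F, hF1, hF2⟩ := M.exists_ext_hom (H := WreathZModInt p)
    (inl (ofAdd (Finsupp.single 0 1))) (inr (ofAdd 1)) (by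
      simp only [key]
      exact isLocalTuple_single.map inl)
  have hr : (inr (ofAdd 1) : WreathZModInt p) ∈ F.range := ⟨_, hF2⟩
  have hb : (inl (ofAdd (Finsupp.single 0 1)) : WreathZModInt p) ∈ F.range := ⟨_, hF1⟩
  refine ⟨F, fun x => ?_⟩
  rw [← MonoidHom.mem_range, ← inl_left_mul_inr_right x]
  refine mul_mem ?_ ?_
  · rw [← ofAdd_toAdd x.left]
    induction toAdd x.left using Finsupp.induction_linear with
    | zero => rw [ofAdd_zero, map_one]; exact one_mem _
    | add f g hf hg => rw [ofAdd_add, map_mul]; exact mul_mem hf hg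
    | single i b =>
      have : Finsupp.single i b = b.val • Finsupp.single i (1 : ZMod p) := by
        rw [Finsupp.smul_single, nsmul_eq_mul, mul_one, ZMod.natCast_zmod_val]
      rw [this, ofAdd_nsmul, map_pow, ← key]
      exact pow_mem (mul_mem (mul_mem (zpow_mem hr _) hb) (inv_mem (zpow_mem hr _))) _
  · rw [← ofAdd_toAdd x.right]
    refine ⟨M.stable ^ toAdd x.right, ?_⟩
    rw [map_zpow, hF2, ← map_zpow, ← ofAdd_zsmul, smul_eq_mul, mul_one]

/-- The projection to `A`, a homomorphism on the kernel of the projection to `ℤ`. -/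
def kerToBase : (rightHom : M.Ext →* Multiplicative ℤ).ker →* A where
  toFun x := x.1.left
  map_one' := rfl
  map_mul' x y := by
    have hx : x.1.right = 1 := x.2
    change x.1.left * _ = _
    rw [hx, map_one]; rfl

theorem kerToBase_injective : Function.Injective M.kerToBase := by
  intro x y h
  have hx : x.1.right = 1 := x.2
  have hy : y.1.right = 1 := y.2
  exact Subtype.ext (SemidirectProduct.ext h (hx.trans hy.symm))

theorem exists_subset_window {S : Set A} (hS : S.Finite) :
    ∃ n : ℕ, S ⊆ M.window (-n) n := by
  induction S, hS using Set.Finite.induction_on with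
  | empty => exact ⟨0, Set.empty_subset _⟩
  | insert _ _ ih =>
    rename_i a S _ _
    obtain ⟨m, hm⟩ := ih
    obtain ⟨n, hn⟩ := M.exists_mem_window a
    refine ⟨max m n, Set.insert_subset (M.window_mono (by simp) (by simp) hn)
      (hm.trans (M.window_mono (by simp) (by simp)))⟩

end

variable (M : LocalModel p c Set.univ A)

theorem finite_window_univ (hp : p.Prime) (u v : ℤ) : Finite (M.window u v) :=
  M.finite_window hp (n := ⟨(v - u).natAbs + 1, by omega⟩) (Set.mem_univ _)
    (show v - u ≤ (((v - u).natAbs + 1 : ℕ) : ℤ) by omega)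

theorem isPGroup_window_univ (hp : p.Prime) (u v : ℤ) : IsPGroup p (M.window u v) :=
  M.isPGroup_window hp (n := ⟨(v - u).natAbs + 1, by omega⟩) (Set.mem_univ _)
    (show v - u ≤ (((v - u).natAbs + 1 : ℕ) : ℤ) by omega)

theorem isPGroup_base (M : LocalModel p c Set.univ A) (hp : p.Prime) : IsPGroup p A := by
  intro a
  obtain ⟨n, hn⟩ := M.exists_mem_window a
  obtain ⟨k, hk⟩ := M.isPGroup_window_univ hp _ _ ⟨a, hn⟩
  exact ⟨k, congrArg Subtype.val hk⟩

theorem isLocallyNilpotentPGroupByInfiniteCyclic (hp : p.Prime) :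
    IsLocallyNilpotentPGroupByInfiniteCyclic p M.Ext := by
  have : Fact p.Prime := ⟨hp⟩
  refine ⟨(rightHom : M.Ext →* Multiplicative ℤ).ker, inferInstance, fun H hH => ?_,
    (M.isPGroup_base hp).of_injective M.kerToBase M.kerToBase_injective,
    ⟨QuotientGroup.quotientKerEquivOfSurjective _ rightHom_surjective⟩⟩
  obtain ⟨S, hS, hSf⟩ := (Subgroup.fg_iff _).1 hH
  obtain ⟨n, hn⟩ := M.exists_subset_window (hSf.image M.kerToBase)
  have hle : H.map M.kerToBase ≤ M.window (-n) n := by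
    rw [← hS, MonoidHom.map_closure, Subgroup.closure_le]
    exact hn
  let f : H →* M.window (-n) n :=
    (M.kerToBase.comp H.subtype).codRestrict _ fun x => hle ⟨x, x.2, rfl⟩
  have hf : Function.Injective f := fun x y h =>
    Subtype.ext (M.kerToBase_injective (congrArg Subtype.val h))
  have := M.finite_window_univ hp (-n) n
  have : Finite H := Finite.of_injective f hf
  exact ((M.isPGroup_window_univ hp (-n) n).of_injective f hf).isNilpotent

theorem isElementaryAmenable (hp : p.Prime) : IsElementaryAmenable M.Ext := by
  have hA : IsElementaryAmenable A := by
    refine .of_directed (Set.range fun n : ℕ => M.window (-n) n) ⟨_, 0, rfl⟩ ?_ ?_ ?_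
    · rintro _ ⟨m, rfl⟩ _ ⟨n, rfl⟩
      exact ⟨_, ⟨max m n, rfl⟩, M.window_mono (by simp) (by simp),
        M.window_mono (by simp) (by simp)⟩
    · rintro _ ⟨m, rfl⟩
      have := M.finite_window_univ hp (-m) m
      exact .of_finite _
    · intro a
      obtain ⟨n, hn⟩ := M.exists_mem_window a
      exact ⟨_, ⟨n, rfl⟩, hn⟩
  refine .of_extension (rightHom : M.Ext →* Multiplicative ℤ).ker
    (.of_injective M.kerToBase M.kerToBase_injective hA)
    (.of_injective
      (QuotientGroup.quotientKerEquivOfSurjective _ rightHom_surjective).toMonoidHom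
      (MulEquiv.injective _) (.of_comm (Multiplicative ℤ) mul_comm))

/-- The Følner sets consist of `t^m a` with `0 ≤ m ≤ n` and `a` in the window `[-n, n]`. Left
multiplication by `a_0` preserves each layer, since `a_0 t^m = t^m a_{-m}`; left multiplication by
`t` pushes out only the last of the `n + 1` equal layers. -/
theorem isAmenableGroup (hp : p.Prime) : IsAmenableGroup M.Ext := by
  classical
  have hfin := fun n : ℕ => M.finite_window_univ hp (-(n : ℤ)) n
  let W : ℕ → Finset A := fun n => (Set.toFinite (M.window (-(n : ℤ)) n : Set A)).toFinset
  have hW : ∀ n a, a ∈ W n ↔ a ∈ M.window (-(n : ℤ)) n := fun n a => by simp [W]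
  let e : ℕ × A → M.Ext := fun x => M.stable ^ (x.1 : ℤ) * inl x.2
  have he : Function.Injective e := by
    rintro ⟨m, a⟩ ⟨n, b⟩ h
    have h1 := congrArg rightHom h
    simp only [e, M.stable_zpow, map_mul, rightHom_inr, rightHom_inl, mul_one] at h1
    have h2 : m = n := by exact_mod_cast ofAdd.injective h1
    subst h2
    have h3 : a = b := inl_injective (mul_left_cancel h)
    rw [h3]
  have hcard : ∀ n, ((Finset.range (n + 1) ×ˢ W n).image e).card = (n + 1) * (W n).card :=
    fun n => by rw [Finset.card_image_of_injective _ he, Finset.card_product, Finset.card_range]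
  have hWpos : ∀ n, (0 : ℝ) < (W n).card := fun n => by
    exact_mod_cast Finset.card_pos.2 ⟨1, (hW n 1).2 (one_mem _)⟩
  refine isAmenableGroup_of_folner {M.base, M.stable} M.closure_base_stable
    (fun n => (Finset.range (n + 1) ×ˢ W n).image e)
    (fun n => ⟨e (0, 1), Finset.mem_image_of_mem _ (by simp [hW, one_mem])⟩) ?_
  rintro g (rfl | rfl)
  · refine tendsto_const_nhds.congr fun n => ?_
    rw [Finset.filter_false_of_mem, Finset.card_empty, Nat.cast_zero, zero_div]
    intro x hx
    rw [not_not]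
    simp only [Finset.mem_image, Finset.mem_product, Finset.mem_range, hW] at hx ⊢
    obtain ⟨⟨m, a⟩, ⟨hm, ha⟩, rfl⟩ := hx
    dsimp only at hm ha
    refine ⟨(m, M.gen (-m) * a), ⟨hm, mul_mem (M.gen_mem_window ?_) ha⟩, ?_⟩
    · rw [Set.mem_Icc]; omega
    · simp only [e]
      rw [map_mul, M.inl_gen]
      group
  · have h0 : Tendsto (fun n : ℕ => 1 / ((n : ℝ) + 1)) atTop (𝓝 0) :=
      tendsto_one_div_add_atTop_nhds_zero_nat
    refine squeeze_zero (fun n => by positivity) (fun n => ?_) h0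
    have : (((Finset.range (n + 1) ×ˢ W n).image e).filter fun x =>
        M.stable * x ∉ (Finset.range (n + 1) ×ˢ W n).image e) ⊆
        ((W n).image fun a => e (n, a)) := by
      intro x hx
      simp only [Finset.mem_filter, Finset.mem_image, Finset.mem_product, Finset.mem_range] at hx ⊢
      obtain ⟨⟨⟨m, a⟩, ⟨hm, ha⟩, rfl⟩, h⟩ := hx
      dsimp only at hm ha
      rcases Nat.lt_succ_iff_lt_or_eq.1 hm with hm' | rfl
      · refine absurd ⟨(m + 1, a), ⟨by simpa using hm', ha⟩, ?_⟩ h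
        simp only [e]
        rw [← mul_assoc, ← zpow_one_add, add_comm]
        push_cast; rfl
      · exact ⟨a, ha, rfl⟩
    have h2 := (Finset.card_le_card this).trans Finset.card_image_le
    rw [hcard, div_le_div_iff₀ (by have := hWpos n; push_cast; positivity) (by positivity), one_mul]
    have h3 := mul_le_mul_of_nonneg_right ((Nat.cast_le (α := ℝ)).2 h2)
      (by positivity : (0 : ℝ) ≤ (n : ℝ) + 1)
    refine h3.trans_eq ?_
    push_cast
    ring

/-- A cyclic subgroup of finite index would meet the infinite torsion group `A` in a cyclic torsion,
hence finite, subgroup of finite index. -/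
theorem not_isVirtuallyCyclic (hp : p.Prime) : ¬ IsVirtuallyCyclic M.Ext := by
  rintro ⟨H, hc, hf⟩
  have hinf : Infinite A := Infinite.of_injective _ (M.gen_injective hp)
  let K := H.comap (inl : A →* M.Ext)
  have hKf : K.FiniteIndex := ⟨by
    rw [Subgroup.index_comap]
    exact (Subgroup.instFiniteIndex_subgroupOf H inl.range).index_ne_zero⟩
  let f : K →* H := ((inl : A →* M.Ext).comp K.subtype).codRestrict _ fun x => x.2
  have hf : Function.Injective f := fun x y h =>
    Subtype.ext (inl_injective (congrArg Subtype.val h))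
  have : IsCyclic K := isCyclic_of_injective f hf
  obtain ⟨g, hg⟩ := IsCyclic.exists_generator (α := K)
  have hgo : IsOfFinOrder g := ((M.isPGroup_base hp).to_subgroup K).isOfFinOrder hp.ne_zero g
  have : Finite K := by
    have h1 : Finite (Subgroup.zpowers g) := (finite_zpowers.2 hgo).to_subtype
    rw [show Subgroup.zpowers g = ⊤ from (Subgroup.eq_top_iff' _).2 hg] at h1
    exact Finite.of_equiv _ Subgroup.topEquiv.toEquiv
  have : Finite (A ⧸ K) := Subgroup.finite_quotient_of_finiteIndex
  exact not_finite_iff_infinite.2 hinf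
    (Finite.of_equiv _ (Subgroup.groupEquivQuotientProdSubgroup (s := K)).symm)

theorem isResiduallyFinitePGroup (hp : p.Prime) : IsResiduallyFinitePGroup p M.Ext := by
  intro g hg
  obtain ⟨n, hn⟩ := M.exists_mem_window g.left
  -- Write `g = a t^m`. The window contains `a`, and `w = |m|` makes `χ` detect `m ≠ 0`, because
  -- `|m| < p^(|m|+1)`. The level `2 * n + 1` is the width of the window plus one, for positivity.
  obtain ⟨E, _, _, F, χ, hE, hF1, hF2, hF3⟩ := M.exists_finite_quotient hp (u := -n) (v := n)
    (n := ⟨2 * n + 1, by omega⟩) (Set.mem_univ _) (by push_cast [PNat.mk_coe]; omega)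
    (toAdd g.right).natAbs
  have hgdec : g = inl g.left * M.stable ^ (toAdd g.right) := by
    rw [M.stable_zpow, ofAdd_toAdd, inl_left_mul_inr_right]
  refine ⟨F.ker, inferInstance, fun h => hg ?_,
    Finite.of_injective _ (QuotientGroup.kerLift_injective F),
    hE.of_injective _ (QuotientGroup.kerLift_injective F)⟩
  rw [MonoidHom.mem_ker] at h
  have h1 : toAdd g.right = 0 := by
    have h2 : χ (F (inl g.left * M.stable ^ toAdd g.right)) = 1 := by
      rw [← hgdec, h, map_one]
    rw [map_mul, map_mul, hF2, one_mul, map_zpow, map_zpow, hF3, ← ofAdd_zsmul,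
      zsmul_one, ofAdd_eq_one, ZMod.intCast_zmod_eq_zero_iff_dvd] at h2
    · refine Int.eq_zero_of_abs_lt_dvd h2 ?_
      have h3 : (toAdd g.right).natAbs + 1 < p ^ ((toAdd g.right).natAbs + 1) :=
        Nat.lt_pow_self hp.one_lt
      have h4 : (((toAdd g.right).natAbs + 1 : ℕ) : ℤ) <
        ((p ^ ((toAdd g.right).natAbs + 1) : ℕ) : ℤ) := by exact_mod_cast h3
      rw [Int.abs_eq_natAbs]
      push_cast at h4 ⊢
      omega
  rw [hgdec, h1, zpow_zero, mul_one] at h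
  rw [hgdec, h1, zpow_zero, mul_one]
  rw [hF1 _ hn h, map_one]

theorem _root_.IsResiduallyFinitePGroup.isResiduallyNilpotent {G : Type*} [Group G]
    (hp : p.Prime) (h : IsResiduallyFinitePGroup p G) : IsResiduallyNilpotent G := by
  have : Fact p.Prime := ⟨hp⟩
  intro g hg
  obtain ⟨N, hN, hgN, hfin, hpg⟩ := h g hg
  exact ⟨N, hN, hgN, hpg.isNilpotent⟩

end LocalModel

/-! ### The four-point condition for groups that act on a tree of lists -/

section ListTree

variable {α : Type*}

/-- Two lists are equal or one is the tail of the other. -/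
def ListStep (l l' : List α) : Prop := l' = l ∨ (∃ x, l' = x :: l) ∨ ∃ x, l = x :: l'

theorem ListStep.symm {l l' : List α} (h : ListStep l l') : ListStep l' l := by
  rcases h with h | h | h
  exacts [Or.inl h.symm, Or.inr (Or.inr h), Or.inr (Or.inl h)]

theorem exists_cons_suffix {m l : List α} (h : m <:+ l) (hne : l ≠ m) : ∃ a, a :: m <:+ l := by
  obtain ⟨t, rfl⟩ := h
  rcases List.eq_nil_or_concat t with rfl | ⟨t', a, rfl⟩
  · exact absurd rfl hne
  · exact ⟨a, t', by simp⟩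

/-- A path of lists from `w 0` to `w k` passes through the longest common suffix of its ends. -/
theorem exists_eq_of_suffix {m : List α} (w : ℕ → List α) (k : ℕ)
    (hstep : ∀ j < k, ListStep (w j) (w (j + 1))) (h0 : m <:+ w 0)
    (hk : ∀ a, a :: m <:+ w 0 → ¬ a :: m <:+ w k) : ∃ j ≤ k, w j = m := by
  by_cases hm : w 0 = m
  · exact ⟨0, Nat.zero_le _, hm⟩
  obtain ⟨a, ha⟩ := exists_cons_suffix h0 hm
  have : ∃ j < k, a :: m <:+ w j ∧ ¬ a :: m <:+ w (j + 1) := by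
    by_contra! hcon
    have : ∀ j ≤ k, a :: m <:+ w j := by
      intro j
      induction j with
      | zero => exact fun _ => ha
      | succ j ih => exact fun hj => hcon j hj (ih (by omega))
    exact hk a ha (this k le_rfl)
  obtain ⟨j, hj, h1, h2⟩ := this
  refine ⟨j + 1, hj, ?_⟩
  rcases hstep j hj with h | ⟨x, h⟩ | ⟨x, h⟩
  · rw [h] at h2; exact absurd h1 h2
  · rw [h] at h2; exact absurd (h1.trans (List.suffix_cons x _)) h2
  · rw [h, List.suffix_cons_iff] at h1
    rcases h1 with h1 | h1
    · exact (List.cons_eq_cons.1 h1).2.symm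
    · exact absurd h1 h2

variable {G : Type*} [Group G] {S : Set G}

/-- The hypotheses place `m` on the tree path from `f x` to `f z`. The prefixes of a shortest word
from `x` to `z` trace a path of lists, which must visit `m`; the word is cut there. -/
theorem exists_on_geodesic (hS : Subgroup.closure S = ⊤) (f : G → List α)
    (hf : ∀ g, ∀ s ∈ S, ListStep (f g) (f (g * s))) {m : List α} {x z : G} (hx : m <:+ f x)
    (hz : ∀ a, a :: m <:+ f x → ¬ a :: m <:+ f z) :
    ∃ u, f u = m ∧ wordLength S (x⁻¹ * u) + wordLength S (u⁻¹ * z) ≤ wordLength S (x⁻¹ * z) := by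
  obtain ⟨l, hl, hlS, hlp⟩ := isWordOfLength_wordLength hS (x⁻¹ * z)
  have hz' : x * l.prod = z := by rw [hlp, mul_inv_cancel_left]
  obtain ⟨j, hj, hjm⟩ := exists_eq_of_suffix (fun j => f (x * (l.take j).prod)) l.length
    (fun j hj => by
      rw [List.take_add_one, List.getElem?_eq_getElem hj, Option.toList_some, List.prod_append,
        List.prod_singleton, ← mul_assoc]
      rcases hlS _ (List.getElem_mem hj) with h | h
      · exact hf _ _ h
      · have := hf (x * (l.take j).prod * l[j]) _ h
        rw [mul_inv_cancel_right] at this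
        exact this.symm)
    (by simpa using hx) (by simpa [hz'] using hz)
  refine ⟨_, hjm, ?_⟩
  rw [← hl]
  have h1 : wordLength S (x⁻¹ * (x * (l.take j).prod)) ≤ j :=
    wordLength_le ⟨l.take j, by simp [hj], fun y hy => hlS y (List.mem_of_mem_take hy), by simp⟩
  have h2 : wordLength S ((x * (l.take j).prod)⁻¹ * z) ≤ l.length - j := by
    refine wordLength_le ⟨l.drop j, by simp, fun y hy => hlS y (List.mem_of_mem_drop hy), ?_⟩
    rw [← hz', ← List.prod_take_mul_prod_drop l j]
    group
  omega

theorem wordLength_symm (hS : Subgroup.closure S = ⊤) (x y : G) :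
    wordLength S (x⁻¹ * y) = wordLength S (y⁻¹ * x) := by
  rw [← wordLength_inv hS, mul_inv_rev, inv_inv]

theorem wordLength_triangle (hS : Subgroup.closure S = ⊤) (x y z : G) :
    wordLength S (x⁻¹ * z) ≤ wordLength S (x⁻¹ * y) + wordLength S (y⁻¹ * z) := by
  have := wordLength_mul_le hS (x⁻¹ * y) (y⁻¹ * z)
  rwa [mul_assoc, mul_inv_cancel_left] at this

/-- A group that maps to the tree of lists, so that generators move the image by at most one step
and the fibres have diameter at most `D`, satisfies the four-point condition. -/
theorem fourPoint_of_listStep (hS : Subgroup.closure S = ⊤) (f : G → List α) (D : ℕ)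
    (hf : ∀ g, ∀ s ∈ S, ListStep (f g) (f (g * s)))
    (hD : ∀ g h, f g = f h → wordLength S (g⁻¹ * h) ≤ D) (h1 : f 1 = []) (x y z w : G) :
    wordLength S (x⁻¹ * y) + wordLength S (z⁻¹ * w) ≤
      max (wordLength S (x⁻¹ * z) + wordLength S (y⁻¹ * w))
        (wordLength S (x⁻¹ * w) + wordLength S (y⁻¹ * z)) + 4 * D := by
  let d : G → G → ℕ := fun x y => wordLength S (x⁻¹ * y)
  have dsymm : ∀ x y, d x y = d y x := wordLength_symm hS
  have dtri : ∀ x y z, d x z ≤ d x y + d y z := wordLength_triangle hS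
  -- The vertex `m` lies on the tree paths from `x` and from `y` to both `z` and `1`, so up to
  -- multiples of `D` these four distances split at one point `u` over `m`. The two sums that pair
  -- `x`, `y` with `z`, `1` then nearly agree, and the remaining sum is at most as large up to the
  -- error.
  have core : ∀ (x y z : G) (m : List α), m <:+ f x → m <:+ f y →
      (∀ a, a :: m <:+ f x → ¬ a :: m <:+ f z) → (∀ a, a :: m <:+ f y → ¬ a :: m <:+ f z) →
      d x y + d z 1 ≤ d x z + d y 1 + 4 * D ∧ d x z + d y 1 ≤ d x 1 + d y z + 4 * D ∧
        d x 1 + d y z ≤ d x z + d y 1 + 4 * D := by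
    intro x y z m hx hy hxz hyz
    have hnil : ∀ l : List α, ∀ a, a :: m <:+ l → ¬ a :: m <:+ f 1 := by
      intro l a _ h
      rw [h1] at h
      simpa using h.length_le
    obtain ⟨u, hu, hu'⟩ := exists_on_geodesic hS f hf hx hxz
    obtain ⟨u₁, hu₁, hu₁'⟩ := exists_on_geodesic hS f hf hy hyz
    obtain ⟨u₂, hu₂, hu₂'⟩ := exists_on_geodesic hS f hf hx (hnil _)
    obtain ⟨u₃, hu₃, hu₃'⟩ := exists_on_geodesic hS f hf hy (hnil _)
    change d x u + d u z ≤ d x z at hu'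
    change d y u₁ + d u₁ z ≤ d y z at hu₁'
    change d x u₂ + d u₂ 1 ≤ d x 1 at hu₂'
    change d y u₃ + d u₃ 1 ≤ d y 1 at hu₃'
    have e1 : d u u₁ ≤ D := hD _ _ (hu.trans hu₁.symm)
    have e2 : d u u₂ ≤ D := hD _ _ (hu.trans hu₂.symm)
    have e3 : d u u₃ ≤ D := hD _ _ (hu.trans hu₃.symm)
    have s1 := dsymm u u₁
    have s2 := dsymm u u₂
    have s3 := dsymm u u₃
    have t1 := dtri y u₁ u
    have t2 := dtri u u₁ z
    have t3 := dtri x u₂ u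
    have t4 := dtri u u₂ 1
    have t5 := dtri y u₃ u
    have t6 := dtri u u₃ 1
    have r1 := dtri x u y
    have r2 := dtri z u 1
    have r3 := dtri x u z
    have r4 := dtri y u 1
    have r5 := dtri x u 1
    have r6 := dtri y u z
    have s4 := dsymm u y
    have s5 := dsymm u z
    omega
  have base : ∀ x y z : G, d x y + d z 1 ≤ max (d x z + d y 1) (d x 1 + d y z) + 4 * D := by
    intro x y z
    -- A longest suffix shared by two of the three lists is their branch point: maximality excludes
    -- a longer suffix common to either of these lists and the third.
    let Q : ℕ → Prop := fun k => ∃ m : List α, m.length = k ∧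
      ((m <:+ f x ∧ m <:+ f y) ∨ (m <:+ f x ∧ m <:+ f z) ∨ (m <:+ f y ∧ m <:+ f z))
    have hQ0 : Q 0 := ⟨[], rfl, Or.inl ⟨List.nil_suffix, List.nil_suffix⟩⟩
    classical
    have hQb : ∀ k, Q k → k ≤ (f x).length + (f y).length := by
      rintro k ⟨m, rfl, ⟨h, -⟩ | ⟨h, -⟩ | ⟨h, -⟩⟩ <;> have := h.length_le <;> omega
    have hmax := Nat.findGreatest_spec (P := Q) (Nat.zero_le ((f x).length + (f y).length)) hQ0
    set K := Nat.findGreatest Q ((f x).length + (f y).length) with hK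
    have hno : ¬ Q (K + 1) := fun h =>
      absurd (Nat.le_findGreatest (hQb _ h) h) (by omega)
    obtain ⟨m, hm, h | h | h⟩ := hmax
    · have := core x y z m h.1 h.2
        (fun a h1 h2 => hno ⟨a :: m, by simp [hm], Or.inr (Or.inl ⟨h1, h2⟩)⟩)
        (fun a h1 h2 => hno ⟨a :: m, by simp [hm], Or.inr (Or.inr ⟨h1, h2⟩)⟩)
      omega
    · have := core x z y m h.1 h.2
        (fun a h1 h2 => hno ⟨a :: m, by simp [hm], Or.inl ⟨h1, h2⟩⟩)
        (fun a h1 h2 => hno ⟨a :: m, by simp [hm], Or.inr (Or.inr ⟨h2, h1⟩)⟩)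
      have s1 := dsymm y z
      omega
    · have := core y z x m h.1 h.2
        (fun a h1 h2 => hno ⟨a :: m, by simp [hm], Or.inl ⟨h2, h1⟩⟩)
        (fun a h1 h2 => hno ⟨a :: m, by simp [hm], Or.inr (Or.inl ⟨h2, h1⟩)⟩)
      have s1 := dsymm y z
      have s2 := dsymm y x
      have s3 := dsymm z x
      omega
  -- By left invariance the fourth point may be moved to `1`, which lies over the root `[]`.
  have h := base (w⁻¹ * x) (w⁻¹ * y) (w⁻¹ * z)
  have e : ∀ a b : G, d (w⁻¹ * a) (w⁻¹ * b) = d a b := fun a b => by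
    simp only [d]; congr 1; group
  have e' : ∀ a : G, d (w⁻¹ * a) 1 = d a w := fun a => by
    simp only [d]; congr 1; group
  simpa only [e, e'] using h

end ListTree

/-! ### The structure of an HNN extension -/

namespace HNNExtension

open NormalWord

/-- Multiplication by the stable letter or its inverse either cancels the first syllable of the
normal form or puts a new one in front. The head in the vertex group is forgotten, so lists of
syllables play the role of vertices of the Bass–Serre tree. -/
theorem listStep_unitsSMul {G : Type*} [Group G] {A B : Subgroup G} (φ : A ≃* B)
    {d : TransversalPair G A B} (u : ℤˣ) (w : NormalWord d) :
    ListStep w.toList (unitsSMul φ u w).toList := by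
  classical
  unfold unitsSMul
  split_ifs with h
  · cases w using consRecOn with
    | ofGroup g => simp [Cancels] at h
    | cons g u' w h1 h2 => exact Or.inr (Or.inr ⟨(u', w.head), rfl⟩)
  · exact Or.inr (Or.inl ⟨_, rfl⟩)

end HNNExtension

/-! ### The extension inside an HNN extension of a finite `p`-group; hyperbolicity -/

namespace LocalModel

open SemidirectProduct Multiplicative HNNExtension

variable {p : ℕ} {c : ℕ+ → ℕ+} {L : Set ℕ+} {A : Type} [Group A] (M : LocalModel p c L A) (N : ℕ)

/-- The vertex group of the HNN extension. -/
abbrev vertexGroup : Type := M.window 0 N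

/-- The first associated subgroup. -/
def lowerSubgroup : Subgroup (M.vertexGroup N) := (M.window 0 (N - 1)).subgroupOf _

/-- The second associated subgroup. -/
def upperSubgroup : Subgroup (M.vertexGroup N) := (M.window 1 N).subgroupOf _

/-- The isomorphism of the associated subgroups induced by the shift. -/
noncomputable def shiftEquiv : M.lowerSubgroup N ≃* M.upperSubgroup N :=
  (Subgroup.subgroupOfEquivOfLe (M.window_mono le_rfl (by omega))).trans <|
    (M.shift.subgroupMap _).trans <|
      (MulEquiv.subgroupCongr (by
        have := M.map_shift_zpow_window 1 0 (N - 1)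
        rw [zpow_one, zero_add, sub_add_cancel] at this
        exact this)).trans
      (Subgroup.subgroupOfEquivOfLe (M.window_mono (by omega) le_rfl)).symm

theorem coe_shiftEquiv (a : M.lowerSubgroup N) :
    ((M.shiftEquiv N a : M.vertexGroup N) : A) = M.shift (a : M.vertexGroup N) := rfl

/-- The HNN extension that the extension by the shift is isomorphic to if all relations have level
at most `N`. -/
abbrev HNN : Type := HNNExtension (M.vertexGroup N) _ _ (M.shiftEquiv N)

theorem coe_windowTuple {u v i : ℤ} (h : i ∈ Set.Icc u v) :
    (M.windowTuple u v i : A) = M.gen i := by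
  rw [windowTuple, dif_pos h]

theorem of_windowTuple (k : ℕ) (hk : k ≤ N) :
    (of (M.windowTuple 0 N k) : M.HNN N) =
      t ^ (k : ℤ) * of (M.windowTuple 0 N 0) * (t ^ (k : ℤ))⁻¹ := by
  induction k with
  | zero => simp
  | succ k ih =>
    have hk1 : (k : ℤ) ∈ Set.Icc (0 : ℤ) N := by rw [Set.mem_Icc]; omega
    have hk2 : ((k + 1 : ℕ) : ℤ) ∈ Set.Icc (0 : ℤ) N := by rw [Set.mem_Icc]; omega
    have hmem : M.windowTuple 0 N k ∈ M.lowerSubgroup N := by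
      rw [windowTuple, dif_pos hk1, lowerSubgroup, Subgroup.mem_subgroupOf]
      exact M.gen_mem_window (by rw [Set.mem_Icc]; omega)
    have h := equiv_eq_conj (φ := M.shiftEquiv N) ⟨_, hmem⟩
    have h2 : ((M.shiftEquiv N ⟨_, hmem⟩ : M.upperSubgroup N) : M.vertexGroup N) =
        M.windowTuple 0 N (k + 1 : ℕ) := by
      refine Subtype.ext ?_
      rw [M.coe_shiftEquiv]
      rw [M.coe_windowTuple hk2]
      change M.shift (M.windowTuple 0 N k : A) = _
      rw [M.coe_windowTuple hk1, M.shift_gen, Nat.cast_add, Nat.cast_one]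
    rw [h2] at h
    rw [h, ih (by omega), Nat.cast_add, Nat.cast_one, add_comm (k : ℤ) 1, zpow_add, zpow_one]
    group

/-- A relation of level at most `N` involves indices in a window of width at most `N`. Conjugation
by the power of `t` given by its smallest index brings it into the vertex group, where it holds. -/
theorem isLocalTuple_hnn (hL : ∀ n ∈ L, (n : ℕ) ≤ N) :
    IsLocalTuple p c L fun i : ℤ =>
      (t ^ i * of (M.windowTuple 0 N 0) * (t ^ i)⁻¹ : M.HNN N) where
  pow_eq_one i := by
    rw [conj_pow, ← map_pow, (M.isLocalTuple_windowTuple 0 N).pow_eq_one, map_one, mul_one,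
      mul_inv_cancel]
  comm_eq_one n hn i hi := by
    obtain ⟨j₀, hj₀, hmin⟩ := Finset.exists_min_image (Finset.range (c n + 1)) i ⟨0, by simp⟩
    rw [Finset.mem_range, Nat.lt_succ_iff] at hj₀
    have hloc := ((M.isLocalTuple_windowTuple 0 N).comp_add (-(i j₀))).map
      ((MulAut.conj (t ^ i j₀ : M.HNN N)).toMonoidHom.comp of)
    rw [← hloc.comm_eq_one n hn i hi]
    refine leftNormedCommutator_congr fun j hj => ?_
    have h1 := hmin j (by simpa using Nat.lt_succ_of_le hj)
    have h2 := (abs_le.1 (hi j hj j₀ hj₀)).2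
    have h3 : (n : ℤ) ≤ N := by exact_mod_cast hL n hn
    obtain ⟨k, hk⟩ := Int.eq_ofNat_of_zero_le (sub_nonneg.2 h1)
    rw [← sub_eq_add_neg, hk]
    simp only [MonoidHom.comp_apply, MulEquiv.coe_toMonoidHom, MulAut.conj_apply]
    rw [M.of_windowTuple N k (by omega), ← hk]
    have : i j = i j₀ + (i j - i j₀) := by ring
    conv_lhs => rw [this, zpow_add]
    group

/-- The extension by the shift embeds in the HNN extension. -/
theorem exists_hom_hnn (hL : ∀ n ∈ L, (n : ℕ) ≤ N) :
    ∃ (F : M.Ext →* M.HNN N) (F' : M.HNN N →* M.Ext), F'.comp F = MonoidHom.id _ ∧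
      F M.base = of (M.windowTuple 0 N 0) ∧ F M.stable = t ∧
      (∀ x : M.vertexGroup N, F' (of x) = inl x.1) ∧ F' t = M.stable := by
  obtain ⟨F, hF1, hF2⟩ := M.exists_ext_hom _ _ (M.isLocalTuple_hnn N hL)
  have hcomm : ∀ a : M.lowerSubgroup N, M.stable * ((inl : A →* M.Ext).comp
      (Subgroup.subtype _)) (a : M.vertexGroup N) =
      ((inl : A →* M.Ext).comp (Subgroup.subtype _)) (M.shiftEquiv N a : M.vertexGroup N) *
        M.stable := by
    intro a
    have h := M.stable_zpow_conj 1 (a : M.vertexGroup N).1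
    rw [zpow_one, zpow_one] at h
    simp only [MonoidHom.comp_apply, Subgroup.subtype_apply]
    rw [M.coe_shiftEquiv, ← h, inv_mul_cancel_right]
  refine ⟨F, HNNExtension.lift _ _ hcomm, M.ext_hom_ext ?_ ?_, hF1, hF2, fun x => ?_, ?_⟩
  · rw [MonoidHom.comp_apply, hF1, lift_of]
    have : (0 : ℤ) ∈ Set.Icc (0 : ℤ) N := by rw [Set.mem_Icc]; omega
    simp [windowTuple, base]
  · rw [MonoidHom.comp_apply, hF2, lift_t]; rfl
  · rw [lift_of]; rfl
  · rw [lift_t]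

/-- The extension by the shift is hyperbolic if the levels of the relations are bounded. -/
theorem exists_fourPoint (hp : p.Prime) (hL : ∀ n ∈ L, (n : ℕ) ≤ N) {n : ℕ+} (hn : n ∈ L)
    (hnN : N ≤ n) :
    ∃ δ : ℕ, ∀ x y z w : M.Ext,
      wordLength {M.base, M.stable} (x⁻¹ * y) + wordLength {M.base, M.stable} (z⁻¹ * w) ≤
        max (wordLength {M.base, M.stable} (x⁻¹ * z) + wordLength {M.base, M.stable} (y⁻¹ * w))
          (wordLength {M.base, M.stable} (x⁻¹ * w) + wordLength {M.base, M.stable} (y⁻¹ * z)) +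
          δ := by
  have hfin : Finite (M.vertexGroup N) :=
    M.finite_window hp hn (by rw [sub_zero]; exact_mod_cast hnN)
  obtain ⟨F, F', hFF', hF1, hF2, hF3, -⟩ := M.exists_hom_hnn N hL
  obtain ⟨d⟩ := NormalWord.TransversalPair.nonempty (M.vertexGroup N) (M.lowerSubgroup N)
    (M.upperSubgroup N)
  obtain ⟨D, hD⟩ := (Set.finite_range fun x : M.vertexGroup N =>
    wordLength {M.base, M.stable} (inl x.1 : M.Ext)).bddAbove
  let e : NormalWord d := NormalWord.empty
  refine ⟨4 * D, fourPoint_of_listStep M.closure_base_stable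
    -- The normal form of `g⁻¹` is used, since right multiplication of `g` by a generator then
    -- becomes left multiplication of a normal word.
    (fun g => (F g⁻¹ • e).toList) D ?_ ?_ (by simp [e])⟩
  · rintro g s (rfl | rfl)
    · rw [mul_inv_rev, map_mul, map_inv F M.base, hF1, mul_smul, ← map_inv of, NormalWord.of_smul_eq_smul,
        NormalWord.group_smul_toList]
      exact Or.inl rfl
    · rw [mul_inv_rev, map_mul, map_inv F M.stable, hF2, mul_smul]
      have := NormalWord.t_pow_smul_eq_unitsSMul (M.shiftEquiv N) (-1) (F g⁻¹ • e)
      rw [Units.val_neg, Units.val_one, zpow_neg_one] at this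
      rw [this]
      exact listStep_unitsSMul _ _ _
  · intro g h hgh
    have key : ∀ g, F g⁻¹ = of (F g⁻¹ • e).head *
        (((F g⁻¹ • e).toList.map fun x => t ^ (x.1 : ℤ) * of x.2)).prod := by
      intro g
      have := NormalWord.prod_smul (M.shiftEquiv N) (F g⁻¹) e
      rw [NormalWord.prod_empty, mul_one] at this
      exact this.symm
    -- Equal lists mean that the two normal words differ only in their heads, so `g⁻¹ * h` comes
    -- from the finite vertex group, whose elements have length at most `D`.
    have h1 : F (g⁻¹ * h) = of ((F g⁻¹ • e).head * (F h⁻¹ • e).head⁻¹) := by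
      have k1 := key g
      rw [hgh] at k1
      calc F (g⁻¹ * h) = F g⁻¹ * (F h⁻¹)⁻¹ := by rw [map_mul, map_inv F h, inv_inv]
        _ = _ := congrArg₂ (fun x y => x * y⁻¹) k1 (key h)
        _ = _ := by rw [map_mul, map_inv of, mul_inv_rev, mul_assoc, mul_inv_cancel_left]
    have h3 : g⁻¹ * h = F' (F (g⁻¹ * h)) := by
      rw [← MonoidHom.comp_apply, hFF', MonoidHom.id_apply]
    rw [h3, h1, hF3]
    exact hD ⟨_, rfl⟩

end LocalModel

/-! ### Alternating words survive in finite `p`-groups -/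

section Unitriangular

/-- The entries of `B` vanish below the `m`-th diagonal. -/
def Matrix.IsUpper {r : ℕ} {R : Type*} [Ring R] (m : ℕ) (B : Matrix (Fin r) (Fin r) R) : Prop :=
  ∀ i j : Fin r, (j : ℕ) < i + m → B i j = 0

namespace Matrix.IsUpper

variable {r : ℕ} {R : Type*} [Ring R] {m n : ℕ} {B C : Matrix (Fin r) (Fin r) R}

theorem add (hB : B.IsUpper m) (hC : C.IsUpper m) : (B + C).IsUpper m := fun i j h => by
  rw [Matrix.add_apply, hB i j h, hC i j h, add_zero]

theorem mul (hB : B.IsUpper m) (hC : C.IsUpper n) : (B * C).IsUpper (m + n) := fun i j h => by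
  rw [Matrix.mul_apply]
  refine Finset.sum_eq_zero fun k _ => ?_
  by_cases hk : (k : ℕ) < i + m
  · rw [hB i k hk, zero_mul]
  · rw [hC k j (by omega), mul_zero]

theorem mono (hB : B.IsUpper n) (h : m ≤ n) : B.IsUpper m := fun i j hij => hB i j (by omega)

theorem pow (hB : B.IsUpper 1) (k : ℕ) : (B ^ k).IsUpper k := by
  induction k with
  | zero =>
    intro i j h
    rw [pow_zero, Matrix.one_apply_ne]
    rintro rfl; omega
  | succ k ih => rw [pow_succ]; exact ih.mul hB

theorem eq_zero (hB : B.IsUpper r) : B = 0 := by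
  ext i j
  exact hB i j (by omega)

end Matrix.IsUpper

variable (p r : ℕ) [Fact p.Prime]

theorem Matrix.pow_eq_one_of_isUpper {B : Matrix (Fin r) (Fin r) (ZMod p)}
    (h : (B - 1).IsUpper 1) : B ^ p ^ r = 1 := by
  have h1 : B = (B - 1) + 1 := by rw [sub_add_cancel]
  -- For `r = 0` the matrix ring is trivial and does not have characteristic `p`.
  cases r with
  | zero => exact Subsingleton.elim _ _
  | succ r =>
    have : (B - 1) ^ p ^ (r + 1) = 0 :=
      ((h.pow _).mono (Nat.lt_pow_self (Fact.out : p.Prime).one_lt).le).eq_zero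
    rw [h1, add_pow_char_pow_of_commute p _ (Commute.one_right _), this, one_pow, zero_add]

/-- The unitriangular matrices over `ℤ/p`. -/
def unitriangular : Subgroup (Matrix (Fin r) (Fin r) (ZMod p))ˣ :=
  let T : Submonoid (Matrix (Fin r) (Fin r) (ZMod p))ˣ :=
    { carrier := {u | ((u : Matrix (Fin r) (Fin r) (ZMod p)) - 1).IsUpper 1}
      one_mem' := by
        intro i j _
        simp
      mul_mem' := fun {u v} hu hv => by
        have : ((u * v : (Matrix (Fin r) (Fin r) (ZMod p))ˣ) : Matrix _ _ (ZMod p)) - 1 =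
          ((u : Matrix (Fin r) (Fin r) (ZMod p)) - 1) * ((v : Matrix _ _ (ZMod p)) - 1) +
            (((u : Matrix _ _ (ZMod p)) - 1) + ((v : Matrix _ _ (ZMod p)) - 1)) := by
            rw [Units.val_mul]; noncomm_ring
        rw [Set.mem_ofPred_eq, this]
        exact ((Matrix.IsUpper.mul hu hv).mono (by omega)).add (Matrix.IsUpper.add hu hv) }
  { T with
    -- Inverses are powers, so the submonoid is already a subgroup.
    inv_mem' := fun {u} hu => by
      have h1 : u ^ p ^ r = 1 := Units.ext (by
        rw [Units.val_pow_eq_pow_val]; exact Matrix.pow_eq_one_of_isUpper p r hu)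
      have h2 : u⁻¹ = u ^ (p ^ r - 1) := by
        rw [inv_eq_iff_mul_eq_one, ← pow_succ',
          Nat.sub_add_cancel (Nat.pos_of_ne_zero (pow_ne_zero _ (Fact.out : p.Prime).ne_zero)), h1]
      rw [h2]
      exact T.pow_mem hu _ }

theorem mem_unitriangular {u : (Matrix (Fin r) (Fin r) (ZMod p))ˣ} :
    u ∈ unitriangular p r ↔ ((u : Matrix (Fin r) (Fin r) (ZMod p)) - 1).IsUpper 1 := Iff.rfl

theorem isPGroup_unitriangular : IsPGroup p (unitriangular p r) := fun u =>
  ⟨r, Subtype.ext (Units.ext (by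
    have := Matrix.pow_eq_one_of_isUpper p r ((mem_unitriangular p r).1 u.2)
    simpa using this))⟩

variable {X : Type*} (l : List (ℤˣ × X))

open Classical in
/-- The matrix with an entry `1` at the places `(i, i + 1)` such that the `i`-th letter is `x`. -/
noncomputable def letterMatrix (x : X) :
    Matrix (Fin (l.length + 1)) (Fin (l.length + 1)) (ZMod p) :=
  Matrix.of fun i j => if (j : ℕ) = i + 1 ∧ (l[(i : ℕ)]?).map Prod.snd = some x then 1 else 0

variable {l}

theorem letterMatrix_isUpper (x : X) : (letterMatrix p l x).IsUpper 1 := fun i j h => by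
  rw [letterMatrix, Matrix.of_apply, if_neg (by omega)]

/-- A nonzero entry of the square would need the letter `x` at two consecutive places. Hence `1 +
letterMatrix p l x` is invertible with inverse `1 - letterMatrix p l x`. -/
theorem letterMatrix_mul_self (hl : l.IsChain fun a b => a.2 ≠ b.2) (x : X) :
    letterMatrix p l x * letterMatrix p l x = 0 := by
  ext i k
  rw [Matrix.mul_apply, Matrix.zero_apply]
  refine Finset.sum_eq_zero fun j _ => ?_
  simp only [letterMatrix, Matrix.of_apply]
  split_ifs with h1 h2
  · exfalso
    obtain ⟨h1, h3⟩ := h1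
    obtain ⟨h2, h4⟩ := h2
    rw [Option.map_eq_some_iff] at h3 h4
    obtain ⟨a, ha, ha'⟩ := h3
    obtain ⟨b, hb, hb'⟩ := h4
    rw [h1] at hb
    obtain ⟨hi, rfl⟩ := List.getElem?_eq_some_iff.1 ha
    obtain ⟨hj, rfl⟩ := List.getElem?_eq_some_iff.1 hb
    exact List.isChain_iff_getElem.1 hl i hj (ha'.trans hb'.symm)
  all_goals simp

/-- The unipotent matrix of a letter. -/
noncomputable def letterUnit (hl : l.IsChain fun a b => a.2 ≠ b.2) (x : X) :
    (Matrix (Fin (l.length + 1)) (Fin (l.length + 1)) (ZMod p))ˣ where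
  val := 1 + letterMatrix p l x
  inv := 1 - letterMatrix p l x
  val_inv := by
    have := letterMatrix_mul_self p hl x
    noncomm_ring
    rw [this]; simp
  inv_val := by
    have := letterMatrix_mul_self p hl x
    noncomm_ring
    rw [this]; simp

theorem letterUnit_zpow (hl : l.IsChain fun a b => a.2 ≠ b.2) (x : X) (u : ℤˣ) :
    ((letterUnit p hl x ^ (u : ℤ) : (Matrix _ _ (ZMod p))ˣ) : Matrix _ _ (ZMod p)) =
      1 + (u : ℤ) • letterMatrix p l x := by
  rcases Int.units_eq_one_or u with rfl | rfl
  · simp [letterUnit]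
  · simp only [Units.val_neg, Units.val_one, zpow_neg, zpow_one, neg_smul, one_smul,
      ← sub_eq_add_neg]
    rfl

/-- Each further letter moves the last nonzero entry of the top row one place to the right and
multiplies it by `±1`. -/
theorem prod_letterUnit (hl : l.IsChain fun a b => a.2 ≠ b.2) (k : ℕ) (hk : k ≤ l.length) :
    let B := (((l.take k).map fun a => letterUnit p hl a.2 ^ (a.1 : ℤ)).prod :
      (Matrix (Fin (l.length + 1)) (Fin (l.length + 1)) (ZMod p))ˣ).val
    IsUnit (B 0 ⟨k, Nat.lt_succ_of_le hk⟩) ∧ ∀ j : Fin (l.length + 1), k < j → B 0 j = 0 := by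
  induction k with
  | zero =>
    refine ⟨by simp, fun j hj => ?_⟩
    simp only [List.take_zero, List.map_nil, List.prod_nil, Units.val_one]
    exact Matrix.one_apply_ne (by rintro rfl; simp at hj)
  | succ k ih =>
    have hk' : k < l.length := hk
    obtain ⟨ih1, ih2⟩ := ih hk'.le
    rw [List.take_add_one, List.getElem?_eq_getElem hk', Option.toList_some, List.map_append,
      List.prod_append, List.map_singleton, List.prod_singleton]
    set B := (((l.take k).map fun a => letterUnit p hl a.2 ^ (a.1 : ℤ)).prod :
      (Matrix (Fin (l.length + 1)) (Fin (l.length + 1)) (ZMod p))ˣ)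
    set a := l[k] with ha
    simp only [Units.val_mul, letterUnit_zpow, mul_add, mul_one, mul_smul_comm, Matrix.add_apply,
      Matrix.smul_apply]
    have hent : ∀ i j : Fin (l.length + 1), (j : ℕ) = i + 1 →
        (B.val * letterMatrix p l a.2) 0 j = B.val 0 i * letterMatrix p l a.2 i j := by
      intro i j hij
      rw [Matrix.mul_apply]
      refine Finset.sum_eq_single i (fun b _ hb => ?_) (by simp)
      rw [letterMatrix, Matrix.of_apply, if_neg, mul_zero]
      rintro ⟨h, -⟩
      exact hb (Fin.ext (by omega))
    constructor
    · rw [ih2 _ (Nat.lt_succ_self k), zero_add, hent ⟨k, by omega⟩ _ rfl]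
      have : letterMatrix p l a.2 ⟨k, by omega⟩ ⟨k + 1, by omega⟩ = 1 := by
        rw [letterMatrix, Matrix.of_apply, if_pos]
        exact ⟨rfl, by rw [List.getElem?_eq_getElem hk']; rfl⟩
      rw [this, mul_one, zsmul_eq_mul]
      exact ((a.1.isUnit).map (Int.castRingHom (ZMod p))).mul ih1
    · intro j hj
      rw [ih2 j (by omega), zero_add, hent ⟨j - 1, by omega⟩ j (by simp; omega),
        ih2 ⟨j - 1, by omega⟩ (by change k < (j : ℕ) - 1; omega), zero_mul, smul_zero]

/-- The unitriangular matrices tailored to the word `l` serve: the product has a unit in its top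
right corner, where the identity matrix has `0` since `l` is nonempty. -/
theorem exists_isPGroup_prod_ne_one (hne : l ≠ []) (hl : l.IsChain fun a b => a.2 ≠ b.2) :
    ∃ (Q : Type) (_ : Group Q) (_ : Finite Q) (q : X → Q), IsPGroup p Q ∧
      (l.map fun a => q a.2 ^ (a.1 : ℤ)).prod ≠ 1 := by
  have hmem : ∀ x, letterUnit p hl x ∈ unitriangular p (l.length + 1) := fun x => by
    rw [mem_unitriangular]
    have : ((letterUnit p hl x : (Matrix _ _ (ZMod p))ˣ) : Matrix _ _ (ZMod p)) - 1 =
      letterMatrix p l x := add_sub_cancel_left _ _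
    rw [this]
    exact letterMatrix_isUpper p x
  refine ⟨unitriangular p (l.length + 1), inferInstance, inferInstance,
    fun x => ⟨letterUnit p hl x, hmem x⟩, isPGroup_unitriangular p _, fun h => ?_⟩
  have h1 := congrArg (unitriangular p (l.length + 1)).subtype h
  rw [map_list_prod, List.map_map, map_one] at h1
  have h2 := (prod_letterUnit p hl l.length le_rfl).1
  rw [List.take_length] at h2
  have h3 : (l.map fun a => letterUnit p hl a.2 ^ (a.1 : ℤ)).prod = 1 := h1
  rw [h3, Units.val_one, Matrix.one_apply_ne] at h2
  · exact not_isUnit_zero h2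
  · intro h0
    have := congrArg Fin.val h0
    simp at this
    exact hne (List.length_eq_zero_iff.1 this.symm)

end Unitriangular

/-! ### Residual finiteness when the levels are bounded -/

namespace LocalModel

open SemidirectProduct Multiplicative HNNExtension

variable {p : ℕ} {c : ℕ+ → ℕ+} {L : Set ℕ+} {A : Type} [Group A] (M : LocalModel p c L A) (N : ℕ)

section Letters

/-- The regular wreath product of `Q` and `E`. -/
abbrev ArrowWreath (Q E : Type*) [Group Q] [Group E] : Type _ := (E → Q) ⋊[mulAutArrow] E

theorem arrowWreath_mul_left {Q E : Type*} [Group Q] [Group E] (a b : ArrowWreath Q E) (y : E) :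
    (a * b).left y = a.left y * b.left (a.right⁻¹ * y) := rfl

theorem arrowWreath_inv_left {Q E : Type*} [Group Q] [Group E] (a : ArrowWreath Q E) (y : E) :
    a⁻¹.left y = (a.left (a.right * y))⁻¹ := by
  change (a.left ((a.right⁻¹)⁻¹ * y))⁻¹ = _
  rw [inv_inv]

variable {E P : Type*} [Group E] [Group P] (π : P →* E) (τ : E) (B : Subgroup E)

/-- The cosets that are read along a word of an HNN extension. -/
def letters : E → List (ℤˣ × P) → List (ℤˣ × (E ⧸ B))
  | _, [] => []
  | e, (u, x) :: l => (u, ((if u = 1 then e else e * τ⁻¹ : E) : E ⧸ B)) ::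
      letters (e * τ ^ (u : ℤ) * π x) l

/-- Two equal neighbouring cosets put one of `τ π(x)`, `π(x) τ⁻¹`, `τ π(x) τ⁻¹`, `π(x)` into `B`.
The first two are excluded by hypothesis; each of the others makes `x` the middle of a pinch, which
a reduced word of the HNN extension does not contain. -/
theorem isChain_letters {A₁ B₁ : Subgroup P} (hτ : ∀ x, τ * π x ∉ B) (hτ' : ∀ x, π x * τ⁻¹ ∉ B)
    (hA : ∀ x, τ * π x * τ⁻¹ ∈ B → x ∈ A₁) (hB : ∀ x, π x ∈ B → x ∈ B₁) (e : E)
    (l : List (ℤˣ × P)) (hl : l.IsChain fun a b => a.2 ∈ toSubgroup A₁ B₁ a.1 → a.1 = b.1) :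
    (letters π τ B e l).IsChain fun a b => a.2 ≠ b.2 := by
  induction l generalizing e with
  | nil => exact List.isChain_nil
  | cons a l ih =>
    obtain ⟨u, x⟩ := a
    rw [List.isChain_cons] at hl
    rw [letters, List.isChain_cons]
    refine ⟨?_, ih _ hl.2⟩
    cases l with
    | nil => simp [letters]
    | cons b l =>
      obtain ⟨u', x'⟩ := b
      have h := hl.1 (u', x') rfl
      simp only [letters, List.head?_cons, Option.mem_def, Option.some.injEq, forall_eq',
        ne_eq, QuotientGroup.eq]
      rcases Int.units_eq_one_or u with rfl | rfl <;> rcases Int.units_eq_one_or u' with rfl | rfl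
      · simpa [mul_assoc] using hτ x
      · simp only [toSubgroup_one] at h
        intro hmem
        have := h (hA x (by simpa [mul_assoc] using hmem))
        simp at this
      · simp only [toSubgroup_neg_one] at h
        intro hmem
        have := h (hB x (by simpa [mul_assoc] using hmem))
        simp at this
      · simpa [mul_assoc] using hτ' x

end Letters

/-- The extension by the shift is residually (finite `p`-group) if the levels are bounded. -/
theorem exists_finite_quotient_of_ne_one (hp : p.Prime) (hL : ∀ n ∈ L, (n : ℕ) ≤ N) {n : ℕ+}
    (hn : n ∈ L) (hnN : N ≤ n) {g : M.Ext} (hg : g ≠ 1) :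
    ∃ (T : Type) (_ : Group T) (_ : Finite T) (F : M.Ext →* T), IsPGroup p T ∧ F g ≠ 1 := by
  have : Fact p.Prime := ⟨hp⟩
  obtain ⟨E, _, _, π, χ, hE, hπ, hχ, hχ'⟩ := M.exists_finite_quotient hp (u := 0) (v := N) hn
    (by rw [sub_zero]; exact_mod_cast hnN) 0
  -- If `π` kills `g`, then `g` is not in the vertex group, on which `π` is injective. Its normal
  -- form then contains stable letters, and these are detected by a wreath product over `E`.
  by_cases hπg : π g = 1
  swap
  · exact ⟨E, _, inferInstance, π, hE, hπg⟩
  obtain ⟨F, F', hFF', hF1, hF2, hF3, hF4⟩ := M.exists_hom_hnn N hL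
  let ρ : M.vertexGroup N →* E := (π.comp inl).comp (Subgroup.subtype _)
  let τ : E := π M.stable
  have hρ : ∀ x y, ρ x = ρ y → x = y := by
    intro x y h
    have h1 : π (inl (x⁻¹ * y).1) = 1 := by
      change ρ (x⁻¹ * y) = 1
      rw [map_mul, map_inv, h, inv_mul_cancel]
    have h2 := hπ _ (x⁻¹ * y).2 h1
    exact (inv_mul_eq_one.1 (Subtype.ext h2 : x⁻¹ * y = 1))
  have hconj : ∀ a : A, τ * π (inl a) * τ⁻¹ = π (inl (M.shift a)) := by
    intro a
    have h := M.stable_zpow_conj 1 a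
    rw [zpow_one, zpow_one] at h
    rw [← h, map_mul, map_mul, map_inv]
  let B : Subgroup E := (M.upperSubgroup N).map ρ
  have hχB : ∀ b ∈ B, χ b = 1 := by
    rintro _ ⟨x, -, rfl⟩
    exact hχ _
  have hχρ : ∀ x, χ (ρ x) = 1 := fun x => hχ _
  have hχτ : χ τ ≠ 1 := by
    have : Fact (1 < p ^ (0 + 1)) := ⟨by simpa using hp.one_lt⟩
    rw [hχ', Ne, ofAdd_eq_one]
    exact one_ne_zero
  obtain ⟨d⟩ := NormalWord.TransversalPair.nonempty (M.vertexGroup N) (M.lowerSubgroup N)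
    (M.upperSubgroup N)
  let w : NormalWord d := F g • NormalWord.empty
  have hw : F g = of w.head * ((w.toList.map fun x => t ^ (x.1 : ℤ) * of x.2)).prod := by
    have := NormalWord.prod_smul (M.shiftEquiv N) (F g) (NormalWord.empty (d := d))
    rw [NormalWord.prod_empty, mul_one] at this
    exact this.symm
  have hgF : g = F' (F g) := by rw [← MonoidHom.comp_apply, hFF', MonoidHom.id_apply]
  have hwne : w.toList ≠ [] := by
    intro h
    rw [h, List.map_nil, List.prod_nil, mul_one] at hw
    rw [hw, hF3] at hgF
    rw [hgF] at hπg
    rw [hπ _ w.head.2 hπg, map_one] at hgF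
    exact hg hgF
  have hchain := isChain_letters ρ τ B (A₁ := M.lowerSubgroup N) (B₁ := M.upperSubgroup N)
    (fun x h => hχτ (by simpa [hχρ] using hχB _ h))
    (fun x h => hχτ (by simpa [hχρ] using hχB _ h))
    (by
      rintro x ⟨b, hb, hbx⟩
      have h1 : (M.shiftEquiv N ((M.shiftEquiv N).symm ⟨b, hb⟩) : M.vertexGroup N) = b := by
        rw [MulEquiv.apply_symm_apply]
      set a := (M.shiftEquiv N).symm ⟨b, hb⟩
      have h2 : τ * ρ a * τ⁻¹ = ρ b := by
        change τ * π (inl (a : M.vertexGroup N).1) * τ⁻¹ = π (inl b.1)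
        rw [hconj, ← M.coe_shiftEquiv, h1]
      rw [← h2] at hbx
      have h3 := hρ _ _ (mul_left_cancel (mul_right_cancel hbx))
      rw [← h3]
      exact a.2)
    (by
      rintro x ⟨b, hb, hbx⟩
      rw [← hρ _ _ hbx]; exact hb) (ρ w.head) w.toList w.chain
  have hlne : letters ρ τ B (ρ w.head) w.toList ≠ [] := by
    obtain ⟨⟨u, x⟩, l, h⟩ := List.exists_cons_of_ne_nil hwne
    rw [h, letters]
    exact List.cons_ne_nil _ _
  obtain ⟨Q, _, _, q, hQ, hq⟩ := exists_isPGroup_prod_ne_one p hlne hchain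
  -- The stable letter is sent to `s`, a lift of `τ` whose function depends only on the coset of
  -- `y⁻¹` modulo `B`. This invariance under the upper associated subgroup is what `hrel` needs.
  let s : ArrowWreath Q E := ⟨fun y => q ((y⁻¹ : E) : E ⧸ B), τ⟩
  have hrel : ∀ a : M.lowerSubgroup N, s * ((inr : E →* ArrowWreath Q E).comp ρ) (a : M.vertexGroup N) =
      ((inr : E →* ArrowWreath Q E).comp ρ) (M.shiftEquiv N a : M.vertexGroup N) * s := by
    intro a
    ext y
    · rw [arrowWreath_mul_left, arrowWreath_mul_left]
      simp only [MonoidHom.comp_apply, left_inr, right_inr, Pi.one_apply, mul_one, one_mul, s]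
      congr 1
      rw [QuotientGroup.eq, mul_inv_rev, inv_inv, inv_inv, mul_inv_cancel_left]
      exact ⟨_, (M.shiftEquiv N a).2, rfl⟩
    · simp only [mul_right, MonoidHom.comp_apply, right_inr, s]
      change τ * π (inl (a : M.vertexGroup N).1) = π (inl _) * τ
      rw [Subgroup.subtype_apply, M.coe_shiftEquiv, ← hconj, inv_mul_cancel_right]
  let Λ : M.HNN N →* ArrowWreath Q E := HNNExtension.lift _ _ hrel
  have hΛt : Λ t = s := lift_t _ _ _
  have hΛof : ∀ x, Λ (of x) = inr (ρ x) := fun x => lift_of _ _ _ x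
  have hΛu : ∀ (u : ℤˣ) (e : E), (Λ (t ^ (u : ℤ))).left e⁻¹ =
      q ((if u = 1 then e else e * τ⁻¹ : E) : E ⧸ B) ^ (u : ℤ) := by
    intro u e
    rcases Int.units_eq_one_or u with rfl | rfl
    · simp only [Units.val_one, zpow_one, hΛt, if_pos, s, inv_inv]
    · simp only [Units.val_neg, Units.val_one, zpow_neg, zpow_one, map_inv, hΛt]
      rw [arrowWreath_inv_left, if_neg (by decide)]
      simp only [s, mul_inv_rev, inv_inv]
  have hΛr : ∀ (u : ℤˣ), (Λ (t ^ (u : ℤ))).right = τ ^ (u : ℤ) := by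
    intro u
    rw [map_zpow, hΛt]
    exact map_zpow (rightHom : ArrowWreath Q E →* E) s _
  -- Along a normal form, the coordinate at `e⁻¹` multiplies the values `q ^ (±1)` of the cosets in
  -- `letters`. These form an alternating word, which `q` was chosen not to kill.
  have heval : ∀ (l : List (ℤˣ × M.vertexGroup N)) (e : E),
      (Λ ((l.map fun x => t ^ (x.1 : ℤ) * of x.2)).prod).left e⁻¹ =
        ((letters ρ τ B e l).map fun a => q a.2 ^ (a.1 : ℤ)).prod := by
    intro l
    induction l with
    | nil => intro e; simp [letters]
    | cons a l ih =>
      intro e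
      obtain ⟨u, x⟩ := a
      rw [List.map_cons, List.prod_cons, map_mul, map_mul, hΛof, arrowWreath_mul_left,
        arrowWreath_mul_left, mul_right, left_inr, right_inr, Pi.one_apply, mul_one, hΛu, hΛr,
        letters, List.map_cons, List.prod_cons, ← ih, mul_assoc e, mul_inv_rev e]
  refine ⟨ArrowWreath Q E, inferInstance, Finite.of_equiv _ equivProd.symm, Λ.comp F,
    isPGroup_semidirectProduct (isPGroup_pi hQ) hE, fun h => hq ?_⟩
  have h1 : (Λ (F g)).left 1 = 1 := by
    rw [MonoidHom.comp_apply] at h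
    rw [h]; rfl
  rw [hw, map_mul, hΛof, arrowWreath_mul_left, left_inr, right_inr, Pi.one_apply, one_mul, mul_one,
    heval] at h1
  exact h1

end LocalModel

/-! ### Balls in word metrics -/

section Balls

variable {G Γ : Type*} [Group G] [Group Γ]

theorem finite_ball {S : Set G} (hS : Subgroup.closure S = ⊤) (hfin : S.Finite) (R : ℕ) :
    {g : G | wordLength S g ≤ R}.Finite := by
  have : Finite {x : G | x ∈ S ∨ x⁻¹ ∈ S} := by
    have : {x : G | x ∈ S ∨ x⁻¹ ∈ S} = S ∪ S⁻¹ := rfl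
    rw [this]
    exact (hfin.union hfin.inv).to_subtype
  refine ((List.finite_length_le {x : G | x ∈ S ∨ x⁻¹ ∈ S} R).image
    fun l => (l.map Subtype.val).prod).subset ?_
  intro g hg
  obtain ⟨l, hl, hlS, hlp⟩ := isWordOfLength_wordLength hS g
  refine ⟨l.attach.map fun x => ⟨x.1, hlS x.1 x.2⟩, ?_, ?_⟩
  · rw [Set.mem_ofPred_eq, List.length_map, List.length_attach, hl]
    exact hg
  · simp only [List.map_map]
    rw [← hlp]
    congr 1
    exact List.attach_map_subtype_val l

theorem wordLength_map_le (Φ : Γ →* G) {S : Set Γ} {S' : Set G} (hS : Subgroup.closure S = ⊤)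
    (himg : Φ '' S = S') (g : Γ) : wordLength S' (Φ g) ≤ wordLength S g := by
  obtain ⟨l, hl, hlS, rfl⟩ := isWordOfLength_wordLength hS g
  refine wordLength_le ⟨l.map Φ, by rw [List.length_map, hl], ?_, by rw [map_list_prod]⟩
  intro x hx
  obtain ⟨y, hy, rfl⟩ := List.mem_map.1 hx
  rw [← himg, ← map_inv]
  exact (hlS y hy).imp (fun h => ⟨y, h, rfl⟩) fun h => ⟨_, h, rfl⟩

theorem exists_lift_wordLength (Φ : Γ →* G) {S : Set Γ} {S' : Set G}
    (hS : Subgroup.closure S = ⊤) (hS' : Subgroup.closure S' = ⊤) (himg : Φ '' S = S') (x : G) :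
    ∃ g, Φ g = x ∧ wordLength S g = wordLength S' x := by
  obtain ⟨l, hl, hlS, hlp⟩ := isWordOfLength_wordLength hS' x
  have : ∀ l : List G, (∀ y ∈ l, y ∈ S' ∨ y⁻¹ ∈ S') → ∃ l' : List Γ, l'.map Φ = l ∧
      ∀ y ∈ l', y ∈ S ∨ y⁻¹ ∈ S := by
    intro l
    induction l with
    | nil => exact fun _ => ⟨[], rfl, by simp⟩
    | cons y l ih =>
      intro h
      obtain ⟨l', rfl, hl'⟩ := ih fun z hz => h z (List.mem_cons_of_mem _ hz)
      have hy : ∃ z, Φ z = y ∧ (z ∈ S ∨ z⁻¹ ∈ S) := by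
        rcases h y List.mem_cons_self with hy | hy <;> rw [← himg] at hy <;>
          obtain ⟨z, hz, hzy⟩ := hy
        · exact ⟨z, hzy, Or.inl hz⟩
        · exact ⟨z⁻¹, by rw [map_inv, hzy, inv_inv], Or.inr (by rwa [inv_inv])⟩
      obtain ⟨z, rfl, hz⟩ := hy
      refine ⟨z :: l', rfl, fun w hw => ?_⟩
      rcases List.mem_cons.1 hw with rfl | hw
      exacts [hz, hl' w hw]
  obtain ⟨l', rfl, hl'⟩ := this l hlS
  rw [← map_list_prod] at hlp
  refine ⟨l'.prod, hlp, le_antisymm ?_ ?_⟩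
  · rw [← hl, List.length_map]
    exact wordLength_le ⟨l', rfl, hl', rfl⟩
  · rw [← hlp]
    exact wordLength_map_le Φ hS himg _

/-- The four-point condition with constant `δ` for the points `x, y, z, w` and the word metric
of `S`. -/
def FourPoint (S : Set G) (δ : ℕ) (x y z w : G) : Prop :=
  wordLength S (x⁻¹ * y) + wordLength S (z⁻¹ * w) ≤
    max (wordLength S (x⁻¹ * z) + wordLength S (y⁻¹ * w))
      (wordLength S (x⁻¹ * w) + wordLength S (y⁻¹ * z)) + δ

/-- A homomorphism that is injective on a large ball transfers the four-point condition. -/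
theorem fourPoint_of_injOn_ball (Φ : Γ →* G) {S : Set Γ} {S' : Set G}
    (hS : Subgroup.closure S = ⊤) (hS' : Subgroup.closure S' = ⊤) (himg : Φ '' S = S') {R δ : ℕ}
    (hinj : ∀ g, wordLength S g ≤ 4 * R → Φ g = 1 → g = 1)
    (hδ : ∀ x y z w, FourPoint S δ x y z w) {x y z w : G} (hx : wordLength S' x ≤ R)
    (hy : wordLength S' y ≤ R) (hz : wordLength S' z ≤ R) (hw : wordLength S' w ≤ R) :
    FourPoint S' δ x y z w := by
  -- For `a`, `b` in the ball of radius `R`, both `a⁻¹ * b` and a shortest lift of its image have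
  -- length at most `2 * R`. Their quotient lies in the ball of radius `4 * R` and in the kernel, so
  -- it is trivial.
  have key : ∀ a b : Γ, wordLength S a ≤ R → wordLength S b ≤ R →
      wordLength S (a⁻¹ * b) = wordLength S' ((Φ a)⁻¹ * Φ b) := by
    intro a b ha hb
    obtain ⟨h, hh, hhl⟩ := exists_lift_wordLength Φ hS hS' himg ((Φ a)⁻¹ * Φ b)
    have h1 : wordLength S (a⁻¹ * b) ≤ 2 * R := by
      have := wordLength_mul_le hS a⁻¹ b
      rw [wordLength_inv hS] at this
      omega
    have h2 : wordLength S h ≤ 2 * R := by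
      rw [hhl, ← map_inv, ← map_mul]
      exact (wordLength_map_le Φ hS himg _).trans h1
    have h3 : a⁻¹ * b * h⁻¹ = 1 := by
      refine hinj _ ?_ ?_
      · have := wordLength_mul_le hS (a⁻¹ * b) h⁻¹
        rw [wordLength_inv hS] at this
        omega
      · rw [map_mul, map_mul, map_inv, map_inv, hh, mul_inv_cancel]
    rw [← hhl, mul_inv_eq_one.1 h3]
  obtain ⟨x, rfl, hx'⟩ := exists_lift_wordLength Φ hS hS' himg x
  obtain ⟨y, rfl, hy'⟩ := exists_lift_wordLength Φ hS hS' himg y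
  obtain ⟨z, rfl, hz'⟩ := exists_lift_wordLength Φ hS hS' himg z
  obtain ⟨w, rfl, hw'⟩ := exists_lift_wordLength Φ hS hS' himg w
  rw [← hx'] at hx
  rw [← hy'] at hy
  rw [← hz'] at hz
  rw [← hw'] at hw
  have := hδ x y z w
  unfold FourPoint at this ⊢
  rwa [key x y hx hy, key z w hz hw, key x z hx hz, key y w hy hw, key x w hx hw,
    key y z hy hz] at this

end Balls

/-! ### The choice of the sequence of nilpotency classes -/

namespace LocalModel

open SemidirectProduct

variable {p : ℕ}

/-- The generating set `{a 0, t}`. -/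
abbrev gens {c : ℕ+ → ℕ+} {L : Set ℕ+} {A : Type} [Group A] (M : LocalModel p c L A) :
    Set M.Ext := {M.base, M.stable}

theorem finite_gens {c : ℕ+ → ℕ+} {L : Set ℕ+} {A : Type} [Group A] (M : LocalModel p c L A) :
    M.gens.Finite := Set.toFinite _

/-- The element `g` survives in a finite `p`-group `T`. If `T` has class at most `K`, the commutator
relations of length beyond `K` hold in `T` automatically. The map to `T` therefore factors through
`Φ` for every such `c'`. -/
theorem exists_survives (hp : p.Prime) (c : ℕ+ → ℕ+) (N : ℕ+) {A : Type} [Group A]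
    (M : LocalModel p c (Set.Iic N) A) {g : M.Ext} (hg : g ≠ 1) :
    ∃ K : ℕ, ∀ c' : ℕ+ → ℕ+, (∀ k ≤ N, c' k = c k) → (∀ k, N < k → K ≤ c' k) →
      ∀ Φ : M.Ext →* (groupA p c').Ext, Φ M.base = (groupA p c').base →
        Φ M.stable = (groupA p c').stable → Φ g ≠ 1 := by
  have : Fact p.Prime := ⟨hp⟩
  obtain ⟨T, _, _, F, hT, hF⟩ := M.exists_finite_quotient_of_ne_one N hp
    (fun n hn => hn) (Set.mem_Iic.2 le_rfl) le_rfl hg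
  have hnil := hT.isNilpotent
  obtain ⟨K, hK⟩ := Subgroup.nilpotent_iff_lowerCentralSeries.1 hnil
  refine ⟨K, fun c' hc' hK' Φ hΦ1 hΦ2 h => hF ?_⟩
  have hloc : IsLocalTuple p c' Set.univ fun i : ℤ =>
      F M.stable ^ i * F M.base * (F M.stable ^ i)⁻¹ := by
    simp only [← M.map_inl_gen]
    have h1 := M.isLocalTuple.map (F.comp inl)
    refine ⟨h1.pow_eq_one, fun n _ i hi => ?_⟩
    by_cases hn : n ≤ N
    · rw [hc' n hn] at hi ⊢
      exact h1.comm_eq_one n hn i hi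
    · have h2 := (⊤ : Subgroup T).lowerCentralSeries_antitone (hK' n (not_le.1 hn))
        (leftNormedCommutator_mem_lowerCentralSeries (fun j => F (inl (M.gen (i j)))) (c' n))
      rw [hK] at h2
      exact h2
  obtain ⟨F', hF1, hF2⟩ := (groupA p c').exists_ext_hom _ _ hloc
  have : F'.comp Φ = F := M.ext_hom_ext (by rw [MonoidHom.comp_apply, hΦ1, hF1])
    (by rw [MonoidHom.comp_apply, hΦ2, hF2])
  rw [← this, MonoidHom.comp_apply, h, map_one]

/-- The order of quantifiers drives the construction of `c`: `δ` depends only on the levels up to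
`N`, so `R` may be chosen after it, and only then is the growth bound `K` on the later values fixed.
One `K` suffices because a ball contains finitely many elements. -/
theorem exists_fourPoint_ball (hp : p.Prime) (c : ℕ+ → ℕ+) (N : ℕ+) :
    ∃ δ : ℕ, ∀ R : ℕ, ∃ K : ℕ, ∀ c' : ℕ+ → ℕ+, (∀ k ≤ N, c' k = c k) →
      (∀ k, N < k → K ≤ c' k) → ∀ x y z w : (groupA p c').Ext,
        wordLength (groupA p c').gens x ≤ R → wordLength (groupA p c').gens y ≤ R →
        wordLength (groupA p c').gens z ≤ R → wordLength (groupA p c').gens w ≤ R →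
          FourPoint (groupA p c').gens δ x y z w := by
  let M := presented p c (Set.Iic N)
  obtain ⟨δ, hδ⟩ := M.exists_fourPoint N hp (fun n hn => hn) (Set.mem_Iic.2 le_rfl) le_rfl
  refine ⟨δ, fun R => ?_⟩
  have hfin := finite_ball M.closure_base_stable M.finite_gens (4 * R)
  choose! K hK using fun (g : M.Ext) (hg : g ≠ 1) => exists_survives hp c N M hg
  obtain ⟨K', hK'⟩ := (hfin.image K).bddAbove
  refine ⟨K', fun c' hc' hcK x y z w hx hy hz hw => ?_⟩
  have hloc : IsLocalTuple p c (Set.Iic N) fun i : ℤ =>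
      (groupA p c').stable ^ i * (groupA p c').base * ((groupA p c').stable ^ i)⁻¹ := by
    simp only [← inl_gen]
    have h1 := (groupA p c').isLocalTuple.map (inl : _ →* (groupA p c').Ext)
    refine ⟨h1.pow_eq_one, fun n hn i hi => ?_⟩
    rw [← hc' n hn] at hi ⊢
    exact h1.comm_eq_one n (Set.mem_univ _) i hi
  obtain ⟨Φ, hΦ1, hΦ2⟩ := M.exists_ext_hom _ _ hloc
  refine fourPoint_of_injOn_ball Φ M.closure_base_stable (groupA p c').closure_base_stable
    (by rw [Set.image_pair, hΦ1, hΦ2]) (R := R) (fun g hg h => ?_) hδ hx hy hz hw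
  by_contra hg1
  exact hK g hg1 c' hc' (fun k hk => (hK' ⟨g, hg, rfl⟩).trans (hcK k hk)) Φ hΦ1 hΦ2 h

/-- A sequence of nilpotency classes for which larger and larger balls satisfy the four-point
condition with relatively small constants. -/
theorem exists_lacunary (hp : p.Prime) :
    ∃ c : ℕ+ → ℕ+, Monotone c ∧ ∃ δ : ℕ → ℕ, Monotone δ ∧ ∀ n : ℕ,
      ∀ x y z w : (groupA p c).Ext,
        wordLength (groupA p c).gens x ≤ (n + 1) * ((n + 1) * (δ n + 1)) →
        wordLength (groupA p c).gens y ≤ (n + 1) * ((n + 1) * (δ n + 1)) →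
        wordLength (groupA p c).gens z ≤ (n + 1) * ((n + 1) * (δ n + 1)) →
        wordLength (groupA p c).gens w ≤ (n + 1) * ((n + 1) * (δ n + 1)) →
          FourPoint (groupA p c).gens (δ n) x y z w := by
  choose δ₀ K hK using fun (c : ℕ+ → ℕ+) (N : ℕ+) => exists_fourPoint_ball hp c N
  -- A stage is a pair of a sequence and a constant. Stage `n` freezes the values at `k ≤ n + 1`,
  -- takes the running maximum `D` of the constants, and raises all later values to more than `κ`,
  -- the bound required for the radius `(n + 1) * ((n + 1) * (D + 1))`.
  let D : ℕ → (ℕ+ → ℕ+) × ℕ → ℕ := fun n s => max s.2 (δ₀ s.1 n.succPNat)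
  let κ : ℕ → (ℕ+ → ℕ+) × ℕ → ℕ := fun n s =>
    K s.1 n.succPNat ((n + 1) * ((n + 1) * (D n s + 1)))
  let step : ℕ → (ℕ+ → ℕ+) × ℕ → (ℕ+ → ℕ+) × ℕ := fun n s =>
    (fun k => if k ≤ n.succPNat then s.1 k else max (s.1 k) (κ n s).succPNat, D n s)
  let s : ℕ → (ℕ+ → ℕ+) × ℕ := fun n => Nat.rec (fun _ => 1, 0) step n
  have hs : ∀ n, s (n + 1) = step n (s n) := fun n => rfl
  have hmono : ∀ n, Monotone (s n).1 := by
    intro n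
    induction n with
    | zero => exact monotone_const
    | succ n ih =>
      intro i j hij
      rw [hs]
      simp only [step]
      split_ifs with h1 h2 h2
      · exact ih hij
      · exact (ih hij).trans (le_max_left _ _)
      · exact absurd (hij.trans h2) h1
      · exact max_le_max (ih hij) le_rfl
  have hle : ∀ n k, (s n).1 k ≤ (s (n + 1)).1 k := by
    intro n k
    rw [hs]
    simp only [step]
    split_ifs
    exacts [le_rfl, le_max_left _ _]
  have heq : ∀ n k, k ≤ n.succPNat → (s (n + 1)).1 k = (s n).1 k := by
    intro n k hk
    rw [hs]
    simp only [step, if_pos hk]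
  have heq' : ∀ (m n : ℕ) (k : ℕ+), (k : ℕ) ≤ m + 1 → m ≤ n → (s n).1 k = (s m).1 k := by
    intro m n k hk hmn
    induction n, hmn using Nat.le_induction with
    | base => rfl
    | succ n hn ih =>
      rw [heq n k (by rw [← PNat.coe_le_coe, Nat.succPNat_coe]; omega), ih]
  have hmono' : ∀ k, Monotone fun n => (s n).1 k := fun k => monotone_nat_of_le_succ fun n => hle n k
  -- The value at `k` no longer changes from stage `k - 1` on, so the diagonal is the limit of the
  -- stages.
  let c : ℕ+ → ℕ+ := fun k => (s k).1 k
  have hc : ∀ (n : ℕ) (k : ℕ+), (k : ℕ) ≤ n + 1 → c k = (s n).1 k := by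
    intro n k hk
    rcases le_total (k : ℕ) n with h | h
    · exact (heq' k n k (by omega) h).symm
    · exact heq' n k k hk h
  refine ⟨c, fun i j hij => ?_, fun n => (s (n + 1)).2, monotone_nat_of_le_succ fun n => ?_,
    fun n x y z w hx hy hz hw => ?_⟩
  · have : (i : ℕ) ≤ j := by exact_mod_cast hij
    rw [hc j i (by omega)]
    exact hmono _ hij
  · rw [hs (n + 1)]
    exact le_max_left _ _
  · have h := hK (s n).1 n.succPNat ((n + 1) * ((n + 1) * (D n (s n) + 1))) c
      (fun k hk => hc n k (by rw [← PNat.coe_le_coe, Nat.succPNat_coe] at hk; exact hk))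
      (fun k hk => ?_) x y z w hx hy hz hw
    · exact Nat.le_trans h (Nat.add_le_add_left (le_max_right _ _) _)
    · have h1 : n + 1 ≤ (k : ℕ) := by
        rw [← PNat.coe_lt_coe, Nat.succPNat_coe] at hk; omega
      have h2 : (s (n + 1)).1 k ≤ c k := hmono' k h1
      have h3 : (κ n (s n)).succPNat ≤ (s (n + 1)).1 k := by
        rw [hs]
        simp only [step, if_neg (not_le.2 hk)]
        exact le_max_right _ _
      have h4 : ((κ n (s n)).succPNat : ℕ) ≤ c k := by exact_mod_cast h3.trans h2
      rw [Nat.succPNat_coe] at h4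
      exact (Nat.le_succ _).trans h4

end LocalModel

/-! ### Geodesics and arcs -/

section Arcs

/-- Any two topological arcs with the same endpoints have the same image. -/
def HasUniqueArcs (X : Type*) [TopologicalSpace X] : Prop :=
  ∀ α β : C(unitInterval, X), Function.Injective α → Function.Injective β →
    α 0 = β 0 → α 1 = β 1 → Set.range α = Set.range β

/-- Used twice: for Lipschitz injections between cones of different generating sets, and for
homeomorphisms between cones. -/
theorem HasUniqueArcs.of_injective {X Y : Type*} [TopologicalSpace X] [TopologicalSpace Y]
    (hY : HasUniqueArcs Y) (f : C(X, Y)) (hf : Function.Injective f) : HasUniqueArcs X := by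
  intro α β hα hβ h0 h1
  have h := hY (f.comp α) (f.comp β) (hf.comp hα) (hf.comp hβ) (congrArg f h0) (congrArg f h1)
  rw [ContinuousMap.coe_comp, ContinuousMap.coe_comp, Set.range_comp, Set.range_comp] at h
  exact hf.image_injective h

theorem HasUniqueArcs.image_Icc_eq {X : Type*} [TopologicalSpace X] (hX : HasUniqueArcs X)
    {f g : ℝ → X} {a b : ℝ} (ha : 0 < a) (hb : 0 < b) (hf : ContinuousOn f (Set.Icc 0 a))
    (hg : ContinuousOn g (Set.Icc 0 b)) (hfi : Set.InjOn f (Set.Icc 0 a))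
    (hgi : Set.InjOn g (Set.Icc 0 b)) (h0 : f 0 = g 0) (h1 : f a = g b) :
    f '' Set.Icc 0 a = g '' Set.Icc 0 b := by
  have key : ∀ {f : ℝ → X} {a : ℝ}, 0 < a → ContinuousOn f (Set.Icc 0 a) →
      Set.InjOn f (Set.Icc 0 a) → ∃ α : C(unitInterval, X), Function.Injective α ∧ α 0 = f 0 ∧
        α 1 = f a ∧ Set.range α = f '' Set.Icc 0 a := by
    intro f a ha hf hfi
    have hmem : ∀ u : unitInterval, (u : ℝ) * a ∈ Set.Icc 0 a := fun u =>
      ⟨mul_nonneg u.2.1 ha.le, mul_le_of_le_one_left ha.le u.2.2⟩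
    refine ⟨⟨fun u => f (u * a), hf.comp_continuous (by fun_prop) hmem⟩, fun u v huv => ?_,
      by simp, by simp, ?_⟩
    · exact Subtype.ext (mul_right_cancel₀ ha.ne' (hfi (hmem u) (hmem v) huv))
    · ext x
      constructor
      · rintro ⟨u, rfl⟩
        exact ⟨_, hmem u, rfl⟩
      · rintro ⟨s, hs, rfl⟩
        refine ⟨⟨s / a, div_nonneg hs.1 ha.le, (div_le_one ha).2 hs.2⟩, ?_⟩
        simp [div_mul_cancel₀ _ ha.ne']
  obtain ⟨α, hα, hα0, hα1, hαr⟩ := key ha hf hfi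
  obtain ⟨β, hβ, hβ0, hβ1, hβr⟩ := key hb hg hgi
  rw [← hαr, ← hβr]
  exact hX α β hα hβ (by rw [hα0, hβ0, h0]) (by rw [hα1, hβ1, h1])

variable {X : Type*} [MetricSpace X]

theorem isRealTree_iff : IsRealTree X ↔ IsGeodesicSpace X ∧ HasUniqueArcs X := Iff.rfl

/-- The four-point condition with constant zero. -/
def IsZeroHyperbolic (X : Type*) [MetricSpace X] : Prop :=
  ∀ x y z w : X, dist x y + dist z w ≤ max (dist x z + dist y w) (dist x w + dist y z)

/-- In a zero-hyperbolic space, a connected set that contains two points contains all the points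
between them. -/
theorem IsZeroHyperbolic.exists_mem_eq {T : Type*} [TopologicalSpace T] (hX : IsZeroHyperbolic X)
    (α : C(T, X)) {C : Set T} (hC : IsPreconnected C) {s t : T} (hs : s ∈ C) (ht : t ∈ C) {z : X}
    (hz : dist (α s) z + dist z (α t) = dist (α s) (α t)) : ∃ r ∈ C, α r = z := by
  by_contra! hne
  -- The strict inequality says that `z` is not between two points. By the four-point condition this
  -- is transitive off `z`, so `U`, the class of `α s`, and `V`, the union of the other classes,
  -- would disconnect `C`.
  let U : Set T := {u | dist (α u) (α s) < dist (α u) z + dist (α s) z}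
  let V : Set T := ⋃ v ∈ Uᶜ, {u | dist (α u) (α v) < dist (α u) z + dist (α v) z}
  have hU : IsOpen U := isOpen_lt (by fun_prop) (by fun_prop)
  have hV : IsOpen V := isOpen_biUnion fun v _ => isOpen_lt (by fun_prop) (by fun_prop)
  have hself : ∀ u ∈ C, dist (α u) (α u) < dist (α u) z + dist (α u) z := by
    intro u hu
    have := dist_pos.2 (hne u hu)
    rw [dist_self]
    linarith
  have hcov : ∀ u ∈ C, u ∉ U → u ∈ V := fun u hu hu' =>
    Set.mem_biUnion (x := u) hu' (hself u hu)
  obtain ⟨u, -, huU, huV⟩ := hC U V hU hV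
    (fun u hu => or_iff_not_imp_left.2 (hcov u hu)) ⟨s, hs, hself s hs⟩
    ⟨t, ht, hcov t ht fun h => by
      have h' : dist (α t) (α s) < dist (α t) z + dist (α s) z := h
      rw [dist_comm (α t) (α s), dist_comm (α t) z] at h'
      linarith⟩
  simp only [V, Set.mem_iUnion] at huV
  obtain ⟨v, hv, huv⟩ := huV
  refine hv ?_
  have h1 : dist (α u) (α s) < dist (α u) z + dist (α s) z := huU
  have h2 : dist (α u) (α v) < dist (α u) z + dist (α v) z := huv
  show dist (α v) (α s) < dist (α v) z + dist (α s) z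
  have h3 := hX (α v) (α s) (α u) z
  rw [dist_comm (α v) (α u), dist_comm (α s) (α u)] at h3
  rcases le_max_iff.1 h3 with h | h <;> linarith

/-- In a zero-hyperbolic geodesic space, the image of an arc consists of the points between its
endpoints. -/
theorem IsZeroHyperbolic.range_arc (hX : IsZeroHyperbolic X) (hgeo : IsGeodesicSpace X)
    (α : C(unitInterval, X)) (hα : Function.Injective α) :
    Set.range α = {z | dist (α 0) z + dist z (α 1) = dist (α 0) (α 1)} := by
  ext p
  constructor
  · rintro ⟨s, rfl⟩
    obtain ⟨γ, hγ0, hγ1, hγ⟩ := hgeo (α 0) (α 1)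
    set D := dist (α 0) (α 1) with hD
    have t1 := dist_triangle (α 0) (α s) (α 1)
    have t2 := dist_triangle (α s) (α 0) (α 1)
    have t3 := dist_triangle (α 0) (α 1) (α s)
    rw [dist_comm (α s) (α 0)] at t2
    rw [dist_comm (α 1) (α s)] at t3
    rw [← hD] at t1 t2 t3
    have hDnn : 0 ≤ D := dist_nonneg
    -- The Gromov product of `α s` and `α 1` seen from `α 0`. The point `γ g` lies between `α s` and
    -- each endpoint, so the arc passes through it both before and after time `s`; injectivity
    -- forces `α s = γ g`.
    obtain ⟨g, hg⟩ : ∃ g, g = (D + dist (α 0) (α s) - dist (α s) (α 1)) / 2 := ⟨_, rfl⟩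
    have hgm : g ∈ Set.Icc 0 D := ⟨by linarith, by linarith⟩
    have hx : dist (α 0) (γ g) = g := by
      have h := hγ 0 ⟨le_rfl, hDnn⟩ g hgm
      rwa [hγ0, zero_sub, abs_neg, abs_of_nonneg hgm.1] at h
    have hy : dist (γ g) (α 1) = D - g := by
      have h := hγ g hgm D ⟨hDnn, le_rfl⟩
      rwa [hγ1, abs_sub_comm, abs_of_nonneg (sub_nonneg.2 hgm.2)] at h
    have h4 : dist (γ g) (α s) ≤ dist (α 0) (α s) - g := by
      have h := hX (γ g) (α s) (α 0) (α 1)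
      rw [dist_comm (γ g) (α 0), hx, hy, dist_comm (α s) (α 0), ← hD] at h
      rcases le_max_iff.1 h with h | h <;> linarith
    have t4 := dist_triangle (α 0) (γ g) (α s)
    have t5 := dist_triangle (α s) (γ g) (α 1)
    rw [dist_comm (α s) (γ g)] at t5
    obtain ⟨r, hr, hrq⟩ := hX.exists_mem_eq α (isPreconnected_Icc (a := 0) (b := s))
      ⟨le_rfl, s.2.1⟩ ⟨s.2.1, le_rfl⟩ (z := γ g) (by linarith)
    obtain ⟨r', hr', hrq'⟩ := hX.exists_mem_eq α (isPreconnected_Icc (a := s) (b := 1))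
      ⟨le_rfl, s.2.2⟩ ⟨s.2.2, le_rfl⟩ (z := γ g) (by rw [dist_comm (α s)]; linarith)
    have hrr : r = r' := hα (hrq.trans hrq'.symm)
    have hrs : r = s := le_antisymm hr.2 (hrr ▸ hr'.1)
    rw [Set.mem_ofPred_eq, ← hrs, hrq]
    linarith
  · intro hp
    obtain ⟨r, -, hr⟩ := hX.exists_mem_eq α isPreconnected_univ (Set.mem_univ 0) (Set.mem_univ 1) hp
    exact ⟨r, hr⟩

theorem IsZeroHyperbolic.isRealTree (hX : IsZeroHyperbolic X) (hgeo : IsGeodesicSpace X) :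
    IsRealTree X := by
  refine ⟨hgeo, fun α β hα hβ h0 h1 => ?_⟩
  rw [hX.range_arc hgeo α hα, hX.range_arc hgeo β hβ, h0, h1]

/-- `γ` is an isometric embedding of the interval `[0, D]`. -/
def IsGeodesicOn (γ : ℝ → X) (D : ℝ) : Prop :=
  ∀ s ∈ Set.Icc 0 D, ∀ t ∈ Set.Icc 0 D, dist (γ s) (γ t) = |s - t|

namespace IsGeodesicOn

variable {γ η : ℝ → X} {D E : ℝ}

theorem continuousOn (h : IsGeodesicOn γ D) : ContinuousOn γ (Set.Icc 0 D) :=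
  (LipschitzOnWith.of_dist_le_mul (K := 1) fun s hs t ht => by
    rw [h s hs t ht, NNReal.coe_one, one_mul, Real.dist_eq]).continuousOn

theorem injOn (h : IsGeodesicOn γ D) : Set.InjOn γ (Set.Icc 0 D) := by
  intro s hs t ht hst
  have := h s hs t ht
  rw [hst, dist_self] at this
  exact sub_eq_zero.1 (abs_eq_zero.1 this.symm)

theorem reverse (h : IsGeodesicOn γ D) : IsGeodesicOn (fun s => γ (D - s)) D := by
  intro s hs t ht
  rw [h (D - s) ⟨sub_nonneg.2 hs.2, sub_le_self _ hs.1⟩ (D - t)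
    ⟨sub_nonneg.2 ht.2, sub_le_self _ ht.1⟩, abs_sub_comm]
  congr 1
  ring

/-- In a tree, a geodesic that starts at the nearest point to `z` can be continued to `z`. -/
theorem dist_right_eq (hX : IsRealTree X) (h : IsGeodesicOn γ D) {z : X} {r : ℝ}
    (hr : r ∈ Set.Icc 0 D) (hmin : ∀ s ∈ Set.Icc 0 D, dist z (γ r) ≤ dist z (γ s)) :
    dist z (γ D) = dist z (γ r) + (D - r) := by
  have hD : D ∈ Set.Icc 0 D := ⟨hr.1.trans hr.2, le_rfl⟩
  rcases eq_or_ne z (γ D) with hz | hz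
  · have h1 := hmin D hD
    rw [← hz, dist_self] at h1
    have h2 : γ r = γ D := (dist_le_zero.1 h1).symm.trans hz
    have h3 := h.injOn hr hD h2
    rw [h3, hz, dist_self]
    ring
  obtain ⟨η, hη0, hη1, hη⟩ := hX.1 z (γ r)
  obtain ⟨ζ, hζ0, hζ1, hζ⟩ := hX.1 z (γ D)
  have hη' : IsGeodesicOn η (dist z (γ r)) := hη
  have hζ' : IsGeodesicOn ζ (dist z (γ D)) := hζ
  set a := dist z (γ r) with ha
  have ha0 : 0 ≤ a := dist_nonneg
  have hrD : 0 ≤ D - r := sub_nonneg.2 hr.2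
  set b := dist z (γ D) with hb
  have hb0 : 0 < b := dist_pos.2 hz
  have hbab : b ≤ a + (D - r) := by
    have h1 := dist_triangle z (γ r) (γ D)
    rw [h r hr D hD, abs_sub_comm, abs_of_nonneg hrD] at h1
    exact h1
  -- The geodesic from `z` to `γ r` followed by `γ` from `r` to `D`. Since `γ r` is nearest to `z`,
  -- this path is injective; uniqueness of arcs then puts `γ r` on the geodesic `ζ`.
  let f : ℝ → X := fun s => if s ≤ a then η s else γ (r + (s - a))
  have hf1 : ∀ s, s ≤ a → f s = η s := fun s hs => if_pos hs
  have hf2 : ∀ s, a ≤ s → f s = γ (r + (s - a)) := by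
    intro s hs
    rcases hs.eq_or_lt with hs | hs
    · rw [hf1 s hs.ge, ← hs, sub_self, add_zero, hη1]
    · exact if_neg (not_le.2 hs)
  have hm2 : ∀ s, a ≤ s → s ≤ a + (D - r) → r + (s - a) ∈ Set.Icc 0 D := fun s hs hs' =>
    ⟨add_nonneg hr.1 (sub_nonneg.2 hs), by linarith⟩
  have hnear : ∀ s ∈ Set.Icc 0 a, ∀ u ∈ Set.Icc 0 D, η s = γ u → s = a ∧ u = r := by
    intro s hs u hu hsu
    have h1 := hmin u hu
    have h2 := hη 0 ⟨le_rfl, ha0⟩ s hs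
    rw [hη0, zero_sub, abs_neg, abs_of_nonneg hs.1, hsu] at h2
    have h3 : s = a := le_antisymm hs.2 (by linarith)
    refine ⟨h3, h.injOn hu hr ?_⟩
    rw [← hsu, h3, hη1]
  have hcont : ContinuousOn f (Set.Icc 0 (a + (D - r))) := by
    have hc1 : ContinuousOn f (Set.Icc 0 a) := hη'.continuousOn.congr fun s hs => hf1 s hs.2
    have hc2 : ContinuousOn f (Set.Icc a (a + (D - r))) := by
      have : ContinuousOn (fun s => γ (r + (s - a))) (Set.Icc a (a + (D - r))) :=
        h.continuousOn.comp (by fun_prop) fun s hs => hm2 s hs.1 hs.2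
      exact this.congr fun s hs => hf2 s hs.1
    rw [← Set.Icc_union_Icc_eq_Icc ha0 (le_add_of_nonneg_right hrD)]
    exact hc1.union_of_isClosed hc2 isClosed_Icc isClosed_Icc
  have hcross : ∀ s ∈ Set.Icc 0 a, ∀ t, a ≤ t → t ≤ a + (D - r) → f s = f t → s = t := by
    intro s hs t ht ht' hst
    rw [hf1 s hs.2, hf2 t ht] at hst
    obtain ⟨h1, h2⟩ := hnear s hs _ (hm2 t ht ht') hst
    linarith
  have hinj : Set.InjOn f (Set.Icc 0 (a + (D - r))) := by
    intro s hs t ht hst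
    rcases le_total s a with hsa | hsa <;> rcases le_total t a with hta | hta
    · rw [hf1 s hsa, hf1 t hta] at hst
      exact hη'.injOn ⟨hs.1, hsa⟩ ⟨ht.1, hta⟩ hst
    · exact hcross s ⟨hs.1, hsa⟩ t hta ht.2 hst
    · exact (hcross t ⟨ht.1, hta⟩ s hsa hs.2 hst.symm).symm
    · rw [hf2 s hsa, hf2 t hta] at hst
      have := h.injOn (hm2 s hsa hs.2) (hm2 t hta ht.2) hst
      linarith
  have himg := HasUniqueArcs.image_Icc_eq (isRealTree_iff.1 hX).2 (hb0.trans_le hbab) hb0 hcont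
    hζ'.continuousOn hinj hζ'.injOn (by rw [hf1 0 ha0, hη0, hζ0])
    (by rw [hf2 _ (le_add_of_nonneg_right hrD), hζ1]; congr 1; ring)
  have hq : γ r ∈ ζ '' Set.Icc 0 b := by
    rw [← himg]
    exact ⟨a, ⟨ha0, le_add_of_nonneg_right hrD⟩, by rw [hf1 a le_rfl, hη1]⟩
  obtain ⟨u, hu, huq⟩ := hq
  have e1 := hζ 0 ⟨le_rfl, hb0.le⟩ u hu
  have e2 := hζ u hu b ⟨hb0.le, le_rfl⟩
  rw [hζ0, huq, zero_sub, abs_neg, abs_of_nonneg hu.1] at e1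
  rw [huq, hζ1, h r hr D hD, abs_sub_comm, abs_of_nonneg hrD, abs_sub_comm,
    abs_of_nonneg (sub_nonneg.2 hu.2)] at e2
  linarith

/-- The point `γ r` is nearest to `z`, and `dist_right_eq` is applied to `γ` and to its reverse. -/
theorem exists_tripod (hX : IsRealTree X) (hD : 0 ≤ D) (h : IsGeodesicOn γ D) (z : X) :
    ∃ r ∈ Set.Icc 0 D, dist z (γ 0) = dist z (γ r) + r ∧
      dist z (γ D) = dist z (γ r) + (D - r) := by
  obtain ⟨r, hr, hmin⟩ := isCompact_Icc.exists_isMinOn (Set.nonempty_Icc.2 hD)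
    (((continuous_const (y := z)).dist continuous_id).comp_continuousOn h.continuousOn)
  refine ⟨r, hr, ?_, h.dist_right_eq hX hr fun s hs => hmin hs⟩
  have := h.reverse.dist_right_eq hX (z := z) (r := D - r)
    ⟨sub_nonneg.2 hr.2, sub_le_self _ hr.1⟩ fun s hs => by
      simpa using hmin (show D - s ∈ Set.Icc 0 D from ⟨sub_nonneg.2 hs.2, sub_le_self _ hs.1⟩)
  simpa using this

end IsGeodesicOn

/-- The distance to a midpoint in a tree. -/
theorem IsRealTree.dist_midpoint_le (hX : IsRealTree X) {x y m : X}
    (hx : dist x m = dist x y / 2) (hy : dist m y = dist x y / 2) {z : X} {R : ℝ}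
    (hzx : dist z x ≤ R) (hzy : dist z y ≤ R) : dist z m ≤ R - dist x y / 2 := by
  obtain ⟨γ, hγ0, hγ1, hγ⟩ := hX.1 x y
  have hγ' : IsGeodesicOn γ (dist x y) := hγ
  set D := dist x y
  have hD : 0 ≤ D := dist_nonneg
  -- The tripod for `m` identifies it with `γ (D / 2)`. The one for `z` shows that the farther
  -- endpoint is at distance `dist z (γ r) + D / 2 + |r - D / 2|`, which exceeds `dist z m` by at
  -- least `D / 2`.
  obtain ⟨q, hq, hq0, hq1⟩ := hγ'.exists_tripod hX hD m
  obtain ⟨r, hr, hr0, hr1⟩ := hγ'.exists_tripod hX hD z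
  rw [hγ0] at hq0 hr0
  rw [hγ1] at hq1 hr1
  rw [dist_comm m x] at hq0
  have hmq : m = γ q := dist_le_zero.1 (by linarith)
  have hq2 : q = D / 2 := by
    rw [hmq, dist_self, ← hmq] at hq0
    linarith
  have t := dist_triangle z (γ r) m
  rw [hmq, hγ' r hr q hq, ← hmq] at t
  rcases abs_cases (r - q) with ⟨h, -⟩ | ⟨h, -⟩ <;> rw [h] at t <;> linarith

end Arcs

/-! ### Asymptotic cones of geodesic and of hyperbolic spaces -/

theorem IsNonprincipal.le_atTop {ω : Ultrafilter ℕ} (h : IsNonprincipal ω) :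
    (ω : Filter ℕ) ≤ atTop := by
  rw [← Nat.cofinite_eq_atTop]
  intro s hs
  by_contra hs'
  exact h sᶜ hs (Ultrafilter.compl_mem_iff_notMem.2 hs')

theorem ScalingSequence.tendsto_atTop (d : ScalingSequence) : Tendsto d atTop atTop :=
  tendsto_atTop_atTop_of_monotone' d.mono d.unbounded

section Cone

variable {X : Type*} [MetricSpace X] {ω : Ultrafilter ℕ} {e : ℕ → X} {d : ScalingSequence}

theorem ConeSeq.tendsto_dist (f g : ConeSeq ω X e d) :
    Tendsto (fun n => dist (f n) (g n) / d n) ω (𝓝 (dist f g)) := f.tendsto g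

theorem ConeSeq.dist_le {f g : ConeSeq ω X e d} {C : ℝ}
    (h : ∀ n, dist (f n) (g n) ≤ C * d n) : dist f g ≤ C :=
  le_of_tendsto' (f.tendsto_dist g) fun n => (div_le_iff₀ (d.pos n)).2 (h n)

theorem ConeSeq.le_dist {f g : ConeSeq ω X e d} {C : ℝ}
    (h : ∀ n, C * d n ≤ dist (f n) (g n)) : C ≤ dist f g :=
  ge_of_tendsto' (f.tendsto_dist g) fun n => (le_div_iff₀ (d.pos n)).2 (h n)

theorem ConeSeq.dist_congr {f g f' g' : ConeSeq ω X e d}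
    (h : ∀ n, dist (f n) (g n) = dist (f' n) (g' n)) : dist f g = dist f' g' :=
  tendsto_nhds_unique (f.tendsto_dist g) (by simpa only [h] using f'.tendsto_dist g')

theorem ConeSeq.dist_midpoint_le (h : IsRealTree (AsymptoticCone ω X e d))
    {x y m z : ConeSeq ω X e d} {R : ℝ} (hxy : dist x y = 1) (hx : dist x m = 1 / 2)
    (hy : dist m y = 1 / 2) (hzx : dist z x ≤ R) (hzy : dist z y ≤ R) : dist z m ≤ R - 1 / 2 := by
  rw [← SeparationQuotient.dist_mk] at hxy hx hy hzx hzy ⊢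
  have := h.dist_midpoint_le (by rw [hx, hxy]) (by rw [hy, hxy]) hzx hzy
  rwa [hxy] at this

/-- Any two points are joined by a discrete geodesic. -/
def HasDiscreteGeodesics (X : Type*) [MetricSpace X] : Prop :=
  ∀ x y : X, ∃ (k : ℕ) (q : ℕ → X), q 0 = x ∧ q k = y ∧
    ∀ i ≤ k, ∀ j ≤ k, dist (q i) (q j) = |(i : ℝ) - j|

theorem HasDiscreteGeodesics.isGeodesicSpace_asymptoticCone (hX : HasDiscreteGeodesics X)
    (hω : IsNonprincipal ω) : IsGeodesicSpace (AsymptoticCone ω X e d) := by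
  intro x y
  obtain ⟨f, rfl⟩ := SeparationQuotient.surjective_mk x
  obtain ⟨g, rfl⟩ := SeparationQuotient.surjective_mk y
  choose ℓ q hq0 hq1 hq using fun n => hX (f n) (g n)
  have hd : Tendsto d ω atTop := d.tendsto_atTop.mono_left hω.le_atTop
  have hℓ : ∀ n, dist (f n) (g n) = ℓ n := by
    intro n
    have h := hq n 0 (Nat.zero_le _) (ℓ n) le_rfl
    rw [hq0, hq1] at h
    simpa using h
  -- The point at time `s` is the `⌊s * d n⌋`-th point of a discrete geodesic, cut off at its end `ℓ
  -- n`. Rounding vanishes in the limit because `d n → ∞` along a non-principal ultrafilter, and the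
  -- cut-off because `s ≤ dist f g`.
  let τ : ℝ → ℕ → ℕ := fun s n => min ⌊s * d n⌋₊ (ℓ n)
  have hτle : ∀ s n, τ s n ≤ ℓ n := fun s n => min_le_right _ _
  have hdiv : ∀ s n, ((τ s n : ℕ) : ℝ) / d n = min ((⌊s * d n⌋₊ : ℝ) / d n) (ℓ n / d n) := by
    intro s n
    simp only [τ, Nat.cast_min]
    exact (min_div_div_right (d.pos n).le _ _).symm
  have hlim : ∀ s ∈ Set.Icc 0 (dist f g),
      Tendsto (fun n => ((τ s n : ℕ) : ℝ) / d n) ω (𝓝 s) := by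
    intro s hs
    simp only [hdiv]
    have h1 := (tendsto_nat_floor_mul_div_atTop hs.1).comp hd
    have h2 := f.tendsto_dist g
    simp only [hℓ] at h2
    have h3 := h1.min h2
    rwa [min_eq_left hs.2] at h3
  obtain ⟨C, hC⟩ := f.bounded
  obtain ⟨C', hC'⟩ := g.bounded
  have hbd : ∀ s, ∃ B, ∀ n, dist (q n (τ s n)) (e n) / d n ≤ B := by
    intro s
    refine ⟨C + C' + C, fun n => ?_⟩
    rw [div_le_iff₀ (d.pos n)]
    have h1 : dist (f n) (e n) ≤ C * d n := (div_le_iff₀ (d.pos n)).1 (hC n)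
    have h2 : dist (g n) (e n) ≤ C' * d n := (div_le_iff₀ (d.pos n)).1 (hC' n)
    have h3 := hq n (τ s n) (hτle s n) 0 (Nat.zero_le _)
    rw [hq0, Nat.cast_zero, sub_zero, abs_of_nonneg (Nat.cast_nonneg _)] at h3
    have h4 : ((τ s n : ℕ) : ℝ) ≤ ℓ n := Nat.cast_le.2 (hτle s n)
    have h5 := dist_triangle_right (f n) (g n) (e n)
    have h6 := dist_triangle (q n (τ s n)) (f n) (e n)
    rw [hℓ] at h5
    linarith
  let γ : ℝ → ConeSeq ω X e d := fun s => ⟨fun n => q n (τ s n), hbd s⟩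
  have hγf : ∀ s ∈ Set.Icc 0 (dist f g), dist (γ s) f = s := by
    intro s hs
    refine tendsto_nhds_unique ((γ s).tendsto_dist f) ?_
    refine (hlim s hs).congr fun n => ?_
    show _ = dist (q n (τ s n)) (f n) / d n
    rw [← hq0 n, hq n _ (hτle s n) 0 (Nat.zero_le _), Nat.cast_zero, sub_zero,
      abs_of_nonneg (Nat.cast_nonneg _)]
  have h0 : (0 : ℝ) ∈ Set.Icc 0 (dist f g) := ⟨le_rfl, dist_nonneg⟩
  have h1 : dist f g ∈ Set.Icc 0 (dist f g) := ⟨dist_nonneg, le_rfl⟩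
  refine ⟨fun s => SeparationQuotient.mk (γ s), ?_, ?_, fun s hs t ht => ?_⟩
  · rw [← dist_eq_zero, SeparationQuotient.dist_mk, hγf 0 h0]
  · rw [← dist_eq_zero, SeparationQuotient.dist_mk, SeparationQuotient.dist_mk]
    refine tendsto_nhds_unique ((γ _).tendsto_dist g) ?_
    have h2 := (f.tendsto_dist g).sub (hlim _ h1)
    rw [sub_self] at h2
    refine h2.congr fun n => ?_
    show _ = dist (q n (τ (dist f g) n)) (g n) / d n
    rw [← hq1 n, hq n _ (hτle _ n) _ le_rfl, hq1 n, hℓ, abs_sub_comm,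
      abs_of_nonneg (sub_nonneg.2 (Nat.cast_le.2 (hτle _ n))), sub_div]
  · rw [SeparationQuotient.dist_mk] at hs ht ⊢
    refine tendsto_nhds_unique ((γ s).tendsto_dist (γ t)) ?_
    refine ((hlim s hs).sub (hlim t ht)).abs.congr fun n => ?_
    show _ = dist (q n (τ s n)) (q n (τ t n)) / d n
    rw [hq n _ (hτle s n) _ (hτle t n), ← sub_div, abs_div, abs_of_pos (d.pos n)]

/-- The asymptotic cone is zero-hyperbolic if the balls of radius `C * d n` are hyperbolic with
constants that are small compared to `d n`. -/
theorem isZeroHyperbolic_asymptoticCone {δ : ℕ → ℝ}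
    (hδ : Tendsto (fun n => δ n / d n) ω (𝓝 0))
    (h : ∀ C : ℝ, ∀ᶠ n in (ω : Filter ℕ), ∀ x y z w : X, dist x (e n) ≤ C * d n →
      dist y (e n) ≤ C * d n → dist z (e n) ≤ C * d n → dist w (e n) ≤ C * d n →
      dist x y + dist z w ≤ max (dist x z + dist y w) (dist x w + dist y z) + δ n) :
    IsZeroHyperbolic (AsymptoticCone ω X e d) := by
  intro x y z w
  obtain ⟨x, rfl⟩ := SeparationQuotient.surjective_mk x
  obtain ⟨y, rfl⟩ := SeparationQuotient.surjective_mk y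
  obtain ⟨z, rfl⟩ := SeparationQuotient.surjective_mk z
  obtain ⟨w, rfl⟩ := SeparationQuotient.surjective_mk w
  simp only [SeparationQuotient.dist_mk]
  have hb : ∀ f : ConeSeq ω X e d, ∃ C, ∀ D, C ≤ D → ∀ n, dist (f n) (e n) ≤ D * d n := by
    intro f
    obtain ⟨C, hC⟩ := f.bounded
    exact ⟨C, fun D hD n => (div_le_iff₀ (d.pos n)).1 ((hC n).trans hD)⟩
  obtain ⟨C₁, h₁⟩ := hb x
  obtain ⟨C₂, h₂⟩ := hb y
  obtain ⟨C₃, h₃⟩ := hb z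
  obtain ⟨C₄, h₄⟩ := hb w
  have hlim := (((x.tendsto_dist z).add (y.tendsto_dist w)).max
    ((x.tendsto_dist w).add (y.tendsto_dist z))).add hδ
  rw [add_zero] at hlim
  refine le_of_tendsto_of_tendsto ((x.tendsto_dist y).add (z.tendsto_dist w)) hlim ?_
  filter_upwards [h (max (max C₁ C₂) (max C₃ C₄))] with n hn
  have := hn (x n) (y n) (z n) (w n) (h₁ _ (by simp) n) (h₂ _ (by simp) n) (h₃ _ (by simp) n)
    (h₄ _ (by simp) n)
  rw [← add_div, ← add_div, ← add_div, max_div_div_right (d.pos n).le, ← add_div]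
  exact div_le_div_of_nonneg_right this (d.pos n).le

end Cone

/-! ### Cones of groups and the choice of the generating set -/

section GroupCone

variable {G : Type*} [Group G]

theorem hasDiscreteGeodesics_wordMetricSpace (S : Set G) (hS : Subgroup.closure S = ⊤) :
    HasDiscreteGeodesics (WordMetricSpace S hS) := by
  intro x y
  change G at x y
  obtain ⟨l, hl, hlS, hlp⟩ := isWordOfLength_wordLength hS (x⁻¹ * y)
  set k := wordLength S (x⁻¹ * y) with hk
  let q : ℕ → G := fun i => x * (l.take i).prod
  have hq0 : q 0 = x := by simp [q]
  have hqk : q k = y := by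
    show x * (l.take k).prod = y
    rw [← hl, List.take_length, hlp, mul_inv_cancel_left]
  have hle : ∀ i j, i ≤ j → wordLength S ((q i)⁻¹ * q j) ≤ j - i := by
    intro i j hij
    have h1 : (q i)⁻¹ * q j = ((l.drop i).take (j - i)).prod := by
      show (x * (l.take i).prod)⁻¹ * (x * (l.take j).prod) = _
      obtain ⟨m, rfl⟩ := Nat.exists_eq_add_of_le hij
      rw [List.take_add, List.prod_append, Nat.add_sub_cancel_left]
      group
    rw [h1]
    refine (wordLength_le ⟨_, rfl, fun a ha => ?_, rfl⟩).trans (List.length_take_le _ _)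
    exact hlS a (List.mem_of_mem_drop (List.mem_of_mem_take ha))
  have heq : ∀ i j, i ≤ j → j ≤ k → ((wordLength S ((q i)⁻¹ * q j) : ℕ) : ℝ) = |(i : ℝ) - j| := by
    intro i j hij hjk
    have h1 := hle 0 i (Nat.zero_le _)
    have h2 := hle i j hij
    have h3 := hle j k hjk
    have h4 := wordLength_triangle hS (q 0) (q i) (q k)
    have h5 := wordLength_triangle hS (q i) (q j) (q k)
    rw [hq0, hqk] at h4
    rw [hqk] at h5 h3
    rw [hq0] at h1
    have h6 : wordLength S ((q i)⁻¹ * q j) = j - i := by omega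
    rw [h6, Nat.cast_sub hij, abs_sub_comm, abs_of_nonneg (sub_nonneg.2 (Nat.cast_le.2 hij))]
  refine ⟨k, q, hq0, hqk, fun i hi j hj => ?_⟩
  show ((wordLength S ((q i)⁻¹ * q j) : ℕ) : ℝ) = _
  rcases le_total i j with hij | hij
  · exact heq i j hij hj
  · rw [wordLength_symm hS, heq j i hij hi, abs_sub_comm]

theorem isGeodesicSpace_groupAsymptoticCone (S : Set G) (hS : Subgroup.closure S = ⊤)
    {ω : Ultrafilter ℕ} (hω : IsNonprincipal ω) (d : ScalingSequence) :
    IsGeodesicSpace (GroupAsymptoticCone S hS ω d) :=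
  (hasDiscreteGeodesics_wordMetricSpace S hS).isGeodesicSpace_asymptoticCone hω

theorem exists_wordLength_le_mul {S S' : Set G} (hS : Subgroup.closure S = ⊤)
    (hS' : Subgroup.closure S' = ⊤) (hfin : S'.Finite) :
    ∃ C : ℕ, ∀ g, wordLength S g ≤ C * wordLength S' g := by
  obtain ⟨C, hC⟩ := (hfin.image (wordLength S)).bddAbove
  refine ⟨C, fun g => ?_⟩
  obtain ⟨l, hl, hlS, hlp⟩ := isWordOfLength_wordLength hS' g
  rw [← hl, ← hlp]
  clear hl hlp
  induction l with
  | nil => simp [wordLength_one]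
  | cons a l ih =>
    rw [List.prod_cons, List.length_cons, mul_add, mul_one, add_comm]
    refine (wordLength_mul_le hS _ _).trans (add_le_add ?_ (ih fun x hx => hlS x (by simp [hx])))
    rcases hlS a (by simp) with h | h
    · exact hC ⟨a, h, rfl⟩
    · rw [← wordLength_inv hS]
      exact hC ⟨a⁻¹, h, rfl⟩

/-- The asymptotic cones for two finite generating sets are related by a Lipschitz injection. -/
theorem exists_injective_groupAsymptoticCone {S S' : Set G} (hS : Subgroup.closure S = ⊤)
    (hS' : Subgroup.closure S' = ⊤) (hfin : S.Finite) (hfin' : S'.Finite) (ω : Ultrafilter ℕ)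
    (d : ScalingSequence) :
    ∃ φ : C(GroupAsymptoticCone S' hS' ω d, GroupAsymptoticCone S hS ω d),
      Function.Injective φ := by
  obtain ⟨C, hC⟩ := exists_wordLength_le_mul hS hS' hfin'
  obtain ⟨C', hC'⟩ := exists_wordLength_le_mul hS' hS hfin
  let ψ : ConeSeq ω (WordMetricSpace S' hS') (fun _ => WordMetricSpace.of 1) d →
      ConeSeq ω (WordMetricSpace S hS) (fun _ => WordMetricSpace.of 1) d := fun f =>
    ⟨f.toFun, by
      obtain ⟨B, hB⟩ := f.bounded
      refine ⟨C * B, fun n => ?_⟩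
      have h2 := hB n
      rw [div_le_iff₀ (d.pos n)] at h2 ⊢
      have h1 : (wordLength S ((show G from f.toFun n)⁻¹ * 1) : ℝ) ≤
        C * wordLength S' ((show G from f.toFun n)⁻¹ * 1) := by exact_mod_cast hC _
      rw [mul_assoc]
      exact h1.trans (mul_le_mul_of_nonneg_left h2 (Nat.cast_nonneg _))⟩
  have hψ : ∀ f g, dist (ψ f) (ψ g) ≤ C * dist f g := by
    intro f g
    refine le_of_tendsto_of_tendsto' ((ψ f).tendsto_dist (ψ g))
      ((f.tendsto_dist g).const_mul (C : ℝ)) fun n => ?_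
    rw [← mul_div_assoc]
    refine div_le_div_of_nonneg_right ?_ (d.pos n).le
    show (wordLength S ((show G from f.toFun n)⁻¹ * (show G from g.toFun n)) : ℝ) ≤
      C * wordLength S' ((show G from f.toFun n)⁻¹ * (show G from g.toFun n))
    exact_mod_cast hC _
  have hψ' : ∀ f g, dist f g ≤ C' * dist (ψ f) (ψ g) := by
    intro f g
    refine le_of_tendsto_of_tendsto' (f.tendsto_dist g)
      (((ψ f).tendsto_dist (ψ g)).const_mul (C' : ℝ)) fun n => ?_
    rw [← mul_div_assoc]
    refine div_le_div_of_nonneg_right ?_ (d.pos n).le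
    show (wordLength S' ((show G from f.toFun n)⁻¹ * (show G from g.toFun n)) : ℝ) ≤
      C' * wordLength S ((show G from f.toFun n)⁻¹ * (show G from g.toFun n))
    exact_mod_cast hC' _
  choose rep hrep using
    SeparationQuotient.surjective_mk
      (X := ConeSeq ω (WordMetricSpace S' hS') (fun _ => WordMetricSpace.of 1) d)
  have hdist : ∀ x y, dist (rep x) (rep y) = dist x y := by
    intro x y
    rw [← SeparationQuotient.dist_mk, hrep, hrep]
  refine ⟨⟨fun x => SeparationQuotient.mk (ψ (rep x)), ?_⟩, fun x y hxy => ?_⟩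
  · refine (LipschitzWith.of_dist_le_mul (K := C) fun x y => ?_).continuous
    rw [SeparationQuotient.dist_mk, ← hdist x y, NNReal.coe_natCast]
    exact hψ _ _
  · have h1 : dist (ψ (rep x)) (ψ (rep y)) = 0 := by
      rw [← SeparationQuotient.dist_mk, dist_eq_zero]
      exact hxy
    have h2 := hψ' (rep x) (rep y)
    rw [h1, mul_zero, hdist] at h2
    exact dist_le_zero.1 h2

/-- Geodesics exist in every cone of a group, so only uniqueness of arcs has to be transferred, and
it pulls back along a continuous injection. -/
theorem IsRealTree.groupAsymptoticCone {S S' : Set G} {hS : Subgroup.closure S = ⊤}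
    {hS' : Subgroup.closure S' = ⊤} (hfin : S.Finite) (hfin' : S'.Finite) {ω : Ultrafilter ℕ}
    (hω : IsNonprincipal ω) {d : ScalingSequence} (h : IsRealTree (GroupAsymptoticCone S hS ω d)) :
    IsRealTree (GroupAsymptoticCone S' hS' ω d) := by
  obtain ⟨φ, hφ⟩ := exists_injective_groupAsymptoticCone hS hS' hfin hfin' ω d
  exact isRealTree_iff.2 ⟨isGeodesicSpace_groupAsymptoticCone S' hS' hω d,
    (isRealTree_iff.1 h).2.of_injective φ hφ⟩

/-! ### Cones that are not trees -/

/-- The smallest `R` such that some conjugate of `F` lies in the ball of radius `R`. -/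
noncomputable def conjugationRadius (S : Set G) (F : Subgroup G) : ℕ :=
  sInf {R | ∃ x : G, ∀ f ∈ F, wordLength S (x⁻¹ * f * x) ≤ R}

section ConjugationRadius

variable {S : Set G} {F F' : Subgroup G}

theorem conjugationRadius_nonempty (S : Set G) (F : Subgroup G) [Finite F] :
    {R | ∃ x : G, ∀ f ∈ F, wordLength S (x⁻¹ * f * x) ≤ R}.Nonempty := by
  obtain ⟨B, hB⟩ := ((Set.toFinite (F : Set G)).image (wordLength S)).bddAbove
  exact ⟨B, 1, fun f hf => by simpa using hB ⟨f, hf, rfl⟩⟩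

theorem exists_wordLength_conj_le (S : Set G) (F : Subgroup G) [Finite F] :
    ∃ x : G, ∀ f ∈ F, wordLength S (x⁻¹ * f * x) ≤ conjugationRadius S F :=
  Nat.sInf_mem (conjugationRadius_nonempty S F)

theorem conjugationRadius_mono [Finite F'] (h : F ≤ F') :
    conjugationRadius S F ≤ conjugationRadius S F' := by
  obtain ⟨x, hx⟩ := exists_wordLength_conj_le S F'
  exact Nat.sInf_le ⟨x, fun f hf => hx f (h hf)⟩

theorem exists_le_wordLength_conj (S : Set G) (F : Subgroup G) (x : G) :
    ∃ f ∈ F, conjugationRadius S F ≤ wordLength S (x⁻¹ * f * x) := by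
  rcases Nat.eq_zero_or_pos (conjugationRadius S F) with h | h
  · exact ⟨1, F.one_mem, by rw [h]; exact Nat.zero_le _⟩
  by_contra! hlt
  have : conjugationRadius S F ≤ conjugationRadius S F - 1 :=
    Nat.sInf_le ⟨x, fun f hf => Nat.le_sub_one_of_lt (hlt f hf)⟩
  omega

theorem conjugationRadius_pos (hS : Subgroup.closure S = ⊤) [Finite F] (hF : F ≠ ⊥) :
    0 < conjugationRadius S F := by
  rw [Nat.pos_iff_ne_zero]
  intro h
  obtain ⟨x, hx⟩ := exists_wordLength_conj_le S F
  refine hF ((Subgroup.eq_bot_iff_forall F).2 fun f hf => ?_)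
  have h1 := eq_one_of_wordLength_eq_zero hS (Nat.le_zero.1 (h ▸ hx f hf))
  have h2 : f * x = x := by rwa [mul_assoc, inv_mul_eq_one, eq_comm] at h1
  exact mul_eq_right.1 h2

theorem card_le_of_conjugationRadius_le (hS : Subgroup.closure S = ⊤) (hfin : S.Finite) [Finite F]
    {R : ℕ} (h : conjugationRadius S F ≤ R) :
    Nat.card F ≤ Nat.card {g : G | wordLength S g ≤ R} := by
  have := (finite_ball hS hfin R).to_subtype
  obtain ⟨x, hx⟩ := exists_wordLength_conj_le S F
  refine Nat.card_le_card_of_injective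
    (fun f : F => (⟨x⁻¹ * f * x, (hx f f.2).trans h⟩ : {g : G | wordLength S g ≤ R}))
    fun f g hfg => ?_
  have := congrArg Subtype.val hfg
  exact Subtype.ext (mul_left_cancel (mul_right_cancel this))

end ConjugationRadius

/-- If `G` has an increasing sequence of finite subgroups of unbounded orders, then some of its
asymptotic cones are not trees. -/
theorem exists_not_isRealTree {S : Set G} (hS : Subgroup.closure S = ⊤) (hfin : S.Finite)
    (F : ℕ → Subgroup G) (hF : ∀ n, Finite (F n)) (hF0 : ∀ n, F n ≠ ⊥) (hmono : Monotone F)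
    (hcard : ∀ k, ∃ n, k < Nat.card (F n)) :
    ∃ d : ScalingSequence, ∀ ω : Ultrafilter ℕ, IsNonprincipal ω →
      ¬ IsRealTree (GroupAsymptoticCone S hS ω d) := by
  let r : ℕ → ℕ := fun n => conjugationRadius S (F n)
  -- The radii are unbounded: a finite ball cannot contain conjugates of subgroups of arbitrarily
  -- large order.
  obtain ⟨d, hd⟩ : ∃ d : ScalingSequence, ∀ n, d n = (r n : ℝ) := by
    refine ⟨⟨fun n => r n, fun n => Nat.cast_pos.2 (conjugationRadius_pos hS (hF0 n)),
      fun m n hmn => Nat.cast_le.2 (conjugationRadius_mono (hmono hmn)), ?_⟩, fun n => rfl⟩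
    rintro ⟨B, hB⟩
    obtain ⟨R, hR⟩ := exists_nat_ge B
    obtain ⟨n, hn⟩ := hcard (Nat.card {g : G | wordLength S g ≤ R})
    refine hn.not_ge (card_le_of_conjugationRadius_le hS hfin ?_)
    have h1 : (r n : ℝ) ≤ R := (hB ⟨n, rfl⟩).trans hR
    exact_mod_cast h1
  refine ⟨d, fun ω hω htree => ?_⟩
  choose x hx using fun n => exists_wordLength_conj_le S (F n)
  have hpt : ∀ (h : ℕ → G) (C : ℝ), (∀ n, (wordLength S (h n) : ℝ) ≤ C * r n) →
      ∃ f : ConeSeq ω (WordMetricSpace S hS) (fun _ => WordMetricSpace.of 1) d,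
        ∀ n, f n = WordMetricSpace.of (h n) := by
    intro h C hC
    refine ⟨⟨fun n => WordMetricSpace.of (h n), C, fun n => ?_⟩, fun n => rfl⟩
    rw [div_le_iff₀ (d.pos n), WordMetricSpace.dist_of, mul_one, wordLength_inv hS, hd]
    exact hC n
  -- In the conjugate of `F n` by the optimal `x n`, some element `f' n` has length exactly `r n`;
  -- it gives a point `b` at distance `1` from the base point `o`.
  choose f hfF hf using fun n => exists_le_wordLength_conj S (F n) (x n)
  let f' : ℕ → G := fun n => (x n)⁻¹ * f n * x n
  have hf' : ∀ n, wordLength S (f' n) = r n := fun n => le_antisymm (hx n _ (hfF n)) (hf n)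
  obtain ⟨o, ho⟩ := hpt (fun _ => 1) 0 fun n => by simp [wordLength_one]
  obtain ⟨b, hb⟩ := hpt f' 1 fun n => by rw [hf', one_mul]
  have hob : dist o b = 1 := by
    refine le_antisymm (ConeSeq.dist_le fun n => ?_) (ConeSeq.le_dist fun n => ?_) <;>
    simp only [ho, hb, WordMetricSpace.dist_of, inv_one, one_mul, hf', hd, le_refl]
  obtain ⟨γ, hγ0, hγ1, hγ⟩ := htree.1 (SeparationQuotient.mk o) (SeparationQuotient.mk b)
  rw [SeparationQuotient.dist_mk, hob] at hγ1 hγ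
  obtain ⟨m, hm⟩ := SeparationQuotient.surjective_mk (γ (1 / 2))
  have hom : dist o m = 1 / 2 := by
    rw [← SeparationQuotient.dist_mk, hm, ← hγ0, hγ 0 (by norm_num) (1 / 2) (by norm_num)]
    norm_num
  have hmb : dist m b = 1 / 2 := by
    rw [← SeparationQuotient.dist_mk, hm, ← hγ1, hγ (1 / 2) (by norm_num) 1 (by norm_num)]
    norm_num
  obtain ⟨m', hm'⟩ : ∃ m' : ℕ → G, ∀ n, m n = WordMetricSpace.of (m' n) :=
    ⟨fun n => m n, fun n => rfl⟩
  -- Minimality of `r n` is now applied to the conjugator `x n * m' n`: some element of the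
  -- conjugated subgroup moves the midpoint `m` by at least `r n`.
  choose g hgF hg using fun n => exists_le_wordLength_conj S (F n) (x n * m' n)
  let g' : ℕ → G := fun n => (x n)⁻¹ * g n * x n
  have hg' : ∀ n, wordLength S (g' n) ≤ r n := fun n => hx n _ (hgF n)
  have hgf : ∀ n, wordLength S (g' n * f' n) ≤ r n := fun n => by
    have := hx n _ ((F n).mul_mem (hgF n) (hfF n))
    rwa [show (x n)⁻¹ * (g n * f n) * x n = g' n * f' n by simp only [g', f']; group] at this
  have hfg : ∀ n, wordLength S ((f' n)⁻¹ * g' n) ≤ r n := fun n => by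
    have := hx n _ ((F n).mul_mem ((F n).inv_mem (hfF n)) (hgF n))
    rwa [show (x n)⁻¹ * ((f n)⁻¹ * g n) * x n = (f' n)⁻¹ * g' n by
      simp only [g', f']; group] at this
  have hfgf : ∀ n, wordLength S ((f' n)⁻¹ * (g' n * f' n)) ≤ r n := fun n => by
    have := hx n _ ((F n).mul_mem ((F n).inv_mem (hfF n)) ((F n).mul_mem (hgF n) (hfF n)))
    rwa [show (x n)⁻¹ * ((f n)⁻¹ * (g n * f n)) * x n = (f' n)⁻¹ * (g' n * f' n) by
      simp only [g', f']; group] at this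
  have hconj : ∀ n, r n ≤ wordLength S ((g' n * m' n)⁻¹ * m' n) := fun n => by
    rw [wordLength_symm hS]
    have := hg n
    rwa [show (x n * m' n)⁻¹ * g n * (x n * m' n) = (m' n)⁻¹ * (g' n * m' n) by
      simp only [g']; group] at this
  obtain ⟨C, hC⟩ := m.bounded
  -- The points `u`, `v`, `w` are the translates of `o`, `b`, `m` by `g'`. Both `o` and `b` are
  -- within `1` of both `u` and `v`, as all four come from the conjugated subgroup.
  obtain ⟨u, hu⟩ := hpt g' 1 fun n => by rw [one_mul]; exact_mod_cast hg' n
  obtain ⟨v, hv⟩ := hpt (fun n => g' n * f' n) 1 fun n => by rw [one_mul]; exact_mod_cast hgf n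
  obtain ⟨w, hw⟩ := hpt (fun n => g' n * m' n) (1 + C) fun n => by
    have h1 := hC n
    rw [div_le_iff₀ (d.pos n), hm', WordMetricSpace.dist_of, mul_one, wordLength_inv hS, hd] at h1
    have h2 : (wordLength S (g' n * m' n) : ℝ) ≤ wordLength S (g' n) + wordLength S (m' n) := by
      exact_mod_cast wordLength_mul_le hS _ _
    have h3 : (wordLength S (g' n) : ℝ) ≤ r n := by exact_mod_cast hg' n
    linarith
  have huw : dist u w = 1 / 2 := by
    rw [← hom]
    refine ConeSeq.dist_congr fun n => ?_
    rw [hu, hw, ho, hm', WordMetricSpace.dist_of, WordMetricSpace.dist_of]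
    congr 2
    group
  have hwv : dist w v = 1 / 2 := by
    rw [← hmb]
    refine ConeSeq.dist_congr fun n => ?_
    rw [hv, hw, hb, hm', WordMetricSpace.dist_of, WordMetricSpace.dist_of]
    congr 2
    group
  have huv : dist u v = 1 := by
    rw [← hob]
    refine ConeSeq.dist_congr fun n => ?_
    rw [hu, hv, ho, hb, WordMetricSpace.dist_of, WordMetricSpace.dist_of]
    congr 2
    group
  have hle : ∀ {s t : ConeSeq ω (WordMetricSpace S hS) (fun _ => WordMetricSpace.of 1) d}
      {s' t' : ℕ → G}, (∀ n, s n = WordMetricSpace.of (s' n)) →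
      (∀ n, t n = WordMetricSpace.of (t' n)) →
      (∀ n, wordLength S ((s' n)⁻¹ * t' n) ≤ r n) → dist s t ≤ 1 := by
    intro s t s' t' hs ht h
    refine ConeSeq.dist_le fun n => ?_
    rw [hs, ht, WordMetricSpace.dist_of, one_mul, hd]
    exact_mod_cast h n
  have hou : dist o u ≤ 1 := hle ho hu fun n => by simpa using hg' n
  have hov : dist o v ≤ 1 := hle ho hv fun n => by simpa using hgf n
  have hbu : dist b u ≤ 1 := hle hb hu hfg
  have hbv : dist b v ≤ 1 := hle hb hv hfgf
  have hwm : 1 ≤ dist w m := ConeSeq.le_dist fun n => by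
    rw [hw, hm', WordMetricSpace.dist_of, one_mul, hd]
    exact_mod_cast hconj n
  -- The midpoint `w` of `u`, `v` is within `1/2` of `o` and of `b`; the midpoint `m` of `o`, `b` is
  -- then at distance `0` from `w`, contrary to `hwm`.
  have how := ConeSeq.dist_midpoint_le htree huv huw hwv hou hov
  have hbw := ConeSeq.dist_midpoint_le htree huv huw hwv hbu hbv
  rw [dist_comm] at how hbw
  have := ConeSeq.dist_midpoint_le htree hob hom hmb how hbw
  linarith

end GroupCone

/-! ### The cones of `G(p, c)` -/

/-- If the balls of a group are hyperbolic with constants that grow slowly compared to the radii,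
then all its asymptotic cones for a suitable scaling sequence are trees. -/
theorem exists_isRealTree_groupAsymptoticCone {G : Type*} [Group G] {S : Set G}
    (hS : Subgroup.closure S = ⊤) {δ : ℕ → ℕ} (hmono : Monotone δ)
    (h : ∀ n : ℕ, ∀ x y z w : G,
      wordLength S x ≤ (n + 1) * ((n + 1) * (δ n + 1)) →
      wordLength S y ≤ (n + 1) * ((n + 1) * (δ n + 1)) →
      wordLength S z ≤ (n + 1) * ((n + 1) * (δ n + 1)) →
      wordLength S w ≤ (n + 1) * ((n + 1) * (δ n + 1)) → FourPoint S (δ n) x y z w) :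
    ∃ d : ScalingSequence, ∀ ω : Ultrafilter ℕ, IsNonprincipal ω →
      IsRealTree (GroupAsymptoticCone S hS ω d) := by
  -- With this choice `δ n / d n ≤ 1 / (n + 1)` tends to `0`, while the radius `(n + 1) * d n`
  -- eventually exceeds every `C * d n`.
  obtain ⟨d, hd⟩ : ∃ d : ScalingSequence, ∀ n : ℕ, d n = ((n + 1) * (δ n + 1) : ℝ) := by
    refine ⟨⟨fun n => (n + 1) * (δ n + 1), fun n => by positivity, fun m n hmn => ?_, ?_⟩,
      fun n => rfl⟩
    · have h1 : (m : ℝ) ≤ n := Nat.cast_le.2 hmn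
      have h2 : (δ m : ℝ) ≤ δ n := Nat.cast_le.2 (hmono hmn)
      exact mul_le_mul (by linarith) (by linarith) (by positivity) (by positivity)
    · rintro ⟨B, hB⟩
      obtain ⟨n, hn⟩ := exists_nat_ge B
      have h1 : ((n : ℝ) + 1) * (δ n + 1) ≤ B := hB ⟨n, rfl⟩
      have h2 : ((n : ℝ) + 1) * 1 ≤ (n + 1) * (δ n + 1) :=
        mul_le_mul_of_nonneg_left (by simp) (by positivity)
      linarith
  refine ⟨d, fun ω hω => ?_⟩
  refine IsZeroHyperbolic.isRealTree
    (isZeroHyperbolic_asymptoticCone (δ := fun n => (δ n : ℝ)) ?_ fun C => ?_)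
    (isGeodesicSpace_groupAsymptoticCone S hS hω d)
  · refine squeeze_zero (fun n => div_nonneg (Nat.cast_nonneg _) (d.pos n).le) (fun n => ?_)
      ((tendsto_one_div_add_atTop_nhds_zero_nat (𝕜 := ℝ)).mono_left hω.le_atTop)
    rw [hd, div_le_div_iff₀ (by positivity) (by positivity)]
    have : (0 : ℝ) ≤ n + 1 := by positivity
    linarith
  · obtain ⟨N, hN⟩ := exists_nat_ge C
    filter_upwards [hω.le_atTop (eventually_ge_atTop N)] with n hn x y z w hx hy hz hw
    have key : ∀ x : WordMetricSpace S hS, dist x (WordMetricSpace.of 1) ≤ C * d n →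
        wordLength S (show G from x) ≤ (n + 1) * ((n + 1) * (δ n + 1)) := by
      intro x hx
      have h1 : (wordLength S (show G from x) : ℝ) ≤ C * d n := by
        have h2 : dist x (WordMetricSpace.of 1) = wordLength S ((show G from x)⁻¹ * 1) := rfl
        rwa [h2, mul_one, wordLength_inv hS] at hx
      have h3 : C ≤ n + 1 := by
        have : (N : ℝ) ≤ n := Nat.cast_le.2 hn
        linarith
      have h4 := h1.trans (mul_le_mul_of_nonneg_right h3 (d.pos n).le)
      rw [hd] at h4
      exact_mod_cast h4
    have h1 := h n _ _ _ _ (key x hx) (key y hy) (key z hz) (key w hw)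
    unfold FourPoint at h1
    have h2 := (Nat.cast_le (α := ℝ)).2 h1
    push_cast at h2
    exact h2

namespace LocalModel

theorem exists_not_isRealTree {p : ℕ} (hp : p.Prime) {c : ℕ+ → ℕ+} {A : Type} [Group A]
    (M : LocalModel p c Set.univ A) {S : Set M.Ext} (hS : Subgroup.closure S = ⊤)
    (hfin : S.Finite) :
    ∃ d : ScalingSequence, ∀ ω : Ultrafilter ℕ, IsNonprincipal ω →
      ¬ IsRealTree (GroupAsymptoticCone S hS ω d) := by
  have hW : ∀ n : ℕ, Finite (M.window 0 (n + 1)) := fun n => M.finite_window_univ hp _ _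
  have hinl : Function.Injective (SemidirectProduct.inl : A →* M.Ext) :=
    SemidirectProduct.inl_injective
  -- The windows end at `n + 1` so that even the first one contains two different generators and is
  -- nontrivial.
  refine _root_.exists_not_isRealTree hS hfin
    (fun n : ℕ => (M.window 0 (n + 1)).map SemidirectProduct.inl) (fun n => ?_) (fun n => ?_)
    (fun m n hmn => Subgroup.map_mono (M.window_mono le_rfl (by omega))) fun k => ⟨k, ?_⟩
  · exact Finite.of_equiv _ ((M.window 0 (n + 1)).equivMapOfInjective _ hinl).toEquiv
  · rw [Ne, Subgroup.map_eq_bot_iff_of_injective _ hinl, Subgroup.eq_bot_iff_forall]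
    intro h
    have h0 := h _ (M.gen_mem_window (i := 0) ⟨le_rfl, by omega⟩)
    have h1 := h _ (M.gen_mem_window (i := 1) ⟨by omega, by omega⟩)
    exact absurd (M.gen_injective hp (h0.trans h1.symm)) (by norm_num)
  · rw [← Nat.card_congr ((M.window 0 (k + 1)).equivMapOfInjective _ hinl).toEquiv]
    have := Nat.card_le_card_of_injective (α := Fin (k + 1)) (β := M.window 0 (k + 1))
      (fun i => ⟨M.gen (i : ℕ), M.gen_mem_window ⟨by omega, by omega⟩⟩) fun i j hij => by
        have := M.gen_injective hp (congrArg Subtype.val hij)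
        exact Fin.ext (by exact_mod_cast this)
    rwa [Nat.card_fin] at this

end LocalModel

theorem theorem3p25 (p : ℕ) (hp : p.Prime) :
    (∀ c : ℕ+ → ℕ+, Monotone c →
      IsTwoGenerated (GroupG p c) ∧
      IsLocallyNilpotentPGroupByInfiniteCyclic p (GroupG p c) ∧
      IsElementaryAmenable (GroupG p c) ∧
      IsAmenableGroup (GroupG p c) ∧
      (∃ f : GroupG p c →* WreathZModInt p, Function.Surjective f) ∧
      ¬ IsVirtuallyCyclic (GroupG p c) ∧
      IsResiduallyFinitePGroup p (GroupG p c) ∧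
      IsResiduallyNilpotent (GroupG p c)) ∧
    ∃ c : ℕ+ → ℕ+, Monotone c ∧
      (∃ d : ScalingSequence, ∀ ω : Ultrafilter ℕ, IsNonprincipal ω →
        ∀ (S : Set (GroupG p c)) (hS : Subgroup.closure S = ⊤), S.Finite →
          IsRealTree (GroupAsymptoticCone S hS ω d)) ∧
      ∀ (S : Set (GroupG p c)) (hS : Subgroup.closure S = ⊤), S.Finite →
        ∃ (ω₁ ω₂ : Ultrafilter ℕ) (d₁ d₂ : ScalingSequence),
          IsNonprincipal ω₁ ∧ IsNonprincipal ω₂ ∧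
          IsEmpty (GroupAsymptoticCone S hS ω₁ d₁ ≃ₜ GroupAsymptoticCone S hS ω₂ d₂) := by
  refine ⟨fun c _ => ?_, ?_⟩
  · let M := LocalModel.groupA p c
    have hres : IsResiduallyFinitePGroup p (GroupG p c) := M.isResiduallyFinitePGroup hp
    exact ⟨⟨M.base, M.stable, M.closure_base_stable⟩, M.isLocallyNilpotentPGroupByInfiniteCyclic hp,
      M.isElementaryAmenable hp, M.isAmenableGroup hp, M.exists_surjective_wreath hp,
      M.not_isVirtuallyCyclic hp, hres, hres.isResiduallyNilpotent hp⟩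
  obtain ⟨c, hc, δ, hδ, h⟩ := LocalModel.exists_lacunary hp
  let M := LocalModel.groupA p c
  obtain ⟨d, hd⟩ := exists_isRealTree_groupAsymptoticCone M.closure_base_stable hδ h
  have htree : ∀ ω : Ultrafilter ℕ, IsNonprincipal ω →
      ∀ (S : Set (GroupG p c)) (hS : Subgroup.closure S = ⊤), S.Finite →
        IsRealTree (GroupAsymptoticCone S hS ω d) := fun ω hω S hS hfin =>
    (hd ω hω).groupAsymptoticCone M.finite_gens hfin hω
  refine ⟨c, hc, ⟨d, htree⟩, fun S hS hfin => ?_⟩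
  obtain ⟨d₂, hd₂⟩ := M.exists_not_isRealTree hp hS hfin
  have hω : IsNonprincipal (hyperfilter ℕ) := fun s hs => notMem_hyperfilter_of_finite hs
  -- One ultrafilter serves for both cones. A homeomorphism would transport uniqueness of arcs from
  -- the tree to the second cone, which is geodesic anyway and would thus be a tree.
  refine ⟨hyperfilter ℕ, hyperfilter ℕ, d, d₂, hω, hω, ⟨fun e => hd₂ _ hω ?_⟩⟩
  exact isRealTree_iff.2 ⟨isGeodesicSpace_groupAsymptoticCone S hS hω d₂,
    (isRealTree_iff.1 (htree _ hω S hS hfin)).2.of_injective ⟨e.symm, e.symm.continuous⟩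
      e.symm.injective⟩
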